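/- Let $(\Omega,\mathcal F,\mathbb P)$ be a standard probability space, i.e. there is a random variable $V:\Omega\to(0,1)$, uniformly distributed under $\mathbb P$, with $\sigma(V)=\mathcal F$. Let $\mathcal C$ be a convex subset of a real vector space and let $B_0(\mathcal C)$ be the set of simple acts, i.e. finite-valued $\mathcal F$-measurable maps $f:\Omega\to\mathcal C$; outcomes $x\in\mathcal C$ are identified with constant acts, and convex combinations of acts are formed statewise. Let $\succsim$ be a preference relation on $B_0(\mathcal C)$, i.e. a complete and transitive relation, with asymmetric part $\succ$ and symmetric part $\sim$, for which $\mathbb P$-almost surely equal acts are identified (so $f=g$ $\mathbb P$-a.s. implies $f\sim g$). Call $f,g\in B_0(\mathcal C)$ disco (disappointment-concordant) if $\{\omega: f(\omega)\prec f\}=\{\omega: g(\omega)\prec g\}$. For probability measures $P,Q$ on $(\Omega,\mathcal F)$, $\alpha\in(0,1)$ and a bounded random variable $X$, let $$\mathrm{Ex}_\alpha^{P,Q}(X)=\inf\{y\in\mathbb R:\ \alpha\,\mathbb E^P[(X-y)_+]=(1-\alpha)\,\mathbb E^Q[(y-X)_+]\};$$ if $P$ and $Q$ are mutually absolutely continuous,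 this is the unique $y$ that satisfies the equation. Then the following are equivalent. (i) $\succsim$ satisfies all of the following axioms. - AA-SM (strict monotonicity): if $f,g\in B_0(\mathcal C)$ and $f(\omega)\succsim g(\omega)$ for all $\omega\in\Omega$, then $f\succsim g$, and if moreover $\mathbb P(\{\omega: f(\omega)\succ g(\omega)\})>0$, then $f\succ g$. - Independence: if $x,y,z\in\mathcal C$, $\lambda\in(0,1]$ and $x\succ y$, then $\lambda x+(1-\lambda)z\succ\lambda y+(1-\lambda)z$. - Archimedean continuity: if $f,g,h\in B_0(\mathcal C)$ and $f\succ g\succ h$, then there are $a,b\in(0,1)$ with $a f+(1-a)h\succ g\succ b f+(1-b)h$. - AA disco aversion: if $f,g,h\in B_0(\mathcal C)$, $f$ and $g$ are disco and $g\sim h$, then $a f+(1-a)h\succsim a f+(1-a)g$ for all $a\in(0,1)$. - Non-degeneracy: $f\succ g$ for some $f,g\in B_0(\mathcal C)$. - Monotone continuity: if $x,y,z\in\mathcal C$, $x\succ y$, and $A_1\supseteq A_2\supseteq\cdots$ are events in $\mathcal F$ with $\bigcap_n A_n=\varnothing$, then $z\mathbf 1_{A_n}+x\mathbf 1_{A_n^c}\succ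 y$ for some $n$. (ii) There are a non-constant affine function $u:\mathcal C\to\mathbb R$, probability measures $P,Q$ on $(\Omega,\mathcal F)$ and $\alpha\in(0,1/2]$ such that $P$, $Q$ and $\mathbb P$ are mutually absolutely continuous, $\alpha P\le(1-\alpha)Q$ (on every event), and for all $f,g\in B_0(\mathcal C)$ $$f\succsim g\iff \mathrm{Ex}_\alpha^{P,Q}(u(f))\ge\mathrm{Ex}_\alpha^{P,Q}(u(g)).$$ Moreover, $P$, $Q$ and $\alpha$ in (ii) are unique and $u$ is cardinally unique: if $(u,P,Q,\alpha)$ is as in (ii), then $(u',P',Q',\alpha')$ is as in (ii) if and only if $P'=P$, $Q'=Q$, $\alpha'=\alpha$ and $u'=au+b$ for some $a>0$ and $b\in\mathbb R$. -/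

import Mathlib

open MeasureTheory

noncomputable section

namespace DuetExpectile

/-- A standard probability space: there is a random variable `V` with values in `(0,1)`, uniformly
distributed under `μ`, that generates the whole `σ`-algebra of `Ω`. -/
def IsStandardSpace {Ω : Type*} [mΩ : MeasurableSpace Ω] (μ : Measure Ω) : Prop :=
  ∃ V : Ω → ℝ, (∀ ω, V ω ∈ Set.Ioo (0 : ℝ) 1) ∧ Measurable V ∧
    μ.map V = (volume : Measure ℝ).restrict (Set.Ioo 0 1) ∧
    MeasurableSpace.comap V (borel ℝ) = mΩ

/-- The simple acts `B₀(C)`: finite-valued maps `Ω → C` all of whose level sets are measurable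
(a `SimpleFunc` needs no `σ`-algebra on its codomain). -/
abbrev Act (Ω : Type*) [MeasurableSpace Ω] {E : Type*} (C : Set E) : Type _ :=
  SimpleFunc Ω C

section Acts

variable {Ω E : Type*} [MeasurableSpace Ω] [AddCommGroup E] [Module ℝ E] {C : Set E}

/-- The outcome `l x + (1 - l) y`, for `l ∈ [0,1]`. -/
def mixOutcome (hC : Convex ℝ C) (l : Set.Icc (0 : ℝ) 1) (x y : C) : C :=
  ⟨(l : ℝ) • (x : E) + (1 - (l : ℝ)) • (y : E),
    hC x.2 y.2 l.2.1 (sub_nonneg.2 l.2.2) (add_sub_cancel _ _)⟩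

/-- The act `l f + (1 - l) g`, formed state by state. -/
def mixAct (hC : Convex ℝ C) (l : Set.Icc (0 : ℝ) 1) (f g : Act Ω C) : Act Ω C :=
  (f.pair g).map fun p => mixOutcome hC l p.1 p.2

/-- The constant act with value `x`. -/
def constAct (Ω : Type*) [MeasurableSpace Ω] (x : C) : Act Ω C :=
  SimpleFunc.const Ω x

/-- The act that yields `z` on the event `A` and `x` on its complement. -/
def betAct (A : Set Ω) (hA : MeasurableSet A) (z x : C) : Act Ω C :=
  SimpleFunc.piecewise A hA (SimpleFunc.const Ω z) (SimpleFunc.const Ω x)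

/-- The asymmetric part `f ≻ g` of `R`. -/
def Strict (R : Act Ω C → Act Ω C → Prop) (f g : Act Ω C) : Prop :=
  R f g ∧ ¬ R g f

/-- The symmetric part `f ∼ g` of `R`. -/
def Indiff (R : Act Ω C → Act Ω C → Prop) (f g : Act Ω C) : Prop :=
  R f g ∧ R g f

/-- A preference relation: a weak order on simple acts for which `μ`-almost surely equal acts are
identified (so that it is a weak order on almost-sure classes). -/
structure IsPreference (μ : Measure Ω) (R : Act Ω C → Act Ω C → Prop) : Prop where
  total : ∀ f g, R f g ∨ R g f
  trans : ∀ f g h, R f g → R g h → R f h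
  ae_eq : ∀ f g : Act Ω C, f =ᵐ[μ] g → Indiff R f g

/-- The disappointment event `{ω | f(ω) ≺ f}` of an act. -/
def disappointment (R : Act Ω C → Act Ω C → Prop) (f : Act Ω C) : Set Ω :=
  {ω | Strict R f (constAct Ω (f ω))}

/-- Disappointment-concordant acts. -/
def Disco (R : Act Ω C → Act Ω C → Prop) (f g : Act Ω C) : Prop :=
  disappointment R f = disappointment R g

/-- Strict monotonicity (a strengthening of monotonicity): statewise weak preference implies weak
preference, and strict preference if the statewise preference is strict with positive
probability. -/
def StrictMonotonicity (μ : Measure Ω) (R : Act Ω C → Act Ω C → Prop) : Prop :=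
  ∀ f g : Act Ω C, (∀ ω, R (constAct Ω (f ω)) (constAct Ω (g ω))) →
    R f g ∧
      (0 < μ {ω | Strict R (constAct Ω (f ω)) (constAct Ω (g ω))} → Strict R f g)

/-- Independence for outcomes. -/
def Independence (hC : Convex ℝ C) (R : Act Ω C → Act Ω C → Prop) : Prop :=
  ∀ (x y z : C) (l : Set.Icc (0 : ℝ) 1), 0 < (l : ℝ) →
    Strict R (constAct Ω x) (constAct Ω y) →
      Strict R (constAct Ω (mixOutcome hC l x z)) (constAct Ω (mixOutcome hC l y z))

/-- Archimedean continuity. -/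
def ArchimedeanContinuity (hC : Convex ℝ C) (R : Act Ω C → Act Ω C → Prop) : Prop :=
  ∀ f g h : Act Ω C, Strict R f g → Strict R g h →
    ∃ a b : Set.Icc (0 : ℝ) 1, (a : ℝ) ∈ Set.Ioo (0 : ℝ) 1 ∧ (b : ℝ) ∈ Set.Ioo (0 : ℝ) 1 ∧
      Strict R (mixAct hC a f h) g ∧ Strict R g (mixAct hC b f h)

/-- Disco aversion. -/
def DiscoAversion (hC : Convex ℝ C) (R : Act Ω C → Act Ω C → Prop) : Prop :=
  ∀ f g h : Act Ω C, Disco R f g → Indiff R g h →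
    ∀ a : Set.Icc (0 : ℝ) 1, (a : ℝ) ∈ Set.Ioo (0 : ℝ) 1 →
      R (mixAct hC a f h) (mixAct hC a f g)

/-- Non-degeneracy. -/
def NonDegeneracy (R : Act Ω C → Act Ω C → Prop) : Prop :=
  ∃ f g : Act Ω C, Strict R f g

/-- Monotone continuity. -/
def MonotoneContinuity (R : Act Ω C → Act Ω C → Prop) : Prop :=
  ∀ x y z : C, Strict R (constAct Ω x) (constAct Ω y) →
    ∀ (A : ℕ → Set Ω) (hA : ∀ n, MeasurableSet (A n)), Antitone A → ⋂ n, A n = ∅ →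
      ∃ n, Strict R (betAct (A n) (hA n) z x) (constAct Ω y)

/-- The duet expectile `Ex_α^{P,Q}(X)`: the (least) real `y` with
`α E^P[(X - y)₊] = (1 - α) E^Q[(y - X)₊]`. -/
def duetExpectile (P Q : Measure Ω) (α : ℝ) (X : Ω → ℝ) : ℝ :=
  sInf {y : ℝ | α * ∫ ω, max (X ω - y) 0 ∂P = (1 - α) * ∫ ω, max (y - X ω) 0 ∂Q}

/-- `u` is affine on the convex set `C`. -/
def IsAffineUtility (hC : Convex ℝ C) (u : C → ℝ) : Prop :=
  ∀ (l : Set.Icc (0 : ℝ) 1) (x y : C),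
    u (mixOutcome hC l x y) = (l : ℝ) * u x + (1 - (l : ℝ)) * u y

/-- `(u, P, Q, α)` is a duet expectiled utility representation of `R`: `u` is a non-constant affine
utility, `P` and `Q` are probability measures, `P`, `Q` and `μ` are mutually absolutely continuous,
`α ∈ (0,1/2]`, `α P ≤ (1 - α) Q`, and `R` compares acts by the duet expectiles of their
utilities. -/
structure IsRepresentation (hC : Convex ℝ C) (μ : Measure Ω) (R : Act Ω C → Act Ω C → Prop)
    (u : C → ℝ) (P Q : Measure Ω) (α : ℝ) : Prop where
  affine : IsAffineUtility hC u
  nonconstant : ∃ x y : C, u x ≠ u y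
  prob_P : IsProbabilityMeasure P
  prob_Q : IsProbabilityMeasure Q
  ac_PQ : P ≪ Q ∧ Q ≪ P
  ac_Qμ : Q ≪ μ ∧ μ ≪ Q
  weight : α ∈ Set.Ioc (0 : ℝ) (1 / 2)
  le : ENNReal.ofReal α • P ≤ ENNReal.ofReal (1 - α) • Q
  represents : ∀ f g : Act Ω C,
    R f g ↔ duetExpectile P Q α (fun ω => u (f ω)) ≥ duetExpectile P Q α (fun ω => u (g ω))

end Acts

end DuetExpectile

end

open DuetExpectile

/-!
A preference that satisfies the axioms is represented, through an affine utility of outcomes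
(expected utility theorem, `IsMixturePreference.exists_affine`), by a certainty equivalent `I` of
acts measured in utils (`IsCertaintyEquivalent`).

*Disco aversion gives certainty independence.* An act `X` that is not riskless, with disappointment
event `D`, is as good as two-level acts `Z` that are arbitrarily close to a constant and also have
disappointment event `D`. Mixing both with a two-level act on `D` that is close to a constant `c`
uses disco aversion in both directions, so `I (a c + (1 - a) X)` and `I (a c + (1 - a) Z)` must
agree (`IsCertaintyEquivalent.certainty_independence`). Hence `I` extends to a translation
invariant, superlinear functional `J` on all simple random variables that is additive on pairs with
the same disappointment event (`IsDiscoFunctional`).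

*Structure of `J`.* On the cone of random variables with disappointment event `D`, `J` is the
restriction of a linear functional `linPiece J D`, and `J` lies below all of these. A balanced bet
that wins on a subset of `(D ∪ D')ᶜ` and loses on a subset of `D ∩ D'` lies in the closures of both
cones. So the weights of `D` and `D'` are proportional where `D` and `D'` agree
(`IsDiscoFunctional.exists_proportional`). Comparing `D` with a fixed `S` and with `Sᶜ` leaves one
constant to be determined, and it does not depend on `D`, since any two events are linked by a third
one that agrees with each of them on parts of every relevant cell
(`IsDiscoFunctional.ratio_eq`; this is where the space must be atomless). Therefore all linear pieces
come from just two measures, `P` on the elating and `Q` on the disappointing states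
(`IsDiscoFunctional.exists_measures`), and `J X = y` says that `∫ (X - y)₊ dP = ∫ (y - X)₊ dQ`.
That `J` lies below its linear pieces gives `P ≤ Q`; normalizing the masses gives `α`.

*Necessity.* The gain function `α E^P[Z₊] - (1 - α) E^Q[Z₋]` is strictly monotone; by
`α P ≤ (1 - α) Q` it is superlinear, and it is linear on random variables with the same negative set.

*Uniqueness.* The expectile of a bet on `A` determines the ratio of `α P(A)` to `(1 - α) Q(Aᶜ)`. For
two representations, on a partition into three cells, each ratio `α P(A) / α' P'(A)` is thus a mean
of the ratios `(1 - α) Q(B) / (1 - α') Q'(B)` of the other cells and vice versa, so that a maximal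
ratio forces all of them to be equal (`ratio_rigid`).
-/

/-! ### Affine utilities for weak orders on convex sets -/

/-- A weak order on a convex set that satisfies the (strict) independence axiom and the Archimedean
axiom. It is kept as a relation `r` on the ambient space; the strict preference `x ≻ y` is written
`¬ r y x`, which is equivalent to the asymmetric part because `r` is total on `C`. -/
structure IsMixturePreference {E : Type*} [AddCommGroup E] [Module ℝ E] (C : Set E)
    (r : E → E → Prop) : Prop where
  convex : Convex ℝ C
  total : ∀ x ∈ C, ∀ y ∈ C, r x y ∨ r y x
  trans : ∀ x ∈ C, ∀ y ∈ C, ∀ z ∈ C, r x y → r y z → r x z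
  ind : ∀ x ∈ C, ∀ y ∈ C, ∀ z ∈ C, ∀ l : ℝ, 0 < l → l ≤ 1 → ¬ r y x →
    ¬ r (l • y + (1 - l) • z) (l • x + (1 - l) • z)
  arch : ∀ x ∈ C, ∀ y ∈ C, ∀ z ∈ C, ¬ r y x → ¬ r z y →
    ∃ a b : ℝ, (0 < a ∧ a < 1) ∧ (0 < b ∧ b < 1) ∧
      ¬ r y (a • x + (1 - a) • z) ∧ ¬ r (b • x + (1 - b) • z) y

/-- An intermediate value principle on `[0,1]`: `up` and `dn` say that the point at time `t` of a
path is weakly above, respectively weakly below, a target. -/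
theorem exists_up_and_dn {up dn : ℝ → Prop} (h0 : dn 0) (h1 : up 1)
    (tot : ∀ t, 0 ≤ t → t ≤ 1 → up t ∨ dn t)
    (anti : ∀ s t, 0 ≤ s → s ≤ t → t ≤ 1 → dn t → dn s)
    (hdn : ∀ t, 0 < t → t ≤ 1 → ¬ dn t → ∃ s, 0 ≤ s ∧ s < t ∧ ¬ dn s)
    (hup : ∀ t, 0 ≤ t → t < 1 → ¬ up t → ∃ s, t < s ∧ s ≤ 1 ∧ ¬ up s) :
    ∃ t, 0 ≤ t ∧ t ≤ 1 ∧ up t ∧ dn t := by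
  set S : Set ℝ := {t | 0 ≤ t ∧ t ≤ 1 ∧ dn t} with hS
  have hne : S.Nonempty := ⟨0, le_rfl, zero_le_one, h0⟩
  have hbd : BddAbove S := ⟨1, fun t ht => ht.2.1⟩
  have hT0 : 0 ≤ sSup S := le_csSup hbd ⟨le_rfl, zero_le_one, h0⟩
  have hT1 : sSup S ≤ 1 := csSup_le hne fun t ht => ht.2.1
  have hd : dn (sSup S) := by
    by_contra hcon
    have hpos : 0 < sSup S := by
      rcases hT0.lt_or_eq with h | h
      · exact h
      · rw [← h] at hcon; exact absurd h0 hcon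
    obtain ⟨s, hs0, hs, hsd⟩ := hdn _ hpos hT1 hcon
    obtain ⟨t, ht, hst⟩ := exists_lt_of_lt_csSup hne hs
    exact hsd (anti s t hs0 hst.le ht.2.1 ht.2.2)
  refine ⟨sSup S, hT0, hT1, ?_, hd⟩
  by_contra hcon
  have hlt : sSup S < 1 := by
    rcases hT1.lt_or_eq with h | h
    · exact h
    · rw [h] at hcon; exact absurd h1 hcon
  obtain ⟨s, hs, hs1, hsu⟩ := hup _ hT0 hlt hcon
  have hs0 : 0 ≤ s := hT0.trans hs.le
  exact absurd (le_csSup hbd ⟨hs0, hs1, (tot s hs0 hs1).resolve_left hsu⟩) (not_le.2 hs)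

namespace IsMixturePreference

variable {E : Type*} [AddCommGroup E] [Module ℝ E] {C : Set E} {r : E → E → Prop}

theorem mem (h : IsMixturePreference C r) {x y : E} (hx : x ∈ C) (hy : y ∈ C) {l : ℝ}
    (h0 : 0 ≤ l) (h1 : l ≤ 1) : l • x + (1 - l) • y ∈ C :=
  h.convex hx hy h0 (sub_nonneg.2 h1) (add_sub_cancel _ _)

theorem refl (h : IsMixturePreference C r) {x : E} (hx : x ∈ C) : r x x :=
  (h.total x hx x hx).elim id id

theorem of_not (h : IsMixturePreference C r) {x y : E} (hx : x ∈ C) (hy : y ∈ C)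
    (hn : ¬ r y x) : r x y := (h.total x hx y hy).resolve_right hn

/-- Independence for weak preference. The content is the case of indifference: if mixing `x ∼ y`
with `z` broke the tie, the Archimedean axiom would allow for a slight improvement of the worse one
(or worsening of the better one) that independence forbids. -/
theorem ind_weak (h : IsMixturePreference C r) {x y z : E} (hx : x ∈ C) (hy : y ∈ C) (hz : z ∈ C)
    {l : ℝ} (h0 : 0 ≤ l) (h1 : l ≤ 1) (hxy : r x y) :
    r (l • x + (1 - l) • z) (l • y + (1 - l) • z) := by
  have hX := h.mem hx hz h0 h1
  have hY := h.mem hy hz h0 h1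
  rcases h0.eq_or_lt with rfl | hpos
  · simpa using h.refl hz
  by_cases hyx : r y x
  swap
  · exact h.of_not hX hY (h.ind x hx y hy z hz l hpos h1 hyx)
  by_contra hcon
  -- here `l y + (1 - l) z ≻ l x + (1 - l) z` although `x ∼ y`
  by_cases hw : ∃ w ∈ C, ¬ r x w
  · obtain ⟨w, hwC, hxw⟩ := hw
    have key : ∀ e : ℝ, 0 < e → e ≤ 1 →
        ¬ r (l • y + (1 - l) • z) (l • (e • w + (1 - e) • x) + (1 - l) • z) := by
      intro e he he1
      have hm := h.mem hwC hx he.le he1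
      refine h.ind _ hm y hy z hz l hpos h1 fun hc => ?_
      refine h.ind w hwC x hx x hx e he he1 hxw ?_
      rw [show e • x + (1 - e) • x = x by module]
      exact h.trans _ hx _ hy _ hm hxy hc
    have hW := h.mem hwC hz h0 h1
    obtain ⟨a, b, -, hb, -, hb'⟩ := h.arch _ hW _ hY _ hX
      (by simpa using key 1 one_pos le_rfl) hcon
    refine key b hb.1 hb.2.le (h.of_not hY ?_ ?_)
    · exact h.mem (h.mem hwC hx hb.1.le hb.2.le) hz h0 h1
    · convert hb' using 2; module
  by_cases hw' : ∃ w ∈ C, ¬ r w y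
  · obtain ⟨w, hwC, hyw⟩ := hw'
    have key : ∀ e : ℝ, 0 < e → e ≤ 1 →
        ¬ r (l • (e • w + (1 - e) • y) + (1 - l) • z) (l • x + (1 - l) • z) := by
      intro e he he1
      have hm := h.mem hwC hy he.le he1
      refine h.ind x hx _ hm z hz l hpos h1 fun hc => ?_
      refine h.ind y hy w hwC y hy e he he1 hyw ?_
      rw [show e • y + (1 - e) • y = y by module]
      exact h.trans _ hm _ hx _ hy hc hxy
    have hW := h.mem hwC hz h0 h1
    obtain ⟨a, b, ha, -, ha', -⟩ := h.arch _ hY _ hX _ hW hcon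
      (by simpa using key 1 one_pos le_rfl)
    refine key (1 - a) (by linarith [ha.2]) (by linarith [ha.1]) (h.of_not ?_ hX ?_)
    · exact h.mem (h.mem hwC hy (by linarith [ha.2]) (by linarith [ha.1])) hz h0 h1
    · convert ha' using 2; module
  push Not at hw hw'
  exact hcon (h.trans _ hX _ hx _ hY (h.trans _ hX _ hy _ hx (hw' _ hX) hyx) (hw _ hY))

/-- Points on the segment from `x₀` to a better `x₁` get strictly better. -/
theorem segment_iff (h : IsMixturePreference C r) {x0 x1 : E} (h0 : x0 ∈ C) (h1 : x1 ∈ C)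
    (h01 : ¬ r x0 x1) {s t : ℝ} (hs : 0 ≤ s) (hs1 : s ≤ 1) (ht : 0 ≤ t) (ht1 : t ≤ 1) :
    r (t • x1 + (1 - t) • x0) (s • x1 + (1 - s) • x0) ↔ s ≤ t := by
  have strict : ∀ {s t : ℝ}, 0 ≤ s → s < t → t ≤ 1 →
      ¬ r (s • x1 + (1 - s) • x0) (t • x1 + (1 - t) • x0) := by
    intro s t hs hst ht1
    have htpos : 0 < t := hs.trans_lt hst
    have hmt := h.mem h1 h0 htpos.le ht1
    have e1 : ¬ r x0 (t • x1 + (1 - t) • x0) := by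
      have := h.ind x1 h1 x0 h0 x0 h0 t htpos ht1 h01
      rwa [show t • x0 + (1 - t) • x0 = x0 by module] at this
    have hk : 0 ≤ s / t := by positivity
    have hk1 : s / t < 1 := (div_lt_one htpos).2 hst
    have := h.ind _ hmt x0 h0 _ hmt (1 - s / t) (by linarith) (by linarith) e1
    rw [show (1 - s / t) • (t • x1 + (1 - t) • x0) + (1 - (1 - s / t)) • (t • x1 + (1 - t) • x0)
      = t • x1 + (1 - t) • x0 by module] at this
    have e2 : (1 - s / t) • x0 + (1 - (1 - s / t)) • (t • x1 + (1 - t) • x0)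
        = s • x1 + (1 - s) • x0 := by
      match_scalars <;> field_simp <;> ring
    rwa [e2] at this
  constructor
  · intro hr
    by_contra hlt
    exact strict ht (not_le.1 hlt) hs1 hr
  · intro hle
    rcases hle.eq_or_lt with rfl | hlt
    · exact h.refl (h.mem h1 h0 hs hs1)
    · exact h.of_not (h.mem h1 h0 ht ht1) (h.mem h1 h0 hs hs1) (strict hs hlt ht1)

theorem exists_indiff_segment (h : IsMixturePreference C r) {x0 x1 z : E} (h0 : x0 ∈ C)
    (h1 : x1 ∈ C) (hz : z ∈ C) (h01 : ¬ r x0 x1) (hz0 : r z x0) (hz1 : r x1 z) :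
    ∃ t : ℝ, 0 ≤ t ∧ t ≤ 1 ∧ r (t • x1 + (1 - t) • x0) z ∧ r z (t • x1 + (1 - t) • x0) := by
  by_cases hz0' : r x0 z
  · exact ⟨0, le_rfl, zero_le_one, by simpa using hz0', by simpa using hz0⟩
  by_cases hz1' : r z x1
  · exact ⟨1, zero_le_one, le_rfl, by simpa using hz1, by simpa using hz1'⟩
  refine exists_up_and_dn (up := fun t => r (t • x1 + (1 - t) • x0) z)
    (dn := fun t => r z (t • x1 + (1 - t) • x0)) (by simpa using hz0) (by simpa using hz1)
    (fun t ht ht1 => h.total _ (h.mem h1 h0 ht ht1) _ hz) ?_ ?_ ?_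
  · intro s t hs hst ht1 hr
    exact h.trans _ hz _ (h.mem h1 h0 (hs.trans hst) ht1) _ (h.mem h1 h0 hs (hst.trans ht1)) hr
      ((h.segment_iff h0 h1 h01 hs (hst.trans ht1) (hs.trans hst) ht1).2 hst)
  · intro t ht ht1 hn
    obtain ⟨a, -, ha, -, ha', -⟩ := h.arch _ (h.mem h1 h0 ht.le ht1) _ hz _ h0 hn hz0'
    refine ⟨a * t, by nlinarith, by nlinarith, fun hc => ha' ?_⟩
    convert hc using 1; module
  · intro t ht ht1 hn
    obtain ⟨-, b, -, hb, -, hb'⟩ := h.arch _ h1 _ hz _ (h.mem h1 h0 ht ht1.le) hz1' hn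
    refine ⟨b + (1 - b) * t, by nlinarith, by nlinarith, fun hc => hb' ?_⟩
    convert hc using 1; module

/-- The utility of `z` on the scale with `u x₀ = 0` and `u x₁ = 1` is `v`, as witnessed by the
contraction factor `s`: after contracting `z` by `s` towards the midpoint of `x₀` and `x₁` it is indifferent to the point of the segment that an affine
utility with these values prescribes. -/
def HasUtility (r : E → E → Prop) (x0 x1 z : E) (v s : ℝ) : Prop :=
  0 < s ∧ s ≤ 1 ∧ 0 ≤ s * v + (1 - s) / 2 ∧ s * v + (1 - s) / 2 ≤ 1 ∧
    r (s • z + (1 - s) • ((1 / 2 : ℝ) • x1 + (1 - 1 / 2 : ℝ) • x0))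
      ((s * v + (1 - s) / 2) • x1 + (1 - (s * v + (1 - s) / 2)) • x0) ∧
    r ((s * v + (1 - s) / 2) • x1 + (1 - (s * v + (1 - s) / 2)) • x0)
      (s • z + (1 - s) • ((1 / 2 : ℝ) • x1 + (1 - 1 / 2 : ℝ) • x0))

theorem HasUtility.scale (h : IsMixturePreference C r) {x0 x1 z : E} (h0 : x0 ∈ C) (h1 : x1 ∈ C)
    (hz : z ∈ C) {v s : ℝ} (hu : HasUtility r x0 x1 z v s) {k : ℝ} (hk : 0 < k) (hk1 : k ≤ 1) :
    HasUtility r x0 x1 z v (k * s) := by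
  obtain ⟨hs, hs1, hv0, hv1, ha, hb⟩ := hu
  have hm : (1 / 2 : ℝ) • x1 + (1 - 1 / 2 : ℝ) • x0 ∈ C := h.mem h1 h0 (by norm_num) (by norm_num)
  have hp := h.mem h1 h0 hv0 hv1
  have hzm := h.mem hz hm hs.le hs1
  refine ⟨by positivity, by nlinarith, by nlinarith, by nlinarith, ?_, ?_⟩
  · convert h.ind_weak hzm hp hm hk.le hk1 ha using 1 <;> module
  · convert h.ind_weak hp hzm hm hk.le hk1 hb using 1 <;> module

theorem exists_hasUtility (h : IsMixturePreference C r) {x0 x1 z : E} (h0 : x0 ∈ C) (h1 : x1 ∈ C)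
    (hz : z ∈ C) (h01 : ¬ r x0 x1) : ∃ v s, HasUtility r x0 x1 z v s := by
  set m := (1 / 2 : ℝ) • x1 + (1 - 1 / 2 : ℝ) • x0 with hmdef
  have hm : m ∈ C := h.mem h1 h0 (by norm_num) (by norm_num)
  have hm0 : ¬ r x0 m := by
    intro hc
    have := (h.segment_iff (s := 1 / 2) (t := 0) h0 h1 h01 (by norm_num) (by norm_num) le_rfl
      zero_le_one).1 (by simpa [hmdef] using hc)
    norm_num at this
  have hm1 : ¬ r m x1 := by
    intro hc
    have := (h.segment_iff (s := 1) (t := 1 / 2) h0 h1 h01 (by norm_num) (by norm_num)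
      (by norm_num) (by norm_num)).1 (by simpa [hmdef] using hc)
    norm_num at this
  obtain ⟨s, hs, hs1, ha, hb⟩ : ∃ s : ℝ, 0 < s ∧ s ≤ 1 ∧ r (s • z + (1 - s) • m) x0 ∧
      r x1 (s • z + (1 - s) • m) := by
    by_cases hz1 : r x1 z
    · by_cases hz0 : r z x0
      · exact ⟨1, one_pos, le_rfl, by simpa using hz0, by simpa using hz1⟩
      · obtain ⟨a, -, ha, -, ha', -⟩ := h.arch _ hm _ h0 _ hz hm0 hz0
        refine ⟨1 - a, by linarith [ha.2], by linarith [ha.1], ?_, ?_⟩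
        · refine h.of_not (h.mem hz hm (by linarith [ha.2]) (by linarith [ha.1])) h0 ?_
          convert ha' using 2; module
        · have e := h.ind_weak h1 hz hm (l := 1 - a) (by linarith [ha.2]) (by linarith [ha.1]) hz1
          refine h.trans _ h1 _ (h.mem h1 hm (l := 1 - a) (by linarith [ha.2])
            (by linarith [ha.1])) _ (h.mem hz hm (by linarith [ha.2]) (by linarith [ha.1])) ?_ e
          have e2 := h.ind_weak h1 hm h1 (l := a) ha.1.le ha.2.le (h.of_not h1 hm hm1)
          convert e2 using 1 <;> module
    · obtain ⟨-, b, -, hb, -, hb'⟩ := h.arch _ hz _ h1 _ hm hz1 hm1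
      refine ⟨b, hb.1, hb.2.le, ?_, h.of_not h1 (h.mem hz hm hb.1.le hb.2.le) hb'⟩
      have hzx : r z x0 := h.trans _ hz _ h1 _ h0 (h.of_not hz h1 hz1) (h.of_not h1 h0 h01)
      have e := h.ind_weak hz h0 hm hb.1.le hb.2.le hzx
      refine h.trans _ (h.mem hz hm hb.1.le hb.2.le) _ (h.mem h0 hm hb.1.le hb.2.le) _ h0 e ?_
      have e2 := h.ind_weak hm h0 h0 (l := 1 - b) (by linarith [hb.2]) (by linarith [hb.1])
        (h.of_not hm h0 hm0)
      convert e2 using 1 <;> module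
  obtain ⟨t, ht0, ht1, hta, htb⟩ := h.exists_indiff_segment h0 h1 (h.mem hz hm hs.le hs1) h01 ha hb
  have e : s * ((t - (1 - s) / 2) / s) + (1 - s) / 2 = t := by field_simp; ring
  exact ⟨(t - (1 - s) / 2) / s, s, hs, hs1, by rwa [e], by rwa [e], by rwa [e], by rwa [e]⟩

theorem HasUtility.iff_le (h : IsMixturePreference C r) {x0 x1 z z' : E} (h0 : x0 ∈ C)
    (h1 : x1 ∈ C) (hz : z ∈ C) (hz' : z' ∈ C) (h01 : ¬ r x0 x1) {v v' s s' : ℝ}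
    (hu : HasUtility r x0 x1 z v s) (hu' : HasUtility r x0 x1 z' v' s') :
    r z z' ↔ v' ≤ v := by
  have k := hu.scale h h0 h1 hz hu'.1 hu'.2.1
  have k' := hu'.scale h h0 h1 hz' hu.1 hu.2.1
  rw [mul_comm] at k'
  set σ := s' * s
  have hm : (1 / 2 : ℝ) • x1 + (1 - 1 / 2 : ℝ) • x0 ∈ C := h.mem h1 h0 (by norm_num) (by norm_num)
  obtain ⟨hs, hs1, p0, p1, pa, pb⟩ := k
  obtain ⟨-, -, q0, q1, qa, qb⟩ := k'
  have hzm := h.mem hz hm hs.le hs1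
  have hzm' := h.mem hz' hm hs.le hs1
  have hp := h.mem h1 h0 p0 p1
  have hq := h.mem h1 h0 q0 q1
  have step : v' ≤ v ↔ σ * v' + (1 - σ) / 2 ≤ σ * v + (1 - σ) / 2 := by
    rw [add_le_add_iff_right, mul_le_mul_iff_right₀ hs]
  rw [step, ← h.segment_iff h0 h1 h01 q0 q1 p0 p1]
  constructor
  · intro hr
    exact h.trans _ hp _ hzm _ hq pb (h.trans _ hzm _ hzm' _ hq
      (h.ind_weak hz hz' hm hs.le hs1 hr) qa)
  · intro hr
    by_contra hn
    exact h.ind _ hz' _ hz _ hm σ hs hs1 hn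
      (h.trans _ hzm _ hp _ hzm' pa (h.trans _ hp _ hq _ hzm' hr qb))

/-- The expected utility theorem: a weak order on a convex set that satisfies independence and the
Archimedean axiom, and that is not trivial, has an affine utility; its values at two outcomes
`x₀ ≺ x₁` can be prescribed to be `-1` and `1`. -/
theorem exists_affine (h : IsMixturePreference C r) {x0 x1 : E} (h0 : x0 ∈ C) (h1 : x1 ∈ C)
    (h01 : ¬ r x0 x1) : ∃ u : E → ℝ, u x0 = -1 ∧ u x1 = 1 ∧
      (∀ x ∈ C, ∀ y ∈ C, r x y ↔ u y ≤ u x) ∧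
      ∀ x ∈ C, ∀ y ∈ C, ∀ l : ℝ, 0 ≤ l → l ≤ 1 →
        u (l • x + (1 - l) • y) = l * u x + (1 - l) * u y := by
  have ex : ∀ z : E, ∃ v, z ∈ C → ∃ s, HasUtility r x0 x1 z v s := by
    intro z
    by_cases hz : z ∈ C
    · obtain ⟨v, s, hv⟩ := h.exists_hasUtility h0 h1 hz h01
      exact ⟨v, fun _ => ⟨s, hv⟩⟩
    · exact ⟨0, fun hc => absurd hc hz⟩
  choose u hu using ex
  have uniq : ∀ z ∈ C, ∀ v s, HasUtility r x0 x1 z v s → u z = v := by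
    intro z hz v s hv
    obtain ⟨s', hs'⟩ := hu z hz
    exact le_antisymm ((hv.iff_le h h0 h1 hz hz h01 hs').1 (h.refl hz))
      ((hs'.iff_le h h0 h1 hz hz h01 hv).1 (h.refl hz))
  refine ⟨fun z => 2 * u z - 1, ?_, ?_, ?_, ?_⟩
  · have : u x0 = 0 := uniq x0 h0 0 1 ⟨one_pos, le_rfl, by norm_num, by norm_num, by
      simpa using h.refl h0, by simpa using h.refl h0⟩
    simp only [this]; norm_num
  · have : u x1 = 1 := uniq x1 h1 1 1 ⟨one_pos, le_rfl, by norm_num, by norm_num, by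
      simpa using h.refl h1, by simpa using h.refl h1⟩
    simp only [this]; norm_num
  · intro x hx y hy
    obtain ⟨s, hs⟩ := hu x hx
    obtain ⟨s', hs'⟩ := hu y hy
    rw [hs.iff_le h h0 h1 hx hy h01 hs']
    constructor <;> intro <;> linarith
  · intro x hx y hy l hl hl1
    have hm : (1 / 2 : ℝ) • x1 + (1 - 1 / 2 : ℝ) • x0 ∈ C :=
      h.mem h1 h0 (by norm_num) (by norm_num)
    obtain ⟨s, hs⟩ := hu x hx
    obtain ⟨s', hs'⟩ := hu y hy
    have k := hs.scale h h0 h1 hx hs'.1 hs'.2.1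
    have k' := hs'.scale h h0 h1 hy hs.1 hs.2.1
    rw [mul_comm] at k'
    set σ := s' * s
    obtain ⟨hs, hs1, p0, p1, pa, pb⟩ := k
    obtain ⟨-, -, q0, q1, qa, qb⟩ := k'
    have hxm := h.mem hx hm hs.le hs1
    have hym := h.mem hy hm hs.le hs1
    have hp := h.mem h1 h0 p0 p1
    have hq := h.mem h1 h0 q0 q1
    have hl' : 0 ≤ 1 - l := by linarith
    have hll : 1 - l ≤ 1 := by linarith
    have key : HasUtility r x0 x1 (l • x + (1 - l) • y) (l * u x + (1 - l) * u y) σ := by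
      refine ⟨hs, hs1, ?_, ?_, ?_, ?_⟩
      · have := mul_nonneg hl p0
        have := mul_nonneg hl' q0
        nlinarith
      · have := mul_le_mul_of_nonneg_left p1 hl
        have := mul_le_mul_of_nonneg_left q1 hl'
        nlinarith
      · have e1 := h.ind_weak hxm hp hym hl hl1 pa
        have e2 := h.ind_weak hym hq hp hl' hll qa
        have := h.trans _ (h.mem hxm hym hl hl1) _ (h.mem hp hym hl hl1) _ (h.mem hq hp hl' hll)
          e1 (by convert e2 using 1; module)
        convert this using 1 <;> module
      · have e1 := h.ind_weak hp hxm hym hl hl1 pb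
        have e2 := h.ind_weak hq hym hp hl' hll qb
        have := h.trans _ (h.mem hq hp hl' hll) _ (h.mem hp hym hl hl1) _ (h.mem hxm hym hl hl1)
          (by convert e2 using 1; module) e1
        convert this using 1 <;> module
    simp only [uniq _ (h.mem hx hy hl hl1) _ _ key]
    ring

end IsMixturePreference

/-! ### Certainty independence of disco averse certainty equivalents -/

section TwoLevel

variable {Ω : Type*} [MeasurableSpace Ω]

/-- The simple function with value `q` on `D` and `p` off `D`. -/
noncomputable def twoLevel (D : Set Ω) (hD : MeasurableSet D) (q p : ℝ) : SimpleFunc Ω ℝ :=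
  SimpleFunc.piecewise D hD (SimpleFunc.const Ω q) (SimpleFunc.const Ω p)

theorem twoLevel_of_mem {D : Set Ω} {hD : MeasurableSet D} {q p : ℝ} {ω : Ω} (h : ω ∈ D) :
    twoLevel D hD q p ω = q := by
  simp [twoLevel, SimpleFunc.piecewise_apply, h]

theorem twoLevel_of_notMem {D : Set Ω} {hD : MeasurableSet D} {q p : ℝ} {ω : Ω} (h : ω ∉ D) :
    twoLevel D hD q p ω = p := by
  simp [twoLevel, SimpleFunc.piecewise_apply, h]

theorem twoLevel_forall {D : Set Ω} {hD : MeasurableSet D} {q p : ℝ} {S : ℝ → Prop} (hq : S q)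
    (hp : S p) (ω : Ω) : S (twoLevel D hD q p ω) := by
  by_cases h : ω ∈ D
  · rwa [twoLevel_of_mem h]
  · rwa [twoLevel_of_notMem h]

end TwoLevel

/-- The properties of the certainty equivalent that the axioms yield directly, for acts that are
measured in utils and take values in the interval `K` of attainable utilities. -/
structure IsCertaintyEquivalent {Ω : Type*} [MeasurableSpace Ω] (μ : Measure Ω) (K : Set ℝ)
    (I : SimpleFunc Ω ℝ → ℝ) : Prop where
  convex : Convex ℝ K
  neg_one_mem : (-1 : ℝ) ∈ K
  one_mem : (1 : ℝ) ∈ K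
  const : ∀ t ∈ K, I (SimpleFunc.const Ω t) = t
  mono : ∀ X Y : SimpleFunc Ω ℝ, (∀ ω, X ω ∈ K) → (∀ ω, Y ω ∈ K) → (∀ ω, X ω ≤ Y ω) → I X ≤ I Y
  strict : ∀ X Y : SimpleFunc Ω ℝ, (∀ ω, X ω ∈ K) → (∀ ω, Y ω ∈ K) → (∀ ω, X ω ≤ Y ω) →
    0 < μ {ω | X ω < Y ω} → I X < I Y
  congr : ∀ X Y : SimpleFunc Ω ℝ, (∀ ω, X ω ∈ K) → (∀ ω, Y ω ∈ K) → X =ᵐ[μ] Y → I X = I Y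
  ivt : ∀ X Y : SimpleFunc Ω ℝ, (∀ ω, X ω ∈ K) → (∀ ω, Y ω ∈ K) → (∀ ω, X ω ≤ Y ω) →
    ∀ t, I X ≤ t → t ≤ I Y → ∃ a : ℝ, 0 ≤ a ∧ a ≤ 1 ∧ I (a • Y + (1 - a) • X) = t
  disco : ∀ X Y Z : SimpleFunc Ω ℝ, (∀ ω, X ω ∈ K) → (∀ ω, Y ω ∈ K) → (∀ ω, Z ω ∈ K) →
    {ω | X ω < I X} = {ω | Y ω < I Y} → I Y = I Z → ∀ a : ℝ, 0 < a → a < 1 →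
      I (a • X + (1 - a) • Y) ≤ I (a • X + (1 - a) • Z)

namespace IsCertaintyEquivalent

variable {Ω : Type*} [MeasurableSpace Ω] {μ : Measure Ω} {K : Set ℝ} {I : SimpleFunc Ω ℝ → ℝ}

theorem mem_of_mem (h : IsCertaintyEquivalent μ K I) {a b c : ℝ} (ha : a ∈ K) (hb : b ∈ K)
    (hac : a ≤ c) (hcb : c ≤ b) : c ∈ K :=
  h.convex.ordConnected.out ha hb ⟨hac, hcb⟩

theorem mem_of_abs_le (h : IsCertaintyEquivalent μ K I) {c : ℝ} (hc : |c| ≤ 1) : c ∈ K :=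
  h.mem_of_mem h.neg_one_mem h.one_mem (abs_le.1 hc).1 (abs_le.1 hc).2

theorem mix_mem (h : IsCertaintyEquivalent μ K I) {X Y : SimpleFunc Ω ℝ} (hX : ∀ ω, X ω ∈ K)
    (hY : ∀ ω, Y ω ∈ K) {a : ℝ} (h0 : 0 ≤ a) (h1 : a ≤ 1) (ω : Ω) :
    (a • X + (1 - a) • Y) ω ∈ K :=
  h.convex (hX ω) (hY ω) h0 (sub_nonneg.2 h1) (add_sub_cancel _ _)

theorem le_of_forall_le (h : IsCertaintyEquivalent μ K I) {X : SimpleFunc Ω ℝ} (hX : ∀ ω, X ω ∈ K)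
    {t : ℝ} (ht : t ∈ K) (hle : ∀ ω, X ω ≤ t) : I X ≤ t := by
  have := h.mono X (SimpleFunc.const Ω t) hX (fun _ => ht) hle
  rwa [h.const t ht] at this

theorem le_of_forall_ge (h : IsCertaintyEquivalent μ K I) {X : SimpleFunc Ω ℝ} (hX : ∀ ω, X ω ∈ K)
    {t : ℝ} (ht : t ∈ K) (hle : ∀ ω, t ≤ X ω) : t ≤ I X := by
  have := h.mono (SimpleFunc.const Ω t) X (fun _ => ht) hX hle
  rwa [h.const t ht] at this

theorem exists_le_apply [Nonempty Ω] (h : IsCertaintyEquivalent μ K I) {X : SimpleFunc Ω ℝ}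
    (hX : ∀ ω, X ω ∈ K) : ∃ ω, I X ≤ X ω := by
  obtain ⟨_, ⟨ω, rfl⟩, hω⟩ := Set.exists_max_image (Set.range X) id X.finite_range
    (Set.range_nonempty _)
  exact ⟨ω, h.le_of_forall_le hX (hX ω) fun ω' => hω _ ⟨ω', rfl⟩⟩

theorem exists_apply_le [Nonempty Ω] (h : IsCertaintyEquivalent μ K I) {X : SimpleFunc Ω ℝ}
    (hX : ∀ ω, X ω ∈ K) : ∃ ω, X ω ≤ I X := by
  obtain ⟨_, ⟨ω, rfl⟩, hω⟩ := Set.exists_min_image (Set.range X) id X.finite_range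
    (Set.range_nonempty _)
  exact ⟨ω, h.le_of_forall_ge hX (hX ω) fun ω' => hω _ ⟨ω', rfl⟩⟩

theorem mem [Nonempty Ω] (h : IsCertaintyEquivalent μ K I) {X : SimpleFunc Ω ℝ}
    (hX : ∀ ω, X ω ∈ K) : I X ∈ K := by
  obtain ⟨ω, hω⟩ := h.exists_le_apply hX
  obtain ⟨ω', hω'⟩ := h.exists_apply_le hX
  exact h.mem_of_mem (hX ω') (hX ω) hω' hω

/-- An act that is not riskless disappoints with positive probability. -/
theorem measure_lt_pos [Nonempty Ω] (h : IsCertaintyEquivalent μ K I) {X : SimpleFunc Ω ℝ}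
    (hX : ∀ ω, X ω ∈ K) (hne : ¬ ∀ᵐ ω ∂μ, X ω = I X) : 0 < μ {ω | X ω < I X} := by
  by_contra h0
  have hy := h.mem hX
  have hae : ∀ᵐ ω ∂μ, I X ≤ X ω := by
    rw [ae_iff]; simpa using h0
  set X' : SimpleFunc Ω ℝ := X ⊔ SimpleFunc.const Ω (I X) with hX'
  have hval : ∀ ω, X' ω = max (X ω) (I X) := fun ω => rfl
  have hK : ∀ ω, X' ω ∈ K := fun ω => by
    rw [hval]; rcases max_choice (X ω) (I X) with e | e <;> rw [e]
    exacts [hX ω, hy]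
  have e1 : I X' = I X := h.congr _ _ hK hX (by
    filter_upwards [hae] with ω hω; rw [hval, max_eq_left hω])
  have := h.strict (SimpleFunc.const Ω (I X)) X' (fun _ => hy) hK
    (fun ω => by rw [hval]; exact le_max_right _ _) (by
      rw [pos_iff_ne_zero]
      intro hz
      apply hne
      have hz' : ∀ᵐ ω ∂μ, ¬ (I X < X' ω) := by rw [ae_iff]; simpa using hz
      filter_upwards [hae, hz'] with ω h1 h2
      rw [hval, max_eq_left h1] at h2
      exact le_antisymm (not_lt.1 h2) h1)
  rw [h.const _ hy, e1] at this
  exact lt_irrefl _ this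

theorem measure_gt_pos [Nonempty Ω] (h : IsCertaintyEquivalent μ K I) {X : SimpleFunc Ω ℝ}
    (hX : ∀ ω, X ω ∈ K) (hne : ¬ ∀ᵐ ω ∂μ, X ω = I X) : 0 < μ {ω | I X < X ω} := by
  by_contra h0
  have hy := h.mem hX
  have hae : ∀ᵐ ω ∂μ, X ω ≤ I X := by
    rw [ae_iff]; simpa using h0
  set X' : SimpleFunc Ω ℝ := X ⊓ SimpleFunc.const Ω (I X) with hX'
  have hval : ∀ ω, X' ω = min (X ω) (I X) := fun ω => rfl
  have hK : ∀ ω, X' ω ∈ K := fun ω => by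
    rw [hval]; rcases min_choice (X ω) (I X) with e | e <;> rw [e]
    exacts [hX ω, hy]
  have e1 : I X' = I X := h.congr _ _ hK hX (by
    filter_upwards [hae] with ω hω; rw [hval, min_eq_left hω])
  have := h.strict X' (SimpleFunc.const Ω (I X)) hK (fun _ => hy)
    (fun ω => by rw [hval]; exact min_le_right _ _) (by
      rw [pos_iff_ne_zero]
      intro hz
      apply hne
      have hz' : ∀ᵐ ω ∂μ, ¬ (X' ω < I X) := by rw [ae_iff]; simpa using hz
      filter_upwards [hae, hz'] with ω h1 h2
      rw [hval, min_eq_left h1] at h2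
      exact le_antisymm h1 (not_lt.1 h2))
  rw [h.const _ hy, e1] at this
  exact lt_irrefl _ this

/-- Both events `D` and `Dᶜ` being possible, a two-level act that is strictly worse on `D`
has disappointment event `D`. -/
theorem twoLevel_bounds (h : IsCertaintyEquivalent μ K I) {D : Set Ω} (hD : MeasurableSet D)
    (hD0 : 0 < μ D) (hD1 : 0 < μ Dᶜ) {q p : ℝ} (hq : q ∈ K) (hp : p ∈ K) (hqp : q < p) :
    q < I (twoLevel D hD q p) ∧ I (twoLevel D hD q p) < p := by
  have hK := twoLevel_forall (D := D) (hD := hD) (S := (· ∈ K)) hq hp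
  constructor
  · have := h.strict (SimpleFunc.const Ω q) (twoLevel D hD q p) (fun _ => hq) hK
      (twoLevel_forall (S := (q ≤ ·)) le_rfl hqp.le) (hD1.trans_le (measure_mono fun ω hω => by
        simpa [twoLevel_of_notMem hω] using hqp))
    rwa [h.const q hq] at this
  · have := h.strict (twoLevel D hD q p) (SimpleFunc.const Ω p) hK (fun _ => hp)
      (twoLevel_forall (S := (· ≤ p)) hqp.le le_rfl) (hD0.trans_le (measure_mono fun ω hω => by
        simpa [twoLevel_of_mem hω] using hqp))
    rwa [h.const p hp] at this

theorem twoLevel_disappointment {D : Set Ω} {hD : MeasurableSet D} {q p y : ℝ} (hq : q < y)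
    (hp : y ≤ p) : {ω | twoLevel D hD q p ω < y} = D := by
  ext ω
  by_cases hω : ω ∈ D
  · simp [twoLevel_of_mem hω, hω, hq]
  · simp [twoLevel_of_notMem hω, hω, hp]

/-- Every `y` in the interior of `K` is the certainty equivalent of two-level acts that are
arbitrarily close to it and have a given disappointment event. -/
theorem exists_twoLevel (h : IsCertaintyEquivalent μ K I) {D : Set Ω} (hD : MeasurableSet D)
    (hD0 : 0 < μ D) (hD1 : 0 < μ Dᶜ) {y e : ℝ} (he : 0 < e) (hm : y - e ∈ K) (hp : y + e ∈ K) :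
    ∃ q p : ℝ, y - e ≤ q ∧ q < y ∧ y ≤ p ∧ p ≤ y + e ∧ I (twoLevel D hD q p) = y := by
  have hy : y ∈ K := h.mem_of_mem hm hp (by linarith) (by linarith)
  have hcomb : ∀ q p q' p' a : ℝ, a • twoLevel D hD q p + (1 - a) • twoLevel D hD q' p' =
      twoLevel D hD (a * q + (1 - a) * q') (a * p + (1 - a) * p') := by
    intro q p q' p' a
    ext ω
    by_cases hω : ω ∈ D
    · simp [twoLevel_of_mem hω]
    · simp [twoLevel_of_notMem hω]
  have hK : ∀ {q p : ℝ}, q ∈ K → p ∈ K → ∀ ω, twoLevel D hD q p ω ∈ K := fun hq hp =>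
    twoLevel_forall (S := (· ∈ K)) hq hp
  rcases le_total (I (twoLevel D hD (y - e) (y + e))) y with hle | hle
  · have hgt := (h.twoLevel_bounds hD hD0 hD1 hy hp (by linarith)).1
    obtain ⟨a, ha0, ha1, ha⟩ := h.ivt (twoLevel D hD (y - e) (y + e)) (twoLevel D hD y (y + e))
      (hK hm hp) (hK hy hp) (fun ω => by
        by_cases hω : ω ∈ D
        · simp only [twoLevel_of_mem hω]; linarith
        · simp only [twoLevel_of_notMem hω, le_refl]) y hle hgt.le
    rw [hcomb] at ha
    have e1 : a * (y + e) + (1 - a) * (y + e) = y + e := by ring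
    rw [e1] at ha
    refine ⟨_, _, ?_, ?_, ?_, le_rfl, ha⟩
    · nlinarith
    · rcases ha1.lt_or_eq with h1 | h1
      · nlinarith
      · rw [h1] at ha
        simp only [one_mul, sub_self, zero_mul, add_zero] at ha
        exact absurd ha hgt.ne'
    · linarith
  · have hlt := (h.twoLevel_bounds hD hD0 hD1 hm hy (by linarith)).2
    obtain ⟨a, ha0, ha1, ha⟩ := h.ivt (twoLevel D hD (y - e) y) (twoLevel D hD (y - e) (y + e))
      (hK hm hy) (hK hm hp) (fun ω => by
        by_cases hω : ω ∈ D
        · simp only [twoLevel_of_mem hω, le_refl]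
        · simp only [twoLevel_of_notMem hω]; linarith) y hlt.le hle
    rw [hcomb] at ha
    have e1 : a * (y - e) + (1 - a) * (y - e) = y - e := by ring
    rw [e1] at ha
    refine ⟨_, _, le_rfl, ?_, ?_, ?_, ha⟩
    · linarith
    · nlinarith
    · nlinarith

/-- Certainty independence. The act `X` is compared with two-level acts `Z` that have the same
disappointment event and certainty equivalent and are close to a constant; they are mixed with a
two-level act `B` close to `c` that is disco with both, so that neither mixture hedges better than
the other. -/
theorem certainty_independence [Nonempty Ω] (h : IsCertaintyEquivalent μ K I) {X : SimpleFunc Ω ℝ}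
    (hX : ∀ ω, X ω ∈ K) {c a : ℝ} (hc : |c| < 1) (ha0 : 0 < a) (ha1 : a < 1) :
    I (a • SimpleFunc.const Ω c + (1 - a) • X) = a * c + (1 - a) * I X := by
  have hcK : c ∈ K := h.mem_of_abs_le hc.le
  have hyK := h.mem hX
  by_cases hae : ∀ᵐ ω ∂μ, X ω = I X
  · have hm : a * c + (1 - a) * I X ∈ K := h.convex hcK hyK ha0.le (sub_nonneg.2 ha1.le)
      (add_sub_cancel _ _)
    rw [← h.const _ hm]
    refine h.congr _ _ (h.mix_mem (fun _ => hcK) hX ha0.le ha1.le) (fun _ => hm) ?_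
    filter_upwards [hae] with ω hω
    simp [hω]
  set y := I X with hy
  set D : Set Ω := {ω | X ω < y} with hDdef
  have hD : MeasurableSet D := measurableSet_lt X.measurable measurable_const
  have hD0 : 0 < μ D := h.measure_lt_pos hX hae
  have hpos := h.measure_gt_pos hX hae
  have hD1 : 0 < μ Dᶜ := hpos.trans_le (measure_mono fun ω (hω : y < X ω) => not_lt.2 hω.le)
  obtain ⟨ω1, h1⟩ : D.Nonempty := nonempty_of_measure_ne_zero hD0.ne'
  obtain ⟨ω2, h2⟩ : {ω | y < X ω}.Nonempty := nonempty_of_measure_ne_zero hpos.ne'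
  simp only [Set.mem_ofPred_eq, hDdef] at h1 h2
  have key : ∀ e : ℝ, 0 < e → e < y - X ω1 → e < X ω2 - y → e < 1 - |c| →
      |I (a • SimpleFunc.const Ω c + (1 - a) • X) - (a * c + (1 - a) * y)| ≤ e := by
    intro e he e1 e2 e3
    have habs := abs_le.1 (le_refl |c|)
    have hcp : c + e ∈ K := h.mem_of_mem h.neg_one_mem h.one_mem (by linarith) (by linarith)
    have hcm : c - e ∈ K := h.mem_of_mem h.neg_one_mem h.one_mem (by linarith) (by linarith)
    have hym : y - e ∈ K := h.mem_of_mem (hX ω1) hyK (by linarith) (by linarith)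
    have hyp : y + e ∈ K := h.mem_of_mem hyK (hX ω2) (by linarith) (by linarith)
    obtain ⟨q, p, hq0, hq1, hp0, hp1, hZ⟩ := h.exists_twoLevel hD hD0 hD1 he hym hyp
    have hqK : q ∈ K := h.mem_of_mem hym hyK hq0 hq1.le
    have hpK : p ∈ K := h.mem_of_mem hyK hyp hp0 hp1
    have hZK := twoLevel_forall (D := D) (hD := hD) (S := (· ∈ K)) hqK hpK
    have hZD : {ω | twoLevel D hD q p ω < I (twoLevel D hD q p)} = D := by
      rw [hZ]; exact twoLevel_disappointment hq1 hp0
    have ha1' : 0 ≤ 1 - a := by linarith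
    have hmemc : ∀ s : ℝ, -e ≤ s → s ≤ e → a * c + (1 - a) * y + s ∈ K := by
      intro s hs hs'
      have : a * c + (1 - a) * y + s = a * (c + s) + (1 - a) * (y + s) := by ring
      rw [this]
      exact h.convex (h.mem_of_mem hcm hcp (by linarith) (by linarith))
        (h.mem_of_mem hym hyp (by linarith) (by linarith)) ha0.le ha1' (add_sub_cancel _ _)
    rw [abs_le]
    constructor
    · have hBK := twoLevel_forall (D := D) (hD := hD) (S := (· ∈ K)) hcm hcK
      have hb := h.twoLevel_bounds hD hD0 hD1 hcm hcK (by linarith)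
      have s1 := h.disco (twoLevel D hD (c - e) c) (twoLevel D hD q p) X hBK hZK hX
        (by rw [hZD]; exact twoLevel_disappointment hb.1 hb.2.le) hZ a ha0 ha1
      have s2 := h.mono (a • twoLevel D hD (c - e) c + (1 - a) • X)
        (a • SimpleFunc.const Ω c + (1 - a) • X) (h.mix_mem hBK hX ha0.le ha1.le)
        (h.mix_mem (fun _ => hcK) hX ha0.le ha1.le) (fun ω => by
          have := twoLevel_forall (D := D) (hD := hD) (S := (· ≤ c)) (by linarith : c - e ≤ c)
            le_rfl ω
          have := mul_le_mul_of_nonneg_left this ha0.le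
          simpa using this)
      have s3 := h.le_of_forall_ge (h.mix_mem hBK hZK ha0.le ha1.le) (hmemc (-e) le_rfl
        (by linarith)) (fun ω => by
          have t1 := twoLevel_forall (D := D) (hD := hD) (S := (c - e ≤ ·)) le_rfl
            (by linarith : c - e ≤ c) ω
          have t2 := twoLevel_forall (D := D) (hD := hD) (S := (y - e ≤ ·)) hq0
            (by linarith : y - e ≤ p) ω
          have := mul_le_mul_of_nonneg_left t1 ha0.le
          have := mul_le_mul_of_nonneg_left t2 ha1'
          simp only [SimpleFunc.coe_add, SimpleFunc.coe_smul, Pi.add_apply, Pi.smul_apply,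
            smul_eq_mul]
          linarith)
      linarith
    · have hBK := twoLevel_forall (D := D) (hD := hD) (S := (· ∈ K)) hcK hcp
      have hb := h.twoLevel_bounds hD hD0 hD1 hcK hcp (by linarith)
      have s1 := h.disco (twoLevel D hD c (c + e)) X (twoLevel D hD q p) hBK hX hZK
        (by rw [← hy, ← hDdef]; exact twoLevel_disappointment hb.1 hb.2.le) hZ.symm a ha0 ha1
      have s2 := h.mono (a • SimpleFunc.const Ω c + (1 - a) • X)
        (a • twoLevel D hD c (c + e) + (1 - a) • X)
        (h.mix_mem (fun _ => hcK) hX ha0.le ha1.le) (h.mix_mem hBK hX ha0.le ha1.le) (fun ω => by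
          have := twoLevel_forall (D := D) (hD := hD) (S := (c ≤ ·)) le_rfl
            (by linarith : c ≤ c + e) ω
          have := mul_le_mul_of_nonneg_left this ha0.le
          simpa using this)
      have s3 := h.le_of_forall_le (h.mix_mem hBK hZK ha0.le ha1.le) (hmemc e (by linarith)
        le_rfl) (fun ω => by
          have t1 := twoLevel_forall (D := D) (hD := hD) (S := (· ≤ c + e))
            (by linarith : c ≤ c + e) le_rfl ω
          have t2 := twoLevel_forall (D := D) (hD := hD) (S := (· ≤ y + e))
            (by linarith : q ≤ y + e) hp1 ω
          have := mul_le_mul_of_nonneg_left t1 ha0.le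
          have := mul_le_mul_of_nonneg_left t2 ha1'
          simp only [SimpleFunc.coe_add, SimpleFunc.coe_smul, Pi.add_apply, Pi.smul_apply,
            smul_eq_mul]
          linarith)
      linarith
  by_contra hne
  have habs : 0 < |I (a • SimpleFunc.const Ω c + (1 - a) • X) - (a * c + (1 - a) * y)| :=
    abs_pos.2 (sub_ne_zero.2 hne)
  set δ := |I (a • SimpleFunc.const Ω c + (1 - a) • X) - (a * c + (1 - a) * y)|
  set M := min (min δ (y - X ω1)) (min (X ω2 - y) (1 - |c|)) with hM
  have hMpos : 0 < M := lt_min (lt_min habs (by linarith)) (lt_min (by linarith) (by linarith))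
  have m1 : M ≤ δ := (min_le_left _ _).trans (min_le_left _ _)
  have m2 : M ≤ y - X ω1 := (min_le_left _ _).trans (min_le_right _ _)
  have m3 : M ≤ X ω2 - y := (min_le_right _ _).trans (min_le_left _ _)
  have m4 : M ≤ 1 - |c| := (min_le_right _ _).trans (min_le_right _ _)
  have := key (M / 2) (by linarith) (by linarith) (by linarith) (by linarith)
  linarith

theorem smul_eq [Nonempty Ω] (h : IsCertaintyEquivalent μ K I) {X : SimpleFunc Ω ℝ}
    (hX : ∀ ω, X ω ∈ K) {k : ℝ} (hk : 0 < k) (hk1 : k ≤ 1) : I (k • X) = k * I X := by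
  rcases hk1.eq_or_lt with rfl | hk1
  · simp
  have := h.certainty_independence hX (c := 0) (a := 1 - k) (by simp) (by linarith) (by linarith)
  rw [show (1 - k) • SimpleFunc.const Ω (0 : ℝ) + (1 - (1 - k)) • X = k • X by
    ext ω; simp] at this
  rw [this]; ring

end IsCertaintyEquivalent

/-! ### The extension to all simple random variables -/

/-- The properties of a certainty equivalent on all simple random variables that follow from
certainty independence and disco aversion: a strictly monotone, normalized, superlinear functional
that is additive on pairs with the same disappointment event. -/
structure IsDiscoFunctional {Ω : Type*} [MeasurableSpace Ω] (μ : Measure Ω)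
    (J : SimpleFunc Ω ℝ → ℝ) : Prop where
  mono : ∀ X Y : SimpleFunc Ω ℝ, (∀ ω, X ω ≤ Y ω) → J X ≤ J Y
  strict : ∀ X Y : SimpleFunc Ω ℝ, (∀ ω, X ω ≤ Y ω) → 0 < μ {ω | X ω < Y ω} → J X < J Y
  congr : ∀ X Y : SimpleFunc Ω ℝ, X =ᵐ[μ] Y → J X = J Y
  add_const : ∀ (X : SimpleFunc Ω ℝ) (c : ℝ), J (X + SimpleFunc.const Ω c) = J X + c
  smul : ∀ (X : SimpleFunc Ω ℝ) (t : ℝ), 0 < t → J (t • X) = t * J X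
  superadd : ∀ X Y : SimpleFunc Ω ℝ, J X + J Y ≤ J (X + Y)
  disco_add : ∀ X Y : SimpleFunc Ω ℝ, {ω | X ω < J X} = {ω | Y ω < J Y} → J (X + Y) = J X + J Y

section Extension

variable {Ω : Type*} [MeasurableSpace Ω] {μ : Measure Ω} {K : Set ℝ} {I : SimpleFunc Ω ℝ → ℝ}

theorem exists_one_le_bound (X : SimpleFunc Ω ℝ) :
    ∃ t : ℝ, 1 ≤ t ∧ ∀ ω, |X ω| ≤ t := by
  obtain ⟨C, hC⟩ := X.exists_forall_norm_le
  exact ⟨max 1 C, le_max_left _ _, fun ω => (hC ω).trans (le_max_right _ _)⟩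

/-- Some bound, at least `1`, for the absolute value of a simple function. -/
noncomputable def simpleBound (X : SimpleFunc Ω ℝ) : ℝ := (exists_one_le_bound X).choose

theorem one_le_simpleBound (X : SimpleFunc Ω ℝ) : 1 ≤ simpleBound X :=
  (exists_one_le_bound X).choose_spec.1

theorem abs_le_simpleBound (X : SimpleFunc Ω ℝ) (ω : Ω) : |X ω| ≤ simpleBound X :=
  (exists_one_le_bound X).choose_spec.2 ω

/-- The positively homogeneous extension of `I`, which may be defined only for random variables with
values in a neighbourhood of `0`, to all simple random variables. -/
noncomputable def homogeneousExtension (I : SimpleFunc Ω ℝ → ℝ) (X : SimpleFunc Ω ℝ) : ℝ :=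
  simpleBound X * I ((simpleBound X)⁻¹ • X)

namespace IsCertaintyEquivalent

theorem smul_mem (h : IsCertaintyEquivalent μ K I) {X : SimpleFunc Ω ℝ} {t : ℝ} (ht : 0 < t)
    (hX : ∀ ω, |X ω| ≤ t) (ω : Ω) : (t⁻¹ • X) ω ∈ K := by
  refine h.mem_of_abs_le ?_
  simp only [SimpleFunc.coe_smul, Pi.smul_apply, smul_eq_mul, abs_mul, abs_inv, abs_of_pos ht]
  rw [inv_mul_le_one₀ ht]
  exact hX ω

theorem extension_eq [Nonempty Ω] (h : IsCertaintyEquivalent μ K I) {X : SimpleFunc Ω ℝ} {t : ℝ}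
    (ht : 0 < t) (hX : ∀ ω, |X ω| ≤ t) : homogeneousExtension I X = t * I (t⁻¹ • X) := by
  set s := simpleBound X with hs
  have hs0 : 0 < s := one_pos.trans_le (one_le_simpleBound X)
  have aux : ∀ {r : ℝ}, 0 < r → (∀ ω, |X ω| ≤ r) → r ≤ s + t →
      r * I (r⁻¹ • X) = (s + t) * I ((s + t)⁻¹ • X) := by
    intro r hr hXr hrt
    have := h.smul_eq (h.smul_mem hr hXr) (k := r / (s + t)) (by positivity)
      ((div_le_one (by positivity)).2 hrt)
    rw [smul_smul, show r / (s + t) * r⁻¹ = (s + t)⁻¹ by field_simp] at this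
    rw [this]; field_simp
  unfold homogeneousExtension
  rw [aux hs0 (abs_le_simpleBound X) (by linarith), aux ht hX (by linarith)]

theorem extension_eq_of_mem [Nonempty Ω] (h : IsCertaintyEquivalent μ K I) {X : SimpleFunc Ω ℝ}
    (hX : ∀ ω, X ω ∈ K) : homogeneousExtension I X = I X := by
  have hs := one_le_simpleBound X
  unfold homogeneousExtension
  rw [h.smul_eq hX (by positivity) (inv_le_one_of_one_le₀ hs)]
  field_simp

theorem isDiscoFunctional [Nonempty Ω] (h : IsCertaintyEquivalent μ K I) :
    IsDiscoFunctional μ (homogeneousExtension I) := by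
  have add_const : ∀ (X : SimpleFunc Ω ℝ) (c : ℝ),
      homogeneousExtension I (X + SimpleFunc.const Ω c) = homogeneousExtension I X + c := by
    intro X c
    have hs := one_le_simpleBound X
    have hc := abs_nonneg c
    set t := simpleBound X + |c| + 1 with ht
    have ht0 : 0 < t := by linarith
    have b1 : ∀ ω, |X ω| ≤ t := fun ω => (abs_le_simpleBound X ω).trans (by linarith)
    have b2 : ∀ ω, |(X + SimpleFunc.const Ω c) ω| ≤ 2 * t := fun ω => by
      have := abs_add_le (X ω) c
      have := abs_le_simpleBound X ω
      simp only [SimpleFunc.coe_add, Pi.add_apply, SimpleFunc.const_apply]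
      linarith
    rw [h.extension_eq ht0 b1, h.extension_eq (by linarith) b2]
    have := h.certainty_independence (h.smul_mem ht0 b1) (c := c / t) (a := 1 / 2)
      (by rw [abs_div, abs_of_pos ht0, div_lt_one ht0]; linarith) (by norm_num) (by norm_num)
    rw [show (2 * t)⁻¹ • (X + SimpleFunc.const Ω c) = (1 / 2 : ℝ) • SimpleFunc.const Ω (c / t) +
      (1 - 1 / 2 : ℝ) • (t⁻¹ • X) by
        ext ω
        simp only [SimpleFunc.coe_add, SimpleFunc.coe_smul, Pi.add_apply, Pi.smul_apply,
          smul_eq_mul, SimpleFunc.const_apply]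
        field_simp; ring, this]
    field_simp; ring
  have smul : ∀ (X : SimpleFunc Ω ℝ) (t : ℝ), 0 < t →
      homogeneousExtension I (t • X) = t * homogeneousExtension I X := by
    intro X t ht
    have hs0 : 0 < simpleBound X := one_pos.trans_le (one_le_simpleBound X)
    rw [h.extension_eq hs0 (abs_le_simpleBound X), h.extension_eq (t := t * simpleBound X)
      (by positivity) (fun ω => by
        simp only [SimpleFunc.coe_smul, Pi.smul_apply, smul_eq_mul, abs_mul, abs_of_pos ht]
        exact mul_le_mul_of_nonneg_left (abs_le_simpleBound X ω) ht.le), smul_smul,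
      show (t * simpleBound X)⁻¹ * t = (simpleBound X)⁻¹ by field_simp]
    ring
  -- a common scale for two random variables
  have two : ∀ X Y : SimpleFunc Ω ℝ, ∃ t : ℝ, 0 < t ∧ (∀ ω, |X ω| ≤ t) ∧ (∀ ω, |Y ω| ≤ t) :=
    fun X Y => by
      have h1 := one_le_simpleBound X
      have h2 := one_le_simpleBound Y
      exact ⟨simpleBound X + simpleBound Y, by linarith,
        fun ω => (abs_le_simpleBound X ω).trans (by linarith),
        fun ω => (abs_le_simpleBound Y ω).trans (by linarith)⟩
  have half : ∀ (X Y : SimpleFunc Ω ℝ) (t : ℝ), 0 < t → (∀ ω, |X ω| ≤ t) → (∀ ω, |Y ω| ≤ t) →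
      homogeneousExtension I (X + Y) =
        2 * t * I ((1 / 2 : ℝ) • (t⁻¹ • X) + (1 - 1 / 2 : ℝ) • (t⁻¹ • Y)) := by
    intro X Y t ht hX hY
    rw [h.extension_eq (t := 2 * t) (by linarith) (fun ω => by
      have := abs_add_le (X ω) (Y ω)
      have := hX ω
      have := hY ω
      simp only [SimpleFunc.coe_add, Pi.add_apply]
      linarith)]
    congr 2
    ext ω
    simp only [SimpleFunc.coe_add, SimpleFunc.coe_smul, Pi.add_apply, Pi.smul_apply, smul_eq_mul]
    field_simp; ring
  have mono : ∀ X Y : SimpleFunc Ω ℝ, (∀ ω, X ω ≤ Y ω) →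
      homogeneousExtension I X ≤ homogeneousExtension I Y := by
    intro X Y hXY
    obtain ⟨t, ht, hX, hY⟩ := two X Y
    rw [h.extension_eq ht hX, h.extension_eq ht hY]
    exact mul_le_mul_of_nonneg_left (h.mono _ _ (h.smul_mem ht hX) (h.smul_mem ht hY)
      fun ω => mul_le_mul_of_nonneg_left (hXY ω) (inv_nonneg.2 ht.le)) ht.le
  have superadd_zero : ∀ X Y : SimpleFunc Ω ℝ, homogeneousExtension I X = 0 →
      homogeneousExtension I Y = 0 → 0 ≤ homogeneousExtension I (X + Y) := by
    intro X Y hX0 hY0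
    obtain ⟨t, ht, hX, hY⟩ := two X Y
    rw [half X Y t ht hX hY]
    rw [h.extension_eq ht hX] at hX0
    rw [h.extension_eq ht hY] at hY0
    have hX1 : I (t⁻¹ • X) = 0 := (mul_eq_zero.1 hX0).resolve_left ht.ne'
    have hY1 : I (t⁻¹ • Y) = 0 := (mul_eq_zero.1 hY0).resolve_left ht.ne'
    have := h.disco _ _ _ (h.smul_mem ht hX) (h.smul_mem ht hX) (h.smul_mem ht hY) rfl
      (hX1.trans hY1.symm) (1 / 2) (by norm_num) (by norm_num)
    rw [← add_smul, add_sub_cancel, one_smul, hX1] at this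
    positivity
  have superadd : ∀ X Y : SimpleFunc Ω ℝ,
      homogeneousExtension I X + homogeneousExtension I Y ≤ homogeneousExtension I (X + Y) := by
    intro X Y
    have := superadd_zero (X + SimpleFunc.const Ω (-homogeneousExtension I X))
      (Y + SimpleFunc.const Ω (-homogeneousExtension I Y)) (by rw [add_const]; ring)
      (by rw [add_const]; ring)
    rw [show X + SimpleFunc.const Ω (-homogeneousExtension I X) +
      (Y + SimpleFunc.const Ω (-homogeneousExtension I Y)) = X + Y +
        SimpleFunc.const Ω (-homogeneousExtension I X - homogeneousExtension I Y) by
          ext ω; simp; ring, add_const] at this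
    linarith
  refine ⟨mono, ?_, ?_, add_const, smul, superadd, ?_⟩
  · intro X Y hXY hpos
    obtain ⟨t, ht, hX, hY⟩ := two X Y
    rw [h.extension_eq ht hX, h.extension_eq ht hY]
    refine mul_lt_mul_of_pos_left (h.strict _ _ (h.smul_mem ht hX) (h.smul_mem ht hY)
      (fun ω => mul_le_mul_of_nonneg_left (hXY ω) (inv_nonneg.2 ht.le)) ?_) ht
    refine hpos.trans_le (measure_mono fun ω hω => ?_)
    exact mul_lt_mul_of_pos_left hω (inv_pos.2 ht)
  · intro X Y hXY
    obtain ⟨t, ht, hX, hY⟩ := two X Y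
    rw [h.extension_eq ht hX, h.extension_eq ht hY]
    congr 1
    refine h.congr _ _ (h.smul_mem ht hX) (h.smul_mem ht hY) ?_
    filter_upwards [hXY] with ω hω
    simp [hω]
  · intro X Y hD
    refine le_antisymm ?_ ?_
    · obtain ⟨t', ht', hX', hY'⟩ := two X Y
      set t := t' + |homogeneousExtension I Y| with htdef
      have hJ := abs_nonneg (homogeneousExtension I Y)
      have ht : 0 < t := by linarith
      have hX : ∀ ω, |X ω| ≤ t := fun ω => (hX' ω).trans (by linarith)
      have hY : ∀ ω, |Y ω| ≤ t := fun ω => (hY' ω).trans (by linarith)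
      have hc : ∀ ω, |SimpleFunc.const Ω (homogeneousExtension I Y) ω| ≤ t := fun ω => by
        simp only [SimpleFunc.const_apply]; linarith
      have eX : I (t⁻¹ • X) = t⁻¹ * homogeneousExtension I X := by
        rw [h.extension_eq ht hX]; field_simp
      have eY : I (t⁻¹ • Y) = t⁻¹ * homogeneousExtension I Y := by
        rw [h.extension_eq ht hY]; field_simp
      have hset : ∀ (W : SimpleFunc Ω ℝ) (c : ℝ), {ω | (t⁻¹ • W) ω < t⁻¹ * c} = {ω | W ω < c} := by
        intro W c
        ext ω
        exact mul_lt_mul_iff_right₀ (inv_pos.2 ht)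
      have hcm := h.smul_mem ht hc
      have hcs : t⁻¹ • SimpleFunc.const Ω (homogeneousExtension I Y) =
          SimpleFunc.const Ω (t⁻¹ * homogeneousExtension I Y) := by ext ω; simp
      have := h.disco (t⁻¹ • X) (t⁻¹ • Y) (t⁻¹ • SimpleFunc.const Ω (homogeneousExtension I Y))
        (h.smul_mem ht hX) (h.smul_mem ht hY) (h.smul_mem ht hc)
        (by rw [eX, eY, hset, hset, hD]) (by
          rw [eY, hcs, h.const]
          obtain ⟨ω⟩ := ‹Nonempty Ω›
          have := hcm ω
          rw [hcs] at this
          exact this) (1 / 2) (by norm_num) (by norm_num)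
      rw [← add_const, half X Y t ht hX hY, half X _ t ht hX hc]
      exact mul_le_mul_of_nonneg_left this (by linarith)
    · exact superadd X Y

end IsCertaintyEquivalent

end Extension

/-! ### Linear pieces of a disco additive functional -/

section LinearPieces

variable {Ω : Type*} [MeasurableSpace Ω]

/-- The indicator function of an event as a simple function (zero if `A` is not measurable). -/
noncomputable def ind (A : Set Ω) : SimpleFunc Ω ℝ := (SimpleFunc.const Ω (1 : ℝ)).restrict A

theorem ind_of_mem {A : Set Ω} (hA : MeasurableSet A) {ω : Ω} (h : ω ∈ A) : ind A ω = 1 := by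
  simp [ind, SimpleFunc.restrict_apply _ hA, h]

theorem ind_of_notMem {A : Set Ω} (hA : MeasurableSet A) {ω : Ω} (h : ω ∉ A) : ind A ω = 0 := by
  simp [ind, SimpleFunc.restrict_apply _ hA, h]

theorem ind_nonneg {A : Set Ω} (hA : MeasurableSet A) (ω : Ω) : 0 ≤ ind A ω := by
  by_cases h : ω ∈ A
  · rw [ind_of_mem hA h]; exact zero_le_one
  · rw [ind_of_notMem hA h]

theorem ind_le_one {A : Set Ω} (hA : MeasurableSet A) (ω : Ω) : ind A ω ≤ 1 := by
  by_cases h : ω ∈ A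
  · rw [ind_of_mem hA h]
  · rw [ind_of_notMem hA h]; exact zero_le_one

/-- Measurable events that are neither null nor conull. -/
structure IsProper (μ : Measure Ω) (D : Set Ω) : Prop where
  meas : MeasurableSet D
  pos : 0 < μ D
  compl_pos : 0 < μ Dᶜ

theorem IsProper.compl {μ : Measure Ω} {D : Set Ω} (h : IsProper μ D) : IsProper μ Dᶜ :=
  ⟨h.meas.compl, h.compl_pos, by rw [compl_compl]; exact h.pos⟩

/-- The linear extension of `J` from the cone of random variables with disappointment event `D`,
evaluated by adding a large multiple of `1_{Dᶜ}`, which brings every simple function into the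
cone. -/
noncomputable def linPiece (J : SimpleFunc Ω ℝ → ℝ) (D : Set Ω) (Z : SimpleFunc Ω ℝ) : ℝ :=
  let n := (2 * simpleBound Z + 1) / min (J (ind Dᶜ)) (1 - J (ind Dᶜ))
  J (n • ind Dᶜ + Z) - n * J (ind Dᶜ)

namespace IsDiscoFunctional

variable {μ : Measure Ω} {J : SimpleFunc Ω ℝ → ℝ}

theorem zero (h : IsDiscoFunctional μ J) : J 0 = 0 := by
  have := h.smul 0 2 two_pos
  rw [smul_zero] at this
  linarith

theorem const (h : IsDiscoFunctional μ J) (c : ℝ) : J (SimpleFunc.const Ω c) = c := by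
  have := h.add_const 0 c
  rwa [zero_add, h.zero, zero_add] at this

theorem le_add (h : IsDiscoFunctional μ J) {X Y : SimpleFunc Ω ℝ} {c : ℝ}
    (hXY : ∀ ω, X ω ≤ Y ω + c) : J X ≤ J Y + c := by
  rw [← h.add_const]
  exact h.mono _ _ hXY

theorem ind_compl_mem (h : IsDiscoFunctional μ J) {D : Set Ω} (hD : IsProper μ D) :
    0 < J (ind Dᶜ) ∧ J (ind Dᶜ) < 1 := by
  have hm := hD.meas.compl
  constructor
  · have := h.strict 0 (ind Dᶜ) (ind_nonneg hm) (hD.compl_pos.trans_le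
      (measure_mono fun ω hω => by simp [ind_of_mem hm hω]))
    rwa [h.zero] at this
  · have := h.strict (ind Dᶜ) (SimpleFunc.const Ω 1) (ind_le_one hm) (hD.pos.trans_le
      (measure_mono fun ω hω => by
        have : ω ∉ Dᶜ := fun hc => hc hω
        simp [ind_of_notMem hm this]))
    rwa [h.const] at this

theorem aligned_add (h : IsDiscoFunctional μ J) {X Y : SimpleFunc Ω ℝ} {D : Set Ω}
    (hX : {ω | X ω < J X} = D) (hY : {ω | Y ω < J Y} = D) :
    {ω | (X + Y) ω < J (X + Y)} = D := by
  rw [h.disco_add X Y (hX.trans hY.symm)]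
  ext ω
  have e1 : X ω < J X ↔ ω ∈ D := by rw [← hX]; rfl
  have e2 : Y ω < J Y ↔ ω ∈ D := by rw [← hY]; rfl
  simp only [Set.mem_ofPred_eq, SimpleFunc.coe_add, Pi.add_apply]
  by_cases hω : ω ∈ D
  · have := e1.2 hω
    have := e2.2 hω
    simp only [hω, iff_true]; linarith
  · have := not_lt.1 (mt e1.1 hω)
    have := not_lt.1 (mt e2.1 hω)
    simp only [hω, iff_false, not_lt]; linarith

theorem aligned_smul (h : IsDiscoFunctional μ J) {X : SimpleFunc Ω ℝ} {D : Set Ω}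
    (hX : {ω | X ω < J X} = D) {t : ℝ} (ht : 0 < t) : {ω | (t • X) ω < J (t • X)} = D := by
  rw [h.smul X t ht, ← hX]
  ext ω
  exact mul_lt_mul_iff_right₀ ht

theorem aligned_ind (h : IsDiscoFunctional μ J) {D : Set Ω} (hD : IsProper μ D) :
    {ω | ind Dᶜ ω < J (ind Dᶜ)} = D := by
  have hb := h.ind_compl_mem hD
  ext ω
  by_cases hω : ω ∈ D
  · have : ω ∉ Dᶜ := fun hc => hc hω
    simp [ind_of_notMem hD.meas.compl this, hω, hb.1]
  · simp [ind_of_mem hD.meas.compl (show ω ∈ Dᶜ from hω), hω, hb.2.le]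

theorem exists_aligned (h : IsDiscoFunctional μ J) {D : Set Ω} (hD : IsProper μ D)
    (Z : SimpleFunc Ω ℝ) : ∃ n : ℝ, 0 < n ∧ {ω | (n • ind Dᶜ + Z) ω < J (n • ind Dᶜ + Z)} = D ∧
      linPiece J D Z = J (n • ind Dᶜ + Z) - n * J (ind Dᶜ) := by
  obtain ⟨hb0, hb1⟩ := h.ind_compl_mem hD
  have hM := one_le_simpleBound Z
  have hmin : 0 < min (J (ind Dᶜ)) (1 - J (ind Dᶜ)) := lt_min hb0 (by linarith)
  set n := (2 * simpleBound Z + 1) / min (J (ind Dᶜ)) (1 - J (ind Dᶜ)) with hn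
  have hn0 : 0 < n := by positivity
  have hnm : n * min (J (ind Dᶜ)) (1 - J (ind Dᶜ)) = 2 * simpleBound Z + 1 := by
    rw [hn]; field_simp
  have e1 : n * min (J (ind Dᶜ)) (1 - J (ind Dᶜ)) ≤ n * J (ind Dᶜ) :=
    mul_le_mul_of_nonneg_left (min_le_left _ _) hn0.le
  have e2 : n * min (J (ind Dᶜ)) (1 - J (ind Dᶜ)) ≤ n * (1 - J (ind Dᶜ)) :=
    mul_le_mul_of_nonneg_left (min_le_right _ _) hn0.le
  refine ⟨n, hn0, ?_, rfl⟩
  have up : J (n • ind Dᶜ + Z) ≤ n * J (ind Dᶜ) + simpleBound Z := by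
    rw [← h.smul _ _ hn0]
    refine h.le_add fun ω => ?_
    have := (abs_le.1 (abs_le_simpleBound Z ω)).2
    simp only [SimpleFunc.coe_add, Pi.add_apply]; linarith
  have dn : n * J (ind Dᶜ) ≤ J (n • ind Dᶜ + Z) + simpleBound Z := by
    rw [← h.smul _ _ hn0]
    refine h.le_add fun ω => ?_
    have := (abs_le.1 (abs_le_simpleBound Z ω)).1
    simp only [SimpleFunc.coe_add, Pi.add_apply]; linarith
  ext ω
  have hZ := abs_le.1 (abs_le_simpleBound Z ω)
  simp only [Set.mem_ofPred_eq, SimpleFunc.coe_add, SimpleFunc.coe_smul, Pi.add_apply,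
    Pi.smul_apply, smul_eq_mul]
  by_cases hω : ω ∈ D
  · have : ω ∉ Dᶜ := fun hc => hc hω
    rw [ind_of_notMem hD.meas.compl this]
    simp only [hω, iff_true]; linarith [hZ.2]
  · rw [ind_of_mem hD.meas.compl (show ω ∈ Dᶜ from hω)]
    simp only [hω, iff_false, not_lt]; linarith [hZ.1]

theorem linPiece_eq (h : IsDiscoFunctional μ J) {D : Set Ω} (hD : IsProper μ D) {Z : SimpleFunc Ω ℝ}
    {n : ℝ} (hn : 0 < n) (hal : {ω | (n • ind Dᶜ + Z) ω < J (n • ind Dᶜ + Z)} = D) :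
    linPiece J D Z = J (n • ind Dᶜ + Z) - n * J (ind Dᶜ) := by
  obtain ⟨k, hk, hal', hs⟩ := h.exists_aligned hD Z
  have a1 := h.disco_add (n • ind Dᶜ + Z) (k • ind Dᶜ)
    (hal.trans (h.aligned_smul (h.aligned_ind hD) hk).symm)
  have a2 := h.disco_add (k • ind Dᶜ + Z) (n • ind Dᶜ)
    (hal'.trans (h.aligned_smul (h.aligned_ind hD) hn).symm)
  rw [show n • ind Dᶜ + Z + k • ind Dᶜ = k • ind Dᶜ + Z + n • ind Dᶜ by abel, a2,
    h.smul _ _ hk, h.smul _ _ hn] at a1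
  rw [hs]; linarith

theorem linPiece_add (h : IsDiscoFunctional μ J) {D : Set Ω} (hD : IsProper μ D)
    (Z W : SimpleFunc Ω ℝ) : linPiece J D (Z + W) = linPiece J D Z + linPiece J D W := by
  obtain ⟨n, hn, hal, hs⟩ := h.exists_aligned hD Z
  obtain ⟨k, hk, hal', hs'⟩ := h.exists_aligned hD W
  have e : (n + k) • ind Dᶜ + (Z + W) = (n • ind Dᶜ + Z) + (k • ind Dᶜ + W) := by
    rw [add_smul]; abel
  rw [h.linPiece_eq hD (n := n + k) (by linarith) (by rw [e]; exact h.aligned_add hal hal'), e,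
    h.disco_add _ _ (hal.trans hal'.symm), hs, hs']
  ring

theorem linPiece_of_aligned (h : IsDiscoFunctional μ J) {D : Set Ω} (hD : IsProper μ D)
    {X : SimpleFunc Ω ℝ} (hX : {ω | X ω < J X} = D) : linPiece J D X = J X := by
  have e := h.aligned_smul (h.aligned_ind hD) one_pos
  rw [h.linPiece_eq hD one_pos (h.aligned_add e hX), h.disco_add _ _ (e.trans hX.symm),
    h.smul _ _ one_pos]
  ring

theorem linPiece_zero (h : IsDiscoFunctional μ J) {D : Set Ω} (hD : IsProper μ D) :
    linPiece J D 0 = 0 := by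
  have := h.linPiece_add hD 0 0
  rw [add_zero] at this
  linarith

theorem linPiece_smul (h : IsDiscoFunctional μ J) {D : Set Ω} (hD : IsProper μ D)
    (t : ℝ) (Z : SimpleFunc Ω ℝ) : linPiece J D (t • Z) = t * linPiece J D Z := by
  have pos : ∀ t : ℝ, 0 < t → linPiece J D (t • Z) = t * linPiece J D Z := by
    intro t ht
    obtain ⟨n, hn, hal, hs⟩ := h.exists_aligned hD Z
    have e : (t * n) • ind Dᶜ + t • Z = t • (n • ind Dᶜ + Z) := by
      rw [smul_add, smul_smul]
    rw [h.linPiece_eq hD (n := t * n) (by positivity) (by rw [e]; exact h.aligned_smul hal ht), e,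
      h.smul _ _ ht, hs]
    ring
  rcases lt_trichotomy t 0 with ht | rfl | ht
  · have e1 := pos (-t) (by linarith)
    have e2 := h.linPiece_add hD (t • Z) (-t • Z)
    rw [← add_smul, add_neg_cancel, zero_smul, h.linPiece_zero hD, e1] at e2
    linarith
  · rw [zero_smul, h.linPiece_zero hD, zero_mul]
  · exact pos t ht

/-- By superadditivity, the linear pieces lie above `J`. -/
theorem le_linPiece (h : IsDiscoFunctional μ J) {D : Set Ω} (hD : IsProper μ D)
    (Z : SimpleFunc Ω ℝ) : J Z ≤ linPiece J D Z := by
  obtain ⟨n, hn, hal, hs⟩ := h.exists_aligned hD Z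
  have := h.superadd (n • ind Dᶜ) Z
  rw [h.smul _ _ hn] at this
  rw [hs]; linarith

theorem linPiece_const (h : IsDiscoFunctional μ J) {D : Set Ω} (hD : IsProper μ D) (c : ℝ) :
    linPiece J D (SimpleFunc.const Ω c) = c := by
  have e1 := h.le_linPiece hD (SimpleFunc.const Ω c)
  have e2 := h.le_linPiece hD (SimpleFunc.const Ω (-c))
  have e3 := h.linPiece_smul hD (-1) (SimpleFunc.const Ω c)
  rw [show (-1 : ℝ) • SimpleFunc.const Ω c = SimpleFunc.const Ω (-c) by ext; simp] at e3
  rw [h.const] at e1 e2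
  linarith

theorem linPiece_ind_compl (h : IsDiscoFunctional μ J) {D : Set Ω} (hD : IsProper μ D) :
    linPiece J D (ind Dᶜ) = J (ind Dᶜ) := h.linPiece_of_aligned hD (h.aligned_ind hD)

/-- `J` agrees with the linear piece of `D` also on the boundary of the cone of random variables
with disappointment event `D`. -/
theorem linPiece_of_le_of_ge (h : IsDiscoFunctional μ J) {D : Set Ω} (hD : IsProper μ D)
    {X : SimpleFunc Ω ℝ} (hle : ∀ ω ∈ D, X ω ≤ J X) (hge : ∀ ω ∉ D, J X ≤ X ω) :
    linPiece J D X = J X := by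
  obtain ⟨hb0, hb1⟩ := h.ind_compl_mem hD
  refine le_antisymm (le_of_forall_pos_le_add fun e he => ?_) (h.le_linPiece hD X)
  set b := J (ind Dᶜ) with hb
  set W : SimpleFunc Ω ℝ := e • (ind Dᶜ + SimpleFunc.const Ω (-b)) with hW
  have hJW : J W = 0 := by rw [hW, h.smul _ _ he, h.add_const, ← hb]; ring
  have hsW : linPiece J D W = 0 := by
    rw [hW, h.linPiece_smul hD, h.linPiece_add hD, h.linPiece_ind_compl hD, h.linPiece_const hD, ← hb]; ring
  have hWin : ∀ ω ∈ D, W ω = -(e * b) := fun ω hω => by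
    have : ω ∉ Dᶜ := fun hc => hc hω
    simp [hW, ind_of_notMem hD.meas.compl this]
  have hWout : ∀ ω ∉ D, W ω = e * (1 - b) := fun ω hω => by
    simp [hW, ind_of_mem hD.meas.compl (show ω ∈ Dᶜ from hω)]; ring
  have up : J (X + W) ≤ J X + e * (1 - b) := h.le_add fun ω => by
    simp only [SimpleFunc.coe_add, Pi.add_apply]
    by_cases hω : ω ∈ D
    · rw [hWin ω hω]; nlinarith
    · rw [hWout ω hω]
  have dn : J X ≤ J (X + W) := by
    have := h.superadd X W
    rwa [hJW, add_zero] at this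
  have hal : {ω | (X + W) ω < J (X + W)} = D := by
    ext ω
    simp only [Set.mem_ofPred_eq, SimpleFunc.coe_add, Pi.add_apply]
    by_cases hω : ω ∈ D
    · have := hle ω hω
      rw [hWin ω hω]
      simp only [hω, iff_true]; nlinarith
    · have := hge ω hω
      rw [hWout ω hω]
      simp only [hω, iff_false, not_lt]; linarith
  have := h.linPiece_of_aligned hD hal
  rw [h.linPiece_add hD, hsW, add_zero] at this
  nlinarith

theorem linPiece_mono (h : IsDiscoFunctional μ J) {D : Set Ω} (hD : IsProper μ D)
    {X Y : SimpleFunc Ω ℝ} (hXY : ∀ ω, X ω ≤ Y ω) : linPiece J D X ≤ linPiece J D Y := by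
  have e1 := h.linPiece_add hD X (Y - X)
  rw [add_sub_cancel] at e1
  have e2 := h.le_linPiece hD (Y - X)
  have e3 := h.mono 0 (Y - X) fun ω => by simpa using hXY ω
  rw [h.zero] at e3
  linarith

/-! ### The weights of events -/

theorem linPiece_ind_union (h : IsDiscoFunctional μ J) {D : Set Ω} (hD : IsProper μ D) {A B : Set Ω}
    (hA : MeasurableSet A) (hB : MeasurableSet B) (hAB : Disjoint A B) :
    linPiece J D (ind (A ∪ B)) = linPiece J D (ind A) + linPiece J D (ind B) := by
  rw [← h.linPiece_add hD]
  congr 1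
  ext ω
  rw [SimpleFunc.coe_add, Pi.add_apply]
  by_cases h1 : ω ∈ A
  · rw [ind_of_mem (hA.union hB) (Or.inl h1), ind_of_mem hA h1,
      ind_of_notMem hB (Set.disjoint_left.1 hAB h1), add_zero]
  · by_cases h2 : ω ∈ B
    · rw [ind_of_mem (hA.union hB) (Or.inr h2), ind_of_notMem hA h1, ind_of_mem hB h2, zero_add]
    · rw [ind_of_notMem (hA.union hB) (fun hc => hc.elim h1 h2), ind_of_notMem hA h1,
        ind_of_notMem hB h2, add_zero]

theorem linPiece_ind_split (h : IsDiscoFunctional μ J) {D : Set Ω} (hD : IsProper μ D) {A : Set Ω}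
    (hA : MeasurableSet A) {B : Set Ω} (hB : MeasurableSet B) :
    linPiece J D (ind A) = linPiece J D (ind (A ∩ B)) + linPiece J D (ind (A \ B)) := by
  rw [← h.linPiece_ind_union hD (hA.inter hB) (hA.diff hB)
    (Set.disjoint_left.2 fun ω h1 h2 => h2.2 h1.2), Set.inter_union_sdiff]

theorem linPiece_ind_nonneg (h : IsDiscoFunctional μ J) {D : Set Ω} (hD : IsProper μ D) {A : Set Ω}
    (hA : MeasurableSet A) : 0 ≤ linPiece J D (ind A) := by
  have := h.linPiece_mono hD (X := 0) (Y := ind A) (ind_nonneg hA)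
  rwa [h.linPiece_zero hD] at this

theorem J_ind_pos (h : IsDiscoFunctional μ J) {A : Set Ω} (hA : MeasurableSet A)
    (hpos : 0 < μ A) : 0 < J (ind A) := by
  have := h.strict 0 (ind A) (ind_nonneg hA) (hpos.trans_le
    (measure_mono fun ω hω => by simp [ind_of_mem hA hω]))
  rwa [h.zero] at this

theorem J_neg_ind_neg (h : IsDiscoFunctional μ J) {A : Set Ω} (hA : MeasurableSet A)
    (hpos : 0 < μ A) : J (-ind A) < 0 := by
  have := h.strict (-ind A) 0 (fun ω => by simpa using ind_nonneg hA ω) (hpos.trans_le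
    (measure_mono fun ω hω => by simp [ind_of_mem hA hω]))
  rwa [h.zero] at this

theorem linPiece_ind_pos (h : IsDiscoFunctional μ J) {D : Set Ω} (hD : IsProper μ D) {A : Set Ω}
    (hA : MeasurableSet A) (hpos : 0 < μ A) : 0 < linPiece J D (ind A) :=
  (h.J_ind_pos hA hpos).trans_le (h.le_linPiece hD _)

theorem linPiece_ind_null (h : IsDiscoFunctional μ J) {D : Set Ω} (hD : IsProper μ D) {A : Set Ω}
    (hA : MeasurableSet A) (hz : μ A = 0) : linPiece J D (ind A) = 0 := by
  have e := h.le_linPiece hD (-ind A)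
  rw [h.congr (-ind A) 0 ?_, h.zero, ← neg_one_smul ℝ, h.linPiece_smul hD] at e
  · linarith [h.linPiece_ind_nonneg hD hA]
  · have : ∀ᵐ ω ∂μ, ω ∉ A := measure_eq_zero_iff_ae_notMem.1 hz
    filter_upwards [this] with ω hω
    simp [ind_of_notMem hA hω]

/-- A win on `A` and a loss on `B` can be scaled so that they balance. -/
theorem exists_balance (h : IsDiscoFunctional μ J) {A B : Set Ω} (hA : MeasurableSet A)
    (hB : MeasurableSet B) (hpA : 0 < μ A) (hpB : 0 < μ B) :
    ∃ s t : ℝ, 0 < s ∧ 0 < t ∧ J (s • ind A - t • ind B) = 0 := by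
  have hcont : Continuous fun t : ℝ => J (t • ind A - (1 - t) • ind B) := by
    have key : ∀ t s : ℝ, J (t • ind A - (1 - t) • ind B) ≤
        J (s • ind A - (1 - s) • ind B) + 2 * |t - s| := by
      intro t s
      refine h.le_add fun ω => ?_
      have e1 := mul_le_mul (le_abs_self (t - s)) (ind_le_one hA ω) (ind_nonneg hA ω)
        (abs_nonneg _)
      have e2 := mul_le_mul (le_abs_self (t - s)) (ind_le_one hB ω) (ind_nonneg hB ω)
        (abs_nonneg _)
      simp only [SimpleFunc.coe_sub, SimpleFunc.coe_smul, Pi.sub_apply, Pi.smul_apply, smul_eq_mul]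
      linarith
    refine (LipschitzWith.of_dist_le_mul (K := 2) fun t s => ?_).continuous
    rw [Real.dist_eq, Real.dist_eq, abs_le]
    have k1 := key t s
    have k2 := key s t
    rw [abs_sub_comm] at k2
    simp only [NNReal.coe_ofNat]
    constructor <;> linarith
  have h0 : J ((0 : ℝ) • ind A - (1 - (0 : ℝ)) • ind B) < 0 := by
    simpa using h.J_neg_ind_neg hB hpB
  have h1 : 0 < J ((1 : ℝ) • ind A - (1 - (1 : ℝ)) • ind B) := by
    simpa using h.J_ind_pos hA hpA
  obtain ⟨t, ⟨ht0, ht1⟩, ht⟩ := intermediate_value_Icc zero_le_one hcont.continuousOn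
    ⟨h0.le, h1.le⟩
  refine ⟨t, 1 - t, ?_, ?_, ht⟩
  · rcases ht0.lt_or_eq with hlt | rfl
    · exact hlt
    · exact absurd ht h0.ne
  · rcases ht1.lt_or_eq with hlt | rfl
    · linarith
    · exact absurd ht h1.ne'

theorem linPiece_balance (h : IsDiscoFunctional μ J) {D A B : Set Ω} (hD : IsProper μ D)
    (hA : MeasurableSet A) (hB : MeasurableSet B) (hAD : ∀ ω ∈ A, ω ∉ D) (hBD : B ⊆ D) {s t : ℝ}
    (hs : 0 < s) (ht : 0 < t) (hJ : J (s • ind A - t • ind B) = 0) :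
    s * linPiece J D (ind A) = t * linPiece J D (ind B) := by
  have e := h.linPiece_of_le_of_ge hD (X := s • ind A - t • ind B) (fun ω hω => by
      have e1 : ω ∉ A := fun hc => hAD ω hc hω
      have e2 := mul_nonneg ht.le (ind_nonneg hB ω)
      rw [hJ]
      simp only [SimpleFunc.coe_sub, SimpleFunc.coe_smul, Pi.sub_apply, Pi.smul_apply, smul_eq_mul,
        ind_of_notMem hA e1]
      linarith) (fun ω hω => by
      have e1 : ω ∉ B := fun hc => hω (hBD hc)
      have e2 := mul_nonneg hs.le (ind_nonneg hA ω)
      rw [hJ]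
      simp only [SimpleFunc.coe_sub, SimpleFunc.coe_smul, Pi.sub_apply, Pi.smul_apply, smul_eq_mul,
        ind_of_notMem hB e1]
      linarith)
  rw [hJ, sub_eq_add_neg, ← neg_smul, h.linPiece_add hD, h.linPiece_smul hD, h.linPiece_smul hD] at e
  linarith

/-- The weights for two disappointment events are proportional where the events agree: a balanced
bet between a disappointing event `B ⊆ D ∩ D'` and an elating event `A ⊆ (D ∪ D')ᶜ` lies in both
cones. -/
theorem exists_proportional_of_pos (h : IsDiscoFunctional μ J) {D D' : Set Ω} (hD : IsProper μ D)
    (hD' : IsProper μ D') (hW : 0 < μ (D ∩ D')) (hU : 0 < μ (D ∪ D')ᶜ) :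
    ∃ c : ℝ, 0 < c ∧ ∀ A, MeasurableSet A → (∀ ω ∈ A, ω ∈ D ↔ ω ∈ D') →
      linPiece J D' (ind A) = c * linPiece J D (ind A) := by
  set W := D ∩ D' with hWdef
  set U := (D ∪ D')ᶜ with hUdef
  have mW : MeasurableSet W := hD.meas.inter hD'.meas
  have mU : MeasurableSet U := (hD.meas.union hD'.meas).compl
  have key : ∀ A B, MeasurableSet A → MeasurableSet B → A ⊆ U → B ⊆ W → 0 < μ A → 0 < μ B →
      linPiece J D' (ind A) * linPiece J D (ind B) = linPiece J D (ind A) * linPiece J D' (ind B) := by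
    intro A B hA hB hAU hBW hpA hpB
    obtain ⟨s, t, hs, ht, hJ⟩ := h.exists_balance hA hB hpA hpB
    have e1 := h.linPiece_balance hD hA hB (fun ω hω hc => hAU hω (Or.inl hc))
      (fun ω hω => (hBW hω).1) hs ht hJ
    have e2 := h.linPiece_balance hD' hA hB (fun ω hω hc => hAU hω (Or.inr hc))
      (fun ω hω => (hBW hω).2) hs ht hJ
    have : s * t * (linPiece J D' (ind A) * linPiece J D (ind B)) =
        s * t * (linPiece J D (ind A) * linPiece J D' (ind B)) := by
      linear_combination (t * linPiece J D (ind B)) * e2 - (t * linPiece J D' (ind B)) * e1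
    exact mul_left_cancel₀ (by positivity) this
  have pW := h.linPiece_ind_pos hD mW hW
  have pW' := h.linPiece_ind_pos hD' mW hW
  have pU := h.linPiece_ind_pos hD mU hU
  refine ⟨linPiece J D' (ind W) / linPiece J D (ind W), by positivity, ?_⟩
  have onU : ∀ A, MeasurableSet A → A ⊆ U →
      linPiece J D' (ind A) = linPiece J D' (ind W) / linPiece J D (ind W) * linPiece J D (ind A) := by
    intro A hA hAU
    rcases eq_or_ne (μ A) 0 with hz | hz
    · rw [h.linPiece_ind_null hD hA hz, h.linPiece_ind_null hD' hA hz, mul_zero]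
    · have := key A W hA mW hAU subset_rfl (pos_iff_ne_zero.2 hz) hW
      field_simp; linarith
  have onW : ∀ B, MeasurableSet B → B ⊆ W →
      linPiece J D' (ind B) = linPiece J D' (ind W) / linPiece J D (ind W) * linPiece J D (ind B) := by
    intro B hB hBW
    rcases eq_or_ne (μ B) 0 with hz | hz
    · rw [h.linPiece_ind_null hD hB hz, h.linPiece_ind_null hD' hB hz, mul_zero]
    · have e1 := key U B mU hB subset_rfl hBW hU (pos_iff_ne_zero.2 hz)
      rw [onU U mU subset_rfl] at e1
      refine mul_left_cancel₀ pU.ne' ?_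
      linarith
  intro A hA hAD
  rw [h.linPiece_ind_split hD hA mW, h.linPiece_ind_split hD' hA mW, onW _ (hA.inter mW)
    Set.inter_subset_right, onU _ (hA.diff mW) ?_]
  · ring
  · rintro ω ⟨h1, h2⟩ h3
    rcases h3 with h3 | h3
    · exact h2 ⟨h3, (hAD ω h1).1 h3⟩
    · exact h2 ⟨(hAD ω h1).2 h3, h3⟩

theorem exists_proportional (h : IsDiscoFunctional μ J) {D D' : Set Ω} (hD : IsProper μ D)
    (hD' : IsProper μ D') :
    ∃ c : ℝ, 0 < c ∧ ∀ A, MeasurableSet A → (∀ ω ∈ A, ω ∈ D ↔ ω ∈ D') →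
      linPiece J D' (ind A) = c * linPiece J D (ind A) := by
  have mW : MeasurableSet (D ∩ D') := hD.meas.inter hD'.meas
  have mU : MeasurableSet (D ∪ D')ᶜ := (hD.meas.union hD'.meas).compl
  have sub : ∀ A, (∀ ω ∈ A, ω ∈ D ↔ ω ∈ D') → A \ (D ∩ D') ⊆ (D ∪ D')ᶜ := by
    rintro A hAD ω ⟨h1, h2⟩ h3
    rcases h3 with h3 | h3
    · exact h2 ⟨h3, (hAD ω h1).1 h3⟩
    · exact h2 ⟨(hAD ω h1).2 h3, h3⟩
  by_cases hW : μ (D ∩ D') = 0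
  · by_cases hU : μ (D ∪ D')ᶜ = 0
    · refine ⟨1, one_pos, fun A hA hAD => ?_⟩
      have hz : μ A = 0 := by
        refine measure_mono_null (t := (D ∩ D') ∪ (D ∪ D')ᶜ) ?_ (measure_union_null hW hU)
        intro ω hω
        by_cases h1 : ω ∈ D ∩ D'
        · exact Or.inl h1
        · exact Or.inr (sub A hAD ⟨hω, h1⟩)
      rw [h.linPiece_ind_null hD hA hz, h.linPiece_ind_null hD' hA hz, mul_zero]
    · have hU' := pos_iff_ne_zero.2 hU
      have hP : IsProper μ (D ∪ D') := ⟨hD.meas.union hD'.meas,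
        hD.pos.trans_le (measure_mono Set.subset_union_left), hU'⟩
      obtain ⟨c, hc, h1⟩ := h.exists_proportional_of_pos hD hP
        (by rw [Set.inter_eq_left.2 Set.subset_union_left]; exact hD.pos)
        (by rw [Set.union_eq_right.2 Set.subset_union_left]; exact hU')
      obtain ⟨c', hc', h2⟩ := h.exists_proportional_of_pos hD' hP
        (by rw [Set.inter_eq_left.2 Set.subset_union_right]; exact hD'.pos)
        (by rw [Set.union_eq_right.2 Set.subset_union_right]; exact hU')
      refine ⟨c / c', by positivity, fun A hA hAD => ?_⟩
      have hz : μ (A ∩ (D ∩ D')) = 0 := measure_mono_null Set.inter_subset_right hW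
      have hout := sub A hAD
      have e1 := h1 _ (hA.diff mW) (fun ω hω =>
        ⟨fun hd => Or.inl hd, fun hd => absurd hd (hout hω)⟩)
      have e2 := h2 _ (hA.diff mW) (fun ω hω =>
        ⟨fun hd => Or.inr hd, fun hd => absurd hd (hout hω)⟩)
      rw [h.linPiece_ind_split hD hA mW, h.linPiece_ind_split hD' hA mW,
        h.linPiece_ind_null hD (hA.inter mW) hz, h.linPiece_ind_null hD' (hA.inter mW) hz]
      rw [e1] at e2
      field_simp; linarith
  · have hW' := pos_iff_ne_zero.2 hW
    by_cases hU : μ (D ∪ D')ᶜ = 0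
    · have hP : IsProper μ (D ∩ D') := ⟨mW, hW', hD.compl_pos.trans_le
        (measure_mono (Set.compl_subset_compl.2 Set.inter_subset_left))⟩
      obtain ⟨c, hc, h1⟩ := h.exists_proportional_of_pos hD hP
        (by rw [Set.inter_eq_right.2 Set.inter_subset_left]; exact hW')
        (by rw [Set.union_eq_left.2 Set.inter_subset_left]; exact hD.compl_pos)
      obtain ⟨c', hc', h2⟩ := h.exists_proportional_of_pos hD' hP
        (by rw [Set.inter_eq_right.2 Set.inter_subset_right]; exact hW')
        (by rw [Set.union_eq_left.2 Set.inter_subset_right]; exact hD'.compl_pos)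
      refine ⟨c / c', by positivity, fun A hA hAD => ?_⟩
      have hz : μ (A \ (D ∩ D')) = 0 := measure_mono_null (sub A hAD) hU
      have e1 := h1 _ (hA.inter mW) (fun ω hω => ⟨fun _ => hω.2, fun hd => hd.1⟩)
      have e2 := h2 _ (hA.inter mW) (fun ω hω => ⟨fun _ => hω.2, fun hd => hd.2⟩)
      rw [h.linPiece_ind_split hD hA mW, h.linPiece_ind_split hD' hA mW,
        h.linPiece_ind_null hD (hA.diff mW) hz, h.linPiece_ind_null hD' (hA.diff mW) hz]
      rw [e1] at e2
      field_simp; linarith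
    · exact h.exists_proportional_of_pos hD hD' hW' (pos_iff_ne_zero.2 hU)

end IsDiscoFunctional

end LinearPieces

/-! ### Splitting events -/

section Splitting

variable {Ω : Type*} [MeasurableSpace Ω] {μ : Measure Ω}

/-- A standard space has no atoms: some cell `{i / n ≤ V < (i + 1) / n}` meets `E` in a non-null
event. -/
theorem exists_small_subset (hμ : IsStandardSpace μ) {E : Set Ω} (hE : MeasurableSet E)
    (hpos : 0 < μ E) {e : ENNReal} (he : 0 < e) :
    ∃ F ⊆ E, MeasurableSet F ∧ 0 < μ F ∧ μ F ≤ e := by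
  obtain ⟨V, -, hV, hmap, -⟩ := hμ
  obtain ⟨n, hn⟩ := ENNReal.exists_inv_nat_lt he.ne'
  have hn0 : 0 < n := by
    rcases Nat.eq_zero_or_pos n with rfl | h
    · simp at hn
    · exact h
  have hnR : (0 : ℝ) < n := by exact_mod_cast hn0
  set cell : ℤ → Set Ω := fun i => V ⁻¹' Set.Ico ((i : ℝ) / n) ((i + 1 : ℝ) / n) with hcell
  have hm : ∀ i, MeasurableSet (cell i) := fun i => hV measurableSet_Ico
  have hle : ∀ i, μ (cell i) ≤ e := by
    intro i
    rw [hcell, ← Measure.map_apply hV measurableSet_Ico, hmap]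
    refine (Measure.restrict_apply_le _ _).trans ?_
    rw [Real.volume_Ico, show ((i + 1 : ℝ) / n - (i : ℝ) / n) = (n : ℝ)⁻¹ by field_simp; ring,
      ENNReal.ofReal_inv_of_pos hnR, ENNReal.ofReal_natCast]
    exact hn.le
  by_contra hcon
  push Not at hcon
  have hz : ∀ i, μ (E ∩ cell i) = 0 := by
    intro i
    by_contra h0
    exact absurd ((measure_mono Set.inter_subset_right).trans (hle i))
      (not_le.2 (hcon _ Set.inter_subset_left (hE.inter (hm i)) (pos_iff_ne_zero.2 h0)))
  refine hpos.ne' (measure_mono_null ?_ (measure_iUnion_null hz))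
  intro ω hω
  refine Set.mem_iUnion.2 ⟨⌊V ω * n⌋, hω, ?_⟩
  constructor
  · rw [div_le_iff₀ hnR]; exact Int.floor_le _
  · rw [lt_div_iff₀ hnR]; exact Int.lt_floor_add_one _

/-- Finitely many non-null events can be split simultaneously: take the union of small parts. -/
theorem exists_split [IsProbabilityMeasure μ] (hμ : IsStandardSpace μ) {ι : Type*} [Fintype ι]
    [Nonempty ι] {E : ι → Set Ω} (hE : ∀ i, MeasurableSet (E i)) (hpos : ∀ i, 0 < μ (E i)) :
    ∃ T, MeasurableSet T ∧ ∀ i, 0 < μ (E i ∩ T) ∧ 0 < μ (E i \ T) := by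
  set δ := Finset.univ.inf fun i => μ (E i) with hδ
  have hδle : ∀ i, δ ≤ μ (E i) := fun i => Finset.inf_le (Finset.mem_univ i)
  have hδ0 : 0 < δ := by
    rw [hδ, Finset.lt_inf_iff (by simp)]
    exact fun i _ => hpos i
  have hδt : δ ≠ ⊤ := by
    obtain ⟨i⟩ := ‹Nonempty ι›
    exact ((hδle i).trans_lt (measure_lt_top μ _)).ne
  set e := δ / (Fintype.card ι + 1 : ENNReal) with he
  have he0 : 0 < e := ENNReal.div_pos hδ0.ne' (by simp)
  have het : e ≠ ⊤ := ENNReal.div_ne_top hδt (by simp)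
  have hlt : Fintype.card ι * e < δ := by
    have : (Fintype.card ι + 1 : ENNReal) * e = δ := ENNReal.mul_div_cancel (by simp) (by simp)
    rw [← this, add_mul, one_mul]
    exact ENNReal.lt_add_right (ENNReal.mul_ne_top (by simp) het) he0.ne'
  choose F hFE hF hF0 hFe using fun i => exists_small_subset hμ (hE i) (hpos i) he0
  refine ⟨⋃ i, F i, MeasurableSet.iUnion hF, fun i => ⟨?_, ?_⟩⟩
  · exact (hF0 i).trans_le (measure_mono fun ω hω => ⟨hFE i hω, Set.mem_iUnion.2 ⟨i, hω⟩⟩)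
  · rw [pos_iff_ne_zero]
    intro hz
    have hT : μ (⋃ i, F i) ≤ Fintype.card ι * e := by
      refine (measure_iUnion_fintype_le μ F).trans ((Finset.sum_le_sum fun i _ => hFe i).trans ?_)
      simp
    have : μ (E i) ≤ μ (E i \ ⋃ i, F i) + μ (⋃ i, F i) := by
      refine (measure_mono fun ω hω => ?_).trans (measure_union_le _ _)
      by_cases h : ω ∈ ⋃ i, F i
      · exact Or.inr h
      · exact Or.inl ⟨hω, h⟩
    rw [hz, zero_add] at this
    exact absurd ((hδle i).trans (this.trans hT)) (not_le.2 hlt)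

/-- An event `T` that agrees with each `D i` on a non-null part of `E i`. -/
theorem exists_generic [IsProbabilityMeasure μ] (hμ : IsStandardSpace μ) {ι : Type*} [Fintype ι]
    [Nonempty ι] {D E : ι → Set Ω} (hD : ∀ i, MeasurableSet (D i)) (hE : ∀ i, MeasurableSet (E i))
    (hpos : ∀ i, 0 < μ (E i)) :
    ∃ T, IsProper μ T ∧ ∀ i, ∃ G ⊆ E i, MeasurableSet G ∧ 0 < μ G ∧ ∀ ω ∈ G, ω ∈ T ↔ ω ∈ D i := by
  have part : ∀ i, ∃ F ⊆ E i, MeasurableSet F ∧ 0 < μ F ∧ (F ⊆ D i ∨ F ⊆ (D i)ᶜ) := by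
    intro i
    by_cases h : 0 < μ (E i ∩ D i)
    · exact ⟨_, Set.inter_subset_left, (hE i).inter (hD i), h, Or.inl Set.inter_subset_right⟩
    · refine ⟨E i \ D i, Set.sdiff_subset, (hE i).diff (hD i), ?_, Or.inr fun ω hω => hω.2⟩
      rw [pos_iff_ne_zero]
      intro hz
      refine (hpos i).ne' (measure_mono_null ?_
        (measure_union_null (not_not.1 (mt pos_iff_ne_zero.2 h)) hz))
      rw [Set.inter_union_sdiff]
  choose F hFE hF hF0 hFD using part
  obtain ⟨T, hT, hsplit⟩ := exists_split hμ hF hF0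
  obtain ⟨i0⟩ := ‹Nonempty ι›
  refine ⟨T, ⟨hT, (hsplit i0).1.trans_le (measure_mono Set.inter_subset_right),
    (hsplit i0).2.trans_le (measure_mono fun ω hω => hω.2)⟩, fun i => ?_⟩
  rcases hFD i with h | h
  · exact ⟨F i ∩ T, Set.inter_subset_left.trans (hFE i), (hF i).inter hT, (hsplit i).1,
      fun ω hω => ⟨fun _ => h hω.1, fun _ => hω.2⟩⟩
  · exact ⟨F i \ T, Set.sdiff_subset.trans (hFE i), (hF i).diff hT, (hsplit i).2,
      fun ω hω => ⟨fun hc => absurd hc hω.2, fun hc => absurd hc (h hω.1)⟩⟩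

end Splitting

/-! ### Gluing the linear pieces -/

section Gluing

variable {Ω : Type*} [MeasurableSpace Ω] {μ : Measure Ω} {J : SimpleFunc Ω ℝ → ℝ}

/-- The event on which `D` and `S` agree. -/
def agreement (D S : Set Ω) : Set Ω := {ω | ω ∈ D ↔ ω ∈ S}

theorem measurableSet_agreement {D S : Set Ω} (hD : MeasurableSet D) (hS : MeasurableSet S) :
    MeasurableSet (agreement D S) := by
  have : agreement D S = (D ∩ S) ∪ (Dᶜ ∩ Sᶜ) := by
    ext ω
    simp only [agreement, Set.mem_ofPred_eq, Set.mem_union, Set.mem_inter_iff, Set.mem_compl_iff]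
    tauto
  rw [this]
  exact (hD.inter hS).union (hD.compl.inter hS.compl)

theorem agreement_compl {Ω : Type*} (D S : Set Ω) : agreement D Sᶜ = (agreement D S)ᶜ := by
  ext ω
  simp only [agreement, Set.mem_ofPred_eq, Set.mem_compl_iff]
  tauto

namespace IsDiscoFunctional

/-- The weights for any event `D` are proportional to those for `S` where `D` and `S` agree, and to
those for `Sᶜ` elsewhere. The ratio of the two factors is the same for all `D`: two events `D` and
`D'` are linked by an event that agrees with each of them on non-null parts of all the pieces. -/
theorem ratio_eq [IsProbabilityMeasure μ] (hμ : IsStandardSpace μ) (h : IsDiscoFunctional μ J)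
    {S D D' : Set Ω} (hS : IsProper μ S) (hD : IsProper μ D) (hD' : IsProper μ D')
    {c₁ c₂ d₁ d₂ : ℝ}
    (hc₁ : ∀ A, MeasurableSet A → A ⊆ agreement D S →
      linPiece J D (ind A) = c₁ * linPiece J S (ind A))
    (hc₂ : ∀ A, MeasurableSet A → A ⊆ agreement D Sᶜ →
      linPiece J D (ind A) = c₂ * linPiece J Sᶜ (ind A))
    (hd₁ : ∀ A, MeasurableSet A → A ⊆ agreement D' S →
      linPiece J D' (ind A) = d₁ * linPiece J S (ind A))
    (hd₂ : ∀ A, MeasurableSet A → A ⊆ agreement D' Sᶜ →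
      linPiece J D' (ind A) = d₂ * linPiece J Sᶜ (ind A))
    (p₁ : 0 < μ (agreement D S)) (p₂ : 0 < μ (agreement D Sᶜ))
    (q₁ : 0 < μ (agreement D' S)) (q₂ : 0 < μ (agreement D' Sᶜ)) : c₂ * d₁ = d₂ * c₁ := by
  have m := fun {D S : Set Ω} => measurableSet_agreement (D := D) (S := S)
  obtain ⟨T, hT, hG⟩ := exists_generic hμ (D := ![D, D, D', D'])
    (E := ![agreement D S, agreement D Sᶜ, agreement D' S, agreement D' Sᶜ])
    (by intro i; fin_cases i <;> simp [hD.meas, hD'.meas])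
    (by
      intro i
      fin_cases i
      exacts [m hD.meas hS.meas, m hD.meas hS.meas.compl, m hD'.meas hS.meas,
        m hD'.meas hS.meas.compl])
    (by intro i; fin_cases i <;> simpa)
  obtain ⟨t₁, ht₁, hT₁⟩ := h.exists_proportional hS hT
  obtain ⟨t₂, ht₂, hT₂⟩ := h.exists_proportional hS.compl hT
  obtain ⟨e, he, hTD⟩ := h.exists_proportional hD hT
  obtain ⟨e', he', hTD'⟩ := h.exists_proportional hD' hT
  have step : ∀ {X Y : Set Ω} {c t e : ℝ} {G : Set Ω}, IsProper μ X →
      (∀ A, MeasurableSet A → A ⊆ agreement Y X →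
        linPiece J Y (ind A) = c * linPiece J X (ind A)) →
      (∀ A, MeasurableSet A → (∀ ω ∈ A, ω ∈ X ↔ ω ∈ T) →
        linPiece J T (ind A) = t * linPiece J X (ind A)) →
      (∀ A, MeasurableSet A → (∀ ω ∈ A, ω ∈ Y ↔ ω ∈ T) →
        linPiece J T (ind A) = e * linPiece J Y (ind A)) →
      G ⊆ agreement Y X → MeasurableSet G → 0 < μ G → (∀ ω ∈ G, ω ∈ T ↔ ω ∈ Y) → t = e * c := by
    intro X Y c t e G hX hc ht he hGs hGm hG0 hGT
    have e1 := hc G hGm hGs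
    have e2 := ht G hGm fun ω hω => (hGs hω).symm.trans (hGT ω hω).symm
    have e3 := he G hGm fun ω hω => (hGT ω hω).symm
    have hp := h.linPiece_ind_pos hX hGm hG0
    refine mul_right_cancel₀ hp.ne' ?_
    rw [← e2, e3, e1]; ring
  obtain ⟨G₀, s₀, m₀, n₀, a₀⟩ := hG 0
  obtain ⟨G₁, s₁, m₁, n₁, a₁⟩ := hG 1
  obtain ⟨G₂, s₂, m₂, n₂, a₂⟩ := hG 2
  obtain ⟨G₃, s₃, m₃, n₃, a₃⟩ := hG 3
  have r₀ := step hS hc₁ hT₁ hTD s₀ m₀ n₀ a₀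
  have r₁ := step hS.compl hc₂ hT₂ hTD s₁ m₁ n₁ a₁
  have r₂ := step hS hd₁ hT₁ hTD' s₂ m₂ n₂ a₂
  have r₃ := step hS.compl hd₂ hT₂ hTD' s₃ m₃ n₃ a₃
  have : e * e' * (c₂ * d₁) = e * e' * (d₂ * c₁) := by
    calc e * e' * (c₂ * d₁) = (e * c₂) * (e' * d₁) := by ring
      _ = (e' * d₂) * (e * c₁) := by rw [← r₁, ← r₂, ← r₃, ← r₀]
      _ = _ := by ring
  exact mul_left_cancel₀ (by positivity) this

/-- All linear pieces arise, up to scale, from those of a fixed event `S` and of `Sᶜ`, with the same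
relative weight `γ`. -/
theorem exists_glue [IsProbabilityMeasure μ] (hμ : IsStandardSpace μ) (h : IsDiscoFunctional μ J) :
    ∃ S, IsProper μ S ∧ ∃ γ : ℝ, 0 < γ ∧ ∀ D, IsProper μ D → ∃ c : ℝ, 0 < c ∧
      ∀ A, MeasurableSet A → linPiece J D (ind A) =
        c * (linPiece J S (ind (A ∩ agreement D S)) +
          γ * linPiece J Sᶜ (ind (A \ agreement D S))) := by
  obtain ⟨S, hS, -⟩ := exists_generic hμ (ι := Unit) (D := fun _ => Set.univ)
    (E := fun _ => Set.univ) (fun _ => MeasurableSet.univ) (fun _ => MeasurableSet.univ)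
    (fun _ => by simp)
  have pair : ∀ D, IsProper μ D → ∃ c₁ c₂ : ℝ, 0 < c₁ ∧ 0 < c₂ ∧
      (∀ A, MeasurableSet A → A ⊆ agreement D S →
        linPiece J D (ind A) = c₁ * linPiece J S (ind A)) ∧
      (∀ A, MeasurableSet A → A ⊆ agreement D Sᶜ →
        linPiece J D (ind A) = c₂ * linPiece J Sᶜ (ind A)) := by
    intro D hD
    obtain ⟨c₁, h₁, e₁⟩ := h.exists_proportional hS hD
    obtain ⟨c₂, h₂, e₂⟩ := h.exists_proportional hS.compl hD
    exact ⟨c₁, c₂, h₁, h₂, fun A hA hs => e₁ A hA fun ω hω => (hs hω).symm,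
      fun A hA hs => e₂ A hA fun ω hω => (hs hω).symm⟩
  obtain ⟨T, hT, hG⟩ := exists_generic hμ (ι := Fin 2) (D := ![S, Sᶜ])
    (E := fun _ => Set.univ)
    (by intro i; fin_cases i; exacts [hS.meas, hS.meas.compl])
    (fun _ => MeasurableSet.univ) (fun _ => by simp)
  obtain ⟨G₀, -, -, n₀, a₀⟩ := hG 0
  obtain ⟨G₁, -, -, n₁, a₁⟩ := hG 1
  have q₁ : 0 < μ (agreement T S) := n₀.trans_le (measure_mono a₀)
  have q₂ : 0 < μ (agreement T Sᶜ) := n₁.trans_le (measure_mono a₁)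
  obtain ⟨t₁, t₂, ht₁, ht₂, hT₁, hT₂⟩ := pair T hT
  refine ⟨S, hS, t₂ / t₁, by positivity, fun D hD => ?_⟩
  obtain ⟨c₁, c₂, hc₁, hc₂, hD₁, hD₂⟩ := pair D hD
  have mag : MeasurableSet (agreement D S) := measurableSet_agreement hD.meas hS.meas
  have main : ∀ A, MeasurableSet A → linPiece J D (ind A) =
      c₁ * linPiece J S (ind (A ∩ agreement D S)) +
        c₂ * linPiece J Sᶜ (ind (A \ agreement D S)) := by
    intro A hA
    rw [h.linPiece_ind_split hD hA mag, hD₁ _ (hA.inter mag) Set.inter_subset_right,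
      hD₂ _ (hA.diff mag) (by rw [agreement_compl]; exact fun ω hω => hω.2)]
  rcases eq_or_ne (μ (agreement D S)) 0 with hz | hz
  · refine ⟨c₂ * t₁ / t₂, by positivity, fun A hA => ?_⟩
    have h0 : linPiece J S (ind (A ∩ agreement D S)) = 0 :=
      h.linPiece_ind_null hS (hA.inter mag) (measure_mono_null Set.inter_subset_right hz)
    rw [main A hA, h0]
    field_simp; ring
  rcases eq_or_ne (μ (agreement D Sᶜ)) 0 with hz' | hz'
  · refine ⟨c₁, hc₁, fun A hA => ?_⟩
    have h0 : linPiece J Sᶜ (ind (A \ agreement D S)) = 0 :=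
      h.linPiece_ind_null hS.compl (hA.diff mag) (measure_mono_null
        (by rw [agreement_compl]; exact fun ω hω => hω.2) hz')
    rw [main A hA, h0]
    ring
  refine ⟨c₁, hc₁, fun A hA => ?_⟩
  have := h.ratio_eq hμ hS hD hT hD₁ hD₂ hT₁ hT₂ (pos_iff_ne_zero.2 hz) (pos_iff_ne_zero.2 hz')
    q₁ q₂
  rw [main A hA, mul_add, ← mul_assoc c₁ (t₂ / t₁),
    show c₁ * (t₂ / t₁) = c₂ by field_simp; linarith]

/-! ### The two measures -/

/-- The weights of a linear piece as a measure, given that `J` is continuous from below along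
vanishing losses. -/
theorem exists_measure (h : IsDiscoFunctional μ J)
    (hcont : ∀ A : ℕ → Set Ω, (∀ n, MeasurableSet (A n)) → Antitone A → ⋂ n, A n = ∅ →
      ∀ e : ℝ, 0 < e → ∃ n, -e < J (-ind (A n))) {D : Set Ω} (hD : IsProper μ D) :
    ∃ M : Measure Ω, ∀ A, MeasurableSet A → M A = ENNReal.ofReal (linPiece J D (ind A)) := by
  have hempty : linPiece J D (ind ∅) = 0 :=
    h.linPiece_ind_null hD MeasurableSet.empty measure_empty
  refine ⟨Measure.ofMeasurable (fun A _ => ENNReal.ofReal (linPiece J D (ind A)))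
    (by rw [hempty, ENNReal.ofReal_zero]) ?_, fun A hA => Measure.ofMeasurable_apply A hA⟩
  intro f hf hdisj
  have hnn : ∀ i, 0 ≤ linPiece J D (ind (f i)) := fun i => h.linPiece_ind_nonneg hD (hf i)
  set U := ⋃ i, f i with hU
  have mU : MeasurableSet U := MeasurableSet.iUnion hf
  set B : ℕ → Set Ω := fun n => ⋃ i ∈ Finset.range n, f i with hB
  have mB : ∀ n, MeasurableSet (B n) := fun n => Finset.measurableSet_biUnion _ fun i _ => hf i
  have hsum : ∀ n, ∑ i ∈ Finset.range n, linPiece J D (ind (f i)) = linPiece J D (ind (B n)) := by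
    intro n
    induction n with
    | zero => simp [hB, hempty]
    | succ n ih =>
      rw [Finset.sum_range_succ, ih, ← h.linPiece_ind_union hD (mB n) (hf n)]
      · congr 2
        simp only [hB, Finset.range_add_one, Finset.set_biUnion_insert]
        exact Set.union_comm _ _
      · simp only [hB, Set.disjoint_iUnion_left]
        exact fun i hi => hdisj (Finset.mem_range.1 hi).ne
  have hBU : ∀ n, B n ⊆ U := fun n => Set.iUnion₂_subset fun i _ => Set.subset_iUnion f i
  have hBm : Monotone B := fun a b hab =>
    Set.biUnion_subset_biUnion_left fun i hi => Finset.range_mono hab hi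
  have hR : ∀ n, linPiece J D (ind U) = linPiece J D (ind (B n)) + linPiece J D (ind (U \ B n)) := by
    intro n
    rw [h.linPiece_ind_split hD mU (mB n), Set.inter_eq_right.2 (hBU n)]
  have hlim : HasSum (fun i => linPiece J D (ind (f i))) (linPiece J D (ind U)) := by
    rw [hasSum_iff_tendsto_nat_of_nonneg hnn, Metric.tendsto_atTop]
    intro e he
    obtain ⟨N, hN⟩ := hcont (fun n => U \ B n) (fun n => mU.diff (mB n))
      (fun a b hab => Set.sdiff_subset_sdiff_right (hBm hab)) (by
        rw [Set.eq_empty_iff_forall_notMem]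
        intro ω hω
        rw [Set.mem_iInter] at hω
        obtain ⟨i, hi⟩ := Set.mem_iUnion.1 (hω 0).1
        exact (hω (i + 1)).2 (Set.mem_biUnion (Finset.mem_coe.2 (Finset.self_mem_range_succ i)) hi))
      e he
    refine ⟨N, fun n hn => ?_⟩
    have e1 : linPiece J D (ind (U \ B n)) ≤ linPiece J D (ind (U \ B N)) := by
      rw [h.linPiece_ind_split hD (mU.diff (mB N)) (mU.diff (mB n)), Set.inter_eq_right.2
        (Set.sdiff_subset_sdiff_right (hBm hn))]
      linarith [h.linPiece_ind_nonneg hD ((mU.diff (mB N)).diff (mU.diff (mB n)))]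
    have e2 := h.le_linPiece hD (-ind (U \ B N))
    rw [← neg_one_smul ℝ, h.linPiece_smul hD, neg_one_smul] at e2
    rw [hsum, hR n, Real.dist_eq, abs_lt]
    have e3 := h.linPiece_ind_nonneg hD (mU.diff (mB n))
    constructor <;> linarith
  rw [← hlim.tsum_eq, ENNReal.ofReal_tsum_of_nonneg hnn hlim.summable]

/-- The structure of disco additive functionals: up to scale, the linear piece of `D` is given by
one measure `P` on the elating event `Dᶜ` and another measure `Q` on the disappointing event
`D`. -/
theorem exists_measures [IsProbabilityMeasure μ] (hμ : IsStandardSpace μ)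
    (h : IsDiscoFunctional μ J)
    (hcont : ∀ A : ℕ → Set Ω, (∀ n, MeasurableSet (A n)) → Antitone A → ⋂ n, A n = ∅ →
      ∀ e : ℝ, 0 < e → ∃ n, -e < J (-ind (A n))) :
    ∃ P Q : Measure Ω, IsFiniteMeasure P ∧ IsFiniteMeasure Q ∧
      (∀ A, MeasurableSet A → (P A = 0 ↔ μ A = 0)) ∧
      (∀ A, MeasurableSet A → (Q A = 0 ↔ μ A = 0)) ∧
      ∀ D, IsProper μ D → ∃ c : ℝ, 0 < c ∧ ∀ A, MeasurableSet A →
        linPiece J D (ind A) = c * (P.real (A \ D) + Q.real (A ∩ D)) := by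
  obtain ⟨S, hS, γ, hγ, hglue⟩ := h.exists_glue hμ
  obtain ⟨M, hM⟩ := h.exists_measure hcont hS
  obtain ⟨M', hM'⟩ := h.exists_measure hcont hS.compl
  have fM : IsFiniteMeasure M := ⟨by rw [hM _ MeasurableSet.univ]; exact ENNReal.ofReal_lt_top⟩
  have fM' : IsFiniteMeasure M' := ⟨by rw [hM' _ MeasurableSet.univ]; exact ENNReal.ofReal_lt_top⟩
  have rM : ∀ A, MeasurableSet A → M.real A = linPiece J S (ind A) := fun A hA => by
    rw [measureReal_def, hM A hA, ENNReal.toReal_ofReal (h.linPiece_ind_nonneg hS hA)]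
  have rM' : ∀ A, MeasurableSet A → M'.real A = linPiece J Sᶜ (ind A) := fun A hA => by
    rw [measureReal_def, hM' A hA, ENNReal.toReal_ofReal (h.linPiece_ind_nonneg hS.compl hA)]
  have zM : ∀ A, MeasurableSet A → (M A = 0 ↔ μ A = 0) := fun A hA => by
    rw [hM A hA, ENNReal.ofReal_eq_zero]
    refine ⟨fun hle => ?_, fun hz => (h.linPiece_ind_null hS hA hz).le⟩
    by_contra hne
    exact absurd (h.linPiece_ind_pos hS hA (pos_iff_ne_zero.2 hne)) (not_lt.2 hle)
  have zM' : ∀ A, MeasurableSet A → (M' A = 0 ↔ μ A = 0) := fun A hA => by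
    rw [hM' A hA, ENNReal.ofReal_eq_zero]
    refine ⟨fun hle => ?_, fun hz => (h.linPiece_ind_null hS.compl hA hz).le⟩
    by_contra hne
    exact absurd (h.linPiece_ind_pos hS.compl hA (pos_iff_ne_zero.2 hne)) (not_lt.2 hle)
  have comb : ∀ {S : Set Ω}, MeasurableSet S → ∀ A, MeasurableSet A →
      (M.restrict S + ENNReal.ofReal γ • M'.restrict Sᶜ) A =
        M (A ∩ S) + ENNReal.ofReal γ * M' (A \ S) := by
    intro S hS A hA
    rw [Measure.add_apply, Measure.smul_apply, Measure.restrict_apply hA, Measure.restrict_apply hA,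
      smul_eq_mul, Set.sdiff_eq]
  have combz : ∀ {S : Set Ω}, MeasurableSet S → ∀ A, MeasurableSet A →
      ((M.restrict S + ENNReal.ofReal γ • M'.restrict Sᶜ) A = 0 ↔ μ A = 0) := by
    intro S hS A hA
    rw [comb hS A hA, add_eq_zero, mul_eq_zero, zM _ (hA.inter hS), zM' _ (hA.diff hS)]
    have : ENNReal.ofReal γ ≠ 0 := by simpa using hγ
    simp only [this, false_or]
    refine ⟨fun hz => ?_, fun hz => ⟨measure_mono_null Set.inter_subset_left hz,
      measure_mono_null Set.sdiff_subset hz⟩⟩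
    have := measure_union_null hz.1 hz.2
    rwa [Set.inter_union_sdiff] at this
  have combr : ∀ {S : Set Ω}, MeasurableSet S → ∀ A, MeasurableSet A →
      (M.restrict S + ENNReal.ofReal γ • M'.restrict Sᶜ).real A =
        M.real (A ∩ S) + γ * M'.real (A \ S) := by
    intro S hS A hA
    rw [measureReal_def, comb hS A hA, ENNReal.toReal_add (measure_ne_top _ _)
      (ENNReal.mul_ne_top ENNReal.ofReal_ne_top (measure_ne_top _ _)), ENNReal.toReal_mul,
      ENNReal.toReal_ofReal hγ.le]
    rfl
  have fin : ∀ S : Set Ω, MeasurableSet S →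
      IsFiniteMeasure (M.restrict S + ENNReal.ofReal γ • M'.restrict Sᶜ) := fun S hS =>
    ⟨by
      rw [comb hS _ MeasurableSet.univ]
      exact ENNReal.add_lt_top.2 ⟨measure_lt_top _ _,
        ENNReal.mul_lt_top ENNReal.ofReal_lt_top (measure_lt_top _ _)⟩⟩
  refine ⟨M.restrict Sᶜ + ENNReal.ofReal γ • M'.restrict Sᶜᶜ,
    M.restrict S + ENNReal.ofReal γ • M'.restrict Sᶜ, fin _ hS.meas.compl, fin _ hS.meas,
    combz hS.meas.compl, combz hS.meas, fun D hD => ?_⟩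
  obtain ⟨c, hc, hcA⟩ := hglue D hD
  refine ⟨c, hc, fun A hA => ?_⟩
  have mag : MeasurableSet (agreement D S) := measurableSet_agreement hD.meas hS.meas
  rw [hcA A hA, combr hS.meas.compl _ (hA.diff hD.meas), combr hS.meas _ (hA.inter hD.meas),
    ← rM _ (hA.inter mag), ← rM' _ (hA.diff mag)]
  have s1 : M.real (A ∩ agreement D S) = M.real ((A \ D) ∩ Sᶜ) + M.real (A ∩ D ∩ S) := by
    rw [← measureReal_union _ ((hA.inter hD.meas).inter hS.meas)]
    · congr 1
      ext ω
      simp only [agreement, Set.mem_inter_iff, Set.mem_ofPred_eq, Set.mem_union, Set.mem_sdiff,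
        Set.mem_compl_iff]
      tauto
    · exact Set.disjoint_left.2 fun ω h1 h2 => h1.1.2 h2.1.2
  have s2 : M'.real (A \ agreement D S) = M'.real ((A \ D) \ Sᶜ) + M'.real ((A ∩ D) \ S) := by
    rw [← measureReal_union _ ((hA.inter hD.meas).diff hS.meas)]
    · congr 1
      ext ω
      simp only [agreement, Set.mem_inter_iff, Set.mem_ofPred_eq, Set.mem_union, Set.mem_sdiff,
        Set.mem_compl_iff]
      tauto
    · exact Set.disjoint_left.2 fun ω h1 h2 => h1.1.2 h2.1.2
  rw [s1, s2]
  ring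

end IsDiscoFunctional

end Gluing

/-! ### Integral representation of disco additive functionals -/

section Representation

variable {Ω : Type*} [MeasurableSpace Ω] {μ : Measure Ω} {J : SimpleFunc Ω ℝ → ℝ}

namespace IsDiscoFunctional

theorem linPiece_eq_integral (h : IsDiscoFunctional μ J) {P Q : Measure Ω} [IsFiniteMeasure P]
    [IsFiniteMeasure Q] {D : Set Ω} (hD : IsProper μ D) {c : ℝ}
    (hc : ∀ A, MeasurableSet A → linPiece J D (ind A) = c * (P.real (A \ D) + Q.real (A ∩ D)))
    (X : SimpleFunc Ω ℝ) :
    linPiece J D X = c * ((∫ ω in Dᶜ, X ω ∂P) + ∫ ω in D, X ω ∂Q) := by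
  induction X using SimpleFunc.induction with
  | const t hs =>
    rename_i s
    have e : SimpleFunc.piecewise s hs (SimpleFunc.const Ω t) (SimpleFunc.const Ω 0) = t • ind s := by
      ext ω
      by_cases hω : ω ∈ s
      · simp [SimpleFunc.piecewise_apply, ind_of_mem hs hω, hω]
      · simp [SimpleFunc.piecewise_apply, ind_of_notMem hs hω, hω]
    have e2 : ∀ ω, (t • ind s) ω = s.indicator (fun _ => t) ω := by
      intro ω
      by_cases hω : ω ∈ s
      · simp [ind_of_mem hs hω, hω]
      · simp [ind_of_notMem hs hω, hω]
    rw [e, h.linPiece_smul hD, hc s hs]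
    simp only [e2, integral_indicator_const _ hs, measureReal_restrict_apply hs, smul_eq_mul,
      ← Set.sdiff_eq]
    ring
  | @add f g hfg hf hg =>
    rw [h.linPiece_add hD, hf, hg]
    simp only [SimpleFunc.coe_add, Pi.add_apply]
    rw [integral_add f.integrable_of_isFiniteMeasure g.integrable_of_isFiniteMeasure,
      integral_add f.integrable_of_isFiniteMeasure g.integrable_of_isFiniteMeasure]
    ring

/-- Disappointment is weighted at least as much as elation: moving an event `A` from the elating
to the disappointing side of a balanced bet cannot lower its value, since the linear pieces lie
above `J`. -/
theorem measure_le_measure [IsProbabilityMeasure μ] (hμ : IsStandardSpace μ)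
    (h : IsDiscoFunctional μ J) {P Q : Measure Ω} [IsFiniteMeasure P] [IsFiniteMeasure Q]
    (hP : ∀ A, MeasurableSet A → (P A = 0 ↔ μ A = 0))
    (hc : ∀ D, IsProper μ D → ∃ c : ℝ, 0 < c ∧ ∀ A, MeasurableSet A →
        linPiece J D (ind A) = c * (P.real (A \ D) + Q.real (A ∩ D))) : P ≤ Q := by
  have key : ∀ A, MeasurableSet A → 0 < μ Aᶜ → P.real A ≤ Q.real A := by
    intro A hA hAc
    rcases eq_or_ne (μ A) 0 with hz | hz
    · rw [measureReal_def, (hP A hA).2 hz]; simp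
    obtain ⟨T, hT, hsplit⟩ := exists_split hμ (ι := Unit) (E := fun _ => Aᶜ)
      (fun _ => hA.compl) (fun _ => hAc)
    obtain ⟨hB0, hB1⟩ := hsplit ()
    set B := Aᶜ ∩ T with hB
    have mB : MeasurableSet B := hA.compl.inter hT
    have hBc : 0 < μ Bᶜ := hB1.trans_le (measure_mono fun ω hω hc => hω.2 hc.2)
    have pB : IsProper μ B := ⟨mB, hB0, hBc⟩
    have pAB : IsProper μ (A ∪ B) := ⟨hA.union mB, hB0.trans_le (measure_mono
      Set.subset_union_right), hB1.trans_le (measure_mono fun ω hω hc =>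
        hc.elim hω.1 fun hc => hω.2 hc.2)⟩
    obtain ⟨s, t, hs, ht, hJ⟩ := h.exists_balance mB.compl mB hBc hB0
    have e1 := h.linPiece_balance pB mB.compl mB (fun ω hω => hω) subset_rfl hs ht hJ
    have e2 := h.le_linPiece pAB (s • ind Bᶜ - t • ind B)
    obtain ⟨c, hc0, hc1⟩ := hc B pB
    obtain ⟨d, hd0, hd1⟩ := hc _ pAB
    rw [hJ, sub_eq_add_neg, ← neg_smul, h.linPiece_add pAB, h.linPiece_smul pAB,
      h.linPiece_smul pAB, hd1 _ mB.compl, hd1 _ mB] at e2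
    rw [hc1 _ mB.compl, hc1 _ mB] at e1
    have hAB : A ⊆ Bᶜ := fun ω hω hc => hc.1 hω
    have s1 : Bᶜ ∩ (A ∪ B) = A := by
      rw [Set.inter_union_distrib_left, Set.compl_inter_self, Set.union_empty,
        Set.inter_eq_right.2 hAB]
    have s2 : Bᶜ \ (A ∪ B) = Bᶜ \ A := by
      ext ω; simp only [Set.mem_sdiff, Set.mem_union, Set.mem_compl_iff]; tauto
    have s3 : B ∩ (A ∪ B) = B := Set.inter_eq_left.2 Set.subset_union_right
    have s4 : B \ (A ∪ B) = ∅ := Set.sdiff_eq_empty.2 Set.subset_union_right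
    have s5 : Bᶜ \ B = Bᶜ := by
      ext ω; simp
    have s6 : P.real Bᶜ = P.real (Bᶜ ∩ A) + P.real (Bᶜ \ A) :=
      (measureReal_inter_add_sdiff hA).symm
    rw [Set.inter_eq_right.2 hAB] at s6
    rw [s1, s2, s3, s4, measureReal_empty] at e2
    rw [s5, Set.compl_inter_self, Set.sdiff_self, Set.inter_self, measureReal_empty,
      measureReal_empty, s6] at e1
    have e1' : s * (P.real A + P.real (Bᶜ \ A)) = t * Q.real B := by
      refine mul_left_cancel₀ hc0.ne' ?_
      linear_combination e1
    have e2' : 0 ≤ d * (s * (P.real (Bᶜ \ A) + Q.real A) - t * Q.real B) := by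
      refine e2.trans_eq ?_
      ring
    have e3 := nonneg_of_mul_nonneg_right e2' hd0
    rw [← e1'] at e3
    have e4 : 0 ≤ s * (Q.real A - P.real A) := by linarith
    linarith [nonneg_of_mul_nonneg_right e4 hs]
  have key' : ∀ A, MeasurableSet A → 0 < μ Aᶜ → P A ≤ Q A := fun A hA h0 =>
    (ENNReal.toReal_le_toReal (measure_ne_top _ _) (measure_ne_top _ _)).1 (key A hA h0)
  obtain ⟨S, hS, -⟩ := exists_generic hμ (ι := Unit) (D := fun _ => Set.univ)
    (E := fun _ => Set.univ) (fun _ => MeasurableSet.univ) (fun _ => MeasurableSet.univ)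
    (fun _ => by simp)
  refine Measure.le_iff.2 fun A hA => ?_
  rw [← measure_inter_add_sdiff A hS.meas, ← measure_inter_add_sdiff (μ := Q) A hS.meas]
  refine add_le_add (key' _ (hA.inter hS.meas) ?_) (key' _ (hA.diff hS.meas) ?_)
  · exact hS.compl_pos.trans_le (measure_mono fun ω hω hc => hω hc.2)
  · exact hS.pos.trans_le (measure_mono fun ω hω hc => hc.2 hω)

theorem isProper_of_not_ae (h : IsDiscoFunctional μ J) {X : SimpleFunc Ω ℝ}
    (hne : ¬ ∀ᵐ ω ∂μ, X ω = J X) : IsProper μ {ω | X ω < J X} := by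
  refine ⟨measurableSet_lt X.measurable measurable_const, ?_, ?_⟩
  · rw [pos_iff_ne_zero]
    intro h0
    have hae : ∀ᵐ ω ∂μ, J X ≤ X ω := by rw [ae_iff]; simpa using h0
    have e1 : J (X ⊔ SimpleFunc.const Ω (J X)) = J X := h.congr _ _ (by
      filter_upwards [hae] with ω hω; exact max_eq_left hω)
    have := h.strict (SimpleFunc.const Ω (J X)) (X ⊔ SimpleFunc.const Ω (J X))
      (fun ω => le_max_right (X ω) (J X)) (by
        rw [pos_iff_ne_zero]
        intro hz
        apply hne
        have hz' : ∀ᵐ ω ∂μ, ¬ (J X < max (X ω) (J X)) := by rw [ae_iff]; simpa using hz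
        filter_upwards [hae, hz'] with ω h1 h2
        rw [max_eq_left h1] at h2
        exact le_antisymm (not_lt.1 h2) h1)
    rw [h.const, e1] at this
    exact lt_irrefl _ this
  · rw [pos_iff_ne_zero]
    intro h0
    have hlt : ∀ᵐ ω ∂μ, X ω < J X := by rw [ae_iff]; exact h0
    have e1 : J (X ⊓ SimpleFunc.const Ω (J X)) = J X := h.congr _ _ (by
      filter_upwards [hlt] with ω hω; exact min_eq_left hω.le)
    have := h.strict (X ⊓ SimpleFunc.const Ω (J X)) (SimpleFunc.const Ω (J X))
      (fun ω => min_le_right (X ω) (J X)) (by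
        rw [pos_iff_ne_zero]
        intro hz
        apply hne
        have hz' : ∀ᵐ ω ∂μ, ¬ (min (X ω) (J X) < J X) := by rw [ae_iff]; simpa using hz
        filter_upwards [hlt, hz'] with ω h1 h2
        rw [min_eq_left h1.le] at h2
        exact absurd h1 h2)
    rw [h.const, e1] at this
    exact lt_irrefl _ this

theorem integral_balance (h : IsDiscoFunctional μ J) {P Q : Measure Ω} [IsFiniteMeasure P]
    [IsFiniteMeasure Q] (hP : P ≪ μ) (hQ : Q ≪ μ)
    (hc : ∀ D, IsProper μ D → ∃ c : ℝ, 0 < c ∧ ∀ A, MeasurableSet A →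
        linPiece J D (ind A) = c * (P.real (A \ D) + Q.real (A ∩ D))) (X : SimpleFunc Ω ℝ) :
    ∫ ω, max (X ω - J X) 0 ∂P = ∫ ω, max (J X - X ω) 0 ∂Q := by
  by_cases hae : ∀ᵐ ω ∂μ, X ω = J X
  · rw [integral_eq_zero_of_ae, integral_eq_zero_of_ae]
    · filter_upwards [hQ.ae_le hae] with ω hω
      simp [hω]
    · filter_upwards [hP.ae_le hae] with ω hω
      simp [hω]
  have hD := h.isProper_of_not_ae hae
  obtain ⟨c, hc0, hc1⟩ := hc _ hD
  have e1 := h.linPiece_of_aligned hD rfl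
  have e2 := h.linPiece_add hD X (SimpleFunc.const Ω (-J X))
  rw [h.linPiece_const hD, e1, add_neg_cancel, h.linPiece_eq_integral hD hc1] at e2
  have e3 := (mul_eq_zero.1 e2).resolve_left hc0.ne'
  set D := {ω | X ω < J X} with hDdef
  rw [← integral_indicator hD.meas.compl, ← integral_indicator hD.meas] at e3
  have f1 : (fun ω => max (X ω - J X) 0) =
      Dᶜ.indicator fun ω => (X + SimpleFunc.const Ω (-J X)) ω := by
    ext ω
    by_cases hω : ω ∈ D
    · have : X ω < J X := hω
      rw [Set.indicator_of_notMem (show ω ∉ Dᶜ from fun hn => hn hω), max_eq_right (by linarith)]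
    · have : J X ≤ X ω := not_lt.1 hω
      rw [Set.indicator_of_mem (show ω ∈ Dᶜ from hω), max_eq_left (by linarith)]
      simp [sub_eq_add_neg]
  have f2 : (fun ω => max (J X - X ω) 0) =
      fun ω => -(D.indicator (fun ω => (X + SimpleFunc.const Ω (-J X)) ω) ω) := by
    ext ω
    by_cases hω : ω ∈ D
    · have : X ω < J X := hω
      rw [Set.indicator_of_mem hω, max_eq_left (by linarith)]
      simp [sub_eq_add_neg]
    · have : J X ≤ X ω := not_lt.1 hω
      rw [Set.indicator_of_notMem hω, max_eq_right (by linarith), neg_zero]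
  rw [f1, f2, integral_neg]
  linarith

theorem exists_duet [IsProbabilityMeasure μ] (hμ : IsStandardSpace μ)
    (h : IsDiscoFunctional μ J)
    (hcont : ∀ A : ℕ → Set Ω, (∀ n, MeasurableSet (A n)) → Antitone A → ⋂ n, A n = ∅ →
      ∀ e : ℝ, 0 < e → ∃ n, -e < J (-ind (A n))) :
    ∃ (P Q : Measure Ω) (α : ℝ), IsProbabilityMeasure P ∧ IsProbabilityMeasure Q ∧
      (P ≪ Q ∧ Q ≪ P) ∧ (Q ≪ μ ∧ μ ≪ Q) ∧ α ∈ Set.Ioc (0 : ℝ) (1 / 2) ∧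
      ENNReal.ofReal α • P ≤ ENNReal.ofReal (1 - α) • Q ∧
      ∀ X : SimpleFunc Ω ℝ, α * ∫ ω, max (X ω - J X) 0 ∂P =
        (1 - α) * ∫ ω, max (J X - X ω) 0 ∂Q := by
  obtain ⟨P, Q, fP, fQ, zP, zQ, hc⟩ := h.exists_measures hμ hcont
  have hPQ := h.measure_le_measure hμ zP hc
  have ac : ∀ {M N : Measure Ω}, (∀ A, MeasurableSet A → (N A = 0 → M A = 0)) → M ≪ N :=
    fun hz => Measure.AbsolutelyContinuous.mk hz
  have hPμ : P ≪ μ := ac fun A hA => (zP A hA).2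
  have hQμ : Q ≪ μ := ac fun A hA => (zQ A hA).2
  have p0 : 0 < P.real Set.univ := by
    rw [measureReal_def]
    refine ENNReal.toReal_pos (fun hz => ?_) (measure_ne_top _ _)
    have := (zP _ MeasurableSet.univ).1 hz
    simp at this
  have q0 : 0 < Q.real Set.univ := by
    rw [measureReal_def]
    refine ENNReal.toReal_pos (fun hz => ?_) (measure_ne_top _ _)
    have := (zQ _ MeasurableSet.univ).1 hz
    simp at this
  have hpq : P.real Set.univ ≤ Q.real Set.univ :=
    ENNReal.toReal_mono (measure_ne_top _ _) (hPQ _)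
  have hbal := h.integral_balance hPμ hQμ hc
  set p := P.real Set.univ with hp
  set q := Q.real Set.univ with hq
  have norm : ∀ (M : Measure Ω) [IsFiniteMeasure M], 0 < M.real Set.univ →
      IsProbabilityMeasure (ENNReal.ofReal (M.real Set.univ)⁻¹ • M) := fun M _ hM => ⟨by
    rw [Measure.smul_apply, smul_eq_mul, ENNReal.ofReal_inv_of_pos hM, measureReal_def,
      ENNReal.ofReal_toReal (measure_ne_top _ _)]
    refine ENNReal.inv_mul_cancel (fun hz => ?_) (measure_ne_top _ _)
    rw [measureReal_def, hz] at hM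
    simp at hM⟩
  have zsm : ∀ (M : Measure Ω) {k : ℝ}, 0 < k → ∀ A, (ENNReal.ofReal k • M) A = 0 ↔ M A = 0 := by
    intro M k hk A
    rw [Measure.smul_apply, smul_eq_mul, mul_eq_zero, ENNReal.ofReal_eq_zero]
    simp [hk]
  have hα : 1 - p / (p + q) = q / (p + q) := by field_simp; ring
  refine ⟨ENNReal.ofReal p⁻¹ • P, ENNReal.ofReal q⁻¹ • Q, p / (p + q), norm P p0, norm Q q0,
    ⟨ac fun A hA hz => ?_, ac fun A hA hz => ?_⟩, ⟨ac fun A hA hz => ?_, ac fun A hA hz => ?_⟩,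
    ⟨by positivity, ?_⟩, ?_, fun X => ?_⟩
  · rw [zsm P (inv_pos.2 p0), zP A hA, ← zQ A hA]; rwa [zsm Q (inv_pos.2 q0)] at hz
  · rw [zsm Q (inv_pos.2 q0), zQ A hA, ← zP A hA]; rwa [zsm P (inv_pos.2 p0)] at hz
  · rw [zsm Q (inv_pos.2 q0), zQ A hA]; exact hz
  · rw [zsm Q (inv_pos.2 q0), zQ A hA] at hz; exact hz
  · rw [div_le_div_iff₀ (by positivity) two_pos]; linarith
  · rw [hα, smul_smul, smul_smul, ← ENNReal.ofReal_mul (by positivity),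
      ← ENNReal.ofReal_mul (by positivity), show p / (p + q) * p⁻¹ = (p + q)⁻¹ by field_simp,
      show q / (p + q) * q⁻¹ = (p + q)⁻¹ by field_simp]
    refine Measure.le_iff.2 fun A hA => ?_
    rw [Measure.smul_apply, Measure.smul_apply]
    exact mul_le_mul_right (hPQ A) _
  · rw [hα, integral_smul_measure, integral_smul_measure, hbal X,
      ENNReal.toReal_ofReal (by positivity), ENNReal.toReal_ofReal (by positivity)]
    simp only [smul_eq_mul]
    field_simp

end IsDiscoFunctional

end Representation

/-! ### Duet expectiles of simple random variables -/

section Gain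

variable {Ω : Type*} [MeasurableSpace Ω] {P Q : Measure Ω} {α : ℝ}

/-- The weighted gains minus losses `α E^P[Z₊] - (1 - α) E^Q[Z₋]`; the duet expectile of `X` is the
`y` for which this vanishes at `X - y`. -/
noncomputable def duetGain (P Q : Measure Ω) (α : ℝ) (Z : SimpleFunc Ω ℝ) : ℝ :=
  α * ∫ ω, max (Z ω) 0 ∂P - (1 - α) * ∫ ω, max (-Z ω) 0 ∂Q

theorem max_sub_max_neg (x : ℝ) : max x 0 - max (-x) 0 = x := by
  rcases le_total x 0 with h | h
  · rw [max_eq_right h, max_eq_left (by linarith)]; ring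
  · rw [max_eq_left h, max_eq_right (by linarith)]; ring

theorem integrable_max (Z : SimpleFunc Ω ℝ) (M : Measure Ω) [IsFiniteMeasure M] :
    Integrable (fun ω => max (Z ω) 0) M :=
  (Z ⊔ 0).integrable_of_isFiniteMeasure

theorem integrable_max_neg (Z : SimpleFunc Ω ℝ) (M : Measure Ω) [IsFiniteMeasure M] :
    Integrable (fun ω => max (-Z ω) 0) M :=
  ((-Z) ⊔ 0).integrable_of_isFiniteMeasure

theorem duetGain_mono [IsFiniteMeasure P] [IsFiniteMeasure Q] (hα0 : 0 ≤ α) (hα1 : α ≤ 1)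
    {Z W : SimpleFunc Ω ℝ} (hZW : ∀ ω, Z ω ≤ W ω) : duetGain P Q α Z ≤ duetGain P Q α W := by
  have e1 : ∫ ω, max (Z ω) 0 ∂P ≤ ∫ ω, max (W ω) 0 ∂P :=
    integral_mono (integrable_max Z P) (integrable_max W P) fun ω => max_le_max (hZW ω) le_rfl
  have e2 : ∫ ω, max (-W ω) 0 ∂Q ≤ ∫ ω, max (-Z ω) 0 ∂Q :=
    integral_mono (integrable_max_neg W Q) (integrable_max_neg Z Q) fun ω =>
      max_le_max (neg_le_neg (hZW ω)) le_rfl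
  have := mul_le_mul_of_nonneg_left e1 hα0
  have := mul_le_mul_of_nonneg_left e2 (sub_nonneg.2 hα1)
  unfold duetGain
  linarith

theorem duetGain_strict [IsFiniteMeasure P] [IsFiniteMeasure Q] (hα0 : 0 < α) (hα1 : α < 1)
    (hQP : Q ≪ P) {Z W : SimpleFunc Ω ℝ} (hZW : ∀ ω, Z ω ≤ W ω)
    (hpos : Q {ω | Z ω < W ω} ≠ 0) : duetGain P Q α Z < duetGain P Q α W := by
  refine (duetGain_mono hα0.le hα1.le hZW).lt_of_ne fun heq => hpos ?_
  have i1 := integrable_max Z P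
  have i2 := integrable_max W P
  have i3 := integrable_max_neg Z Q
  have i4 := integrable_max_neg W Q
  have n1 : ∀ ω, 0 ≤ max (W ω) 0 - max (Z ω) 0 := fun ω =>
    sub_nonneg.2 (max_le_max (hZW ω) le_rfl)
  have n2 : ∀ ω, 0 ≤ max (-Z ω) 0 - max (-W ω) 0 := fun ω =>
    sub_nonneg.2 (max_le_max (neg_le_neg (hZW ω)) le_rfl)
  have e1 : 0 ≤ ∫ ω, (max (W ω) 0 - max (Z ω) 0) ∂P := integral_nonneg n1
  have e2 : 0 ≤ ∫ ω, (max (-Z ω) 0 - max (-W ω) 0) ∂Q := integral_nonneg n2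
  have hsum : α * ∫ ω, (max (W ω) 0 - max (Z ω) 0) ∂P +
      (1 - α) * ∫ ω, (max (-Z ω) 0 - max (-W ω) 0) ∂Q = 0 := by
    rw [integral_sub i2 i1, integral_sub i3 i4]
    unfold duetGain at heq
    linarith
  have z1 : ∫ ω, (max (W ω) 0 - max (Z ω) 0) ∂P = 0 := by
    have := mul_nonneg (sub_nonneg.2 hα1.le) e2
    nlinarith
  have z2 : ∫ ω, (max (-Z ω) 0 - max (-W ω) 0) ∂Q = 0 := by
    have := mul_nonneg hα0.le e1
    nlinarith
  rw [integral_eq_zero_iff_of_nonneg n1 (i2.sub i1)] at z1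
  rw [integral_eq_zero_iff_of_nonneg n2 (i3.sub i4)] at z2
  have hae : ∀ᵐ ω ∂Q, ¬ (Z ω < W ω) := by
    filter_upwards [hQP.ae_le z1, z2] with ω h1 h2
    simp only [Pi.zero_apply] at h1 h2
    have p1 := max_sub_max_neg (Z ω)
    have p2 := max_sub_max_neg (W ω)
    linarith
  simpa [ae_iff] using hae

/-- How far positive parts are from being additive. -/
theorem duetGain_mix [IsFiniteMeasure P] [IsFiniteMeasure Q] (Z W : SimpleFunc Ω ℝ) (a b : ℝ) :
    duetGain P Q α (a • Z + b • W) = a * duetGain P Q α Z + b * duetGain P Q α W +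
      ((1 - α) * ∫ ω, (a * max (Z ω) 0 + b * max (W ω) 0 - max (a * Z ω + b * W ω) 0) ∂Q -
        α * ∫ ω, (a * max (Z ω) 0 + b * max (W ω) 0 - max (a * Z ω + b * W ω) 0) ∂P) := by
  have i1 := (integrable_max Z P).const_mul a
  have i2 := (integrable_max W P).const_mul b
  have i3 := integrable_max (a • Z + b • W) P
  have j1 := (integrable_max_neg Z Q).const_mul a
  have j2 := (integrable_max_neg W Q).const_mul b
  have e : ∀ ω, a * max (Z ω) 0 + b * max (W ω) 0 - max (a * Z ω + b * W ω) 0 =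
      a * max (-Z ω) 0 + b * max (-W ω) 0 - max (-(a * Z ω + b * W ω)) 0 := fun ω => by
    have p1 := max_sub_max_neg (Z ω)
    have p2 := max_sub_max_neg (W ω)
    have p3 := max_sub_max_neg (a * Z ω + b * W ω)
    linear_combination a * p1 + b * p2 - p3
  have hQ : ∫ ω, (a * max (Z ω) 0 + b * max (W ω) 0 - max (a * Z ω + b * W ω) 0) ∂Q =
      a * ∫ ω, max (-Z ω) 0 ∂Q + b * ∫ ω, max (-W ω) 0 ∂Q -
        ∫ ω, max (-(a • Z + b • W) ω) 0 ∂Q := by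
    simp only [e]
    refine (integral_sub (j1.add j2) (integrable_max_neg (a • Z + b • W) Q)).trans ?_
    rw [integral_add' j1 j2, integral_const_mul, integral_const_mul]
  have hP : ∫ ω, (a * max (Z ω) 0 + b * max (W ω) 0 - max (a * Z ω + b * W ω) 0) ∂P =
      a * ∫ ω, max (Z ω) 0 ∂P + b * ∫ ω, max (W ω) 0 ∂P -
        ∫ ω, max ((a • Z + b • W) ω) 0 ∂P := by
    refine (integral_sub (i1.add i2) i3).trans ?_
    rw [integral_add' i1 i2, integral_const_mul, integral_const_mul]
  rw [hP, hQ]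
  unfold duetGain
  ring

/-- Superlinearity, from `α P ≤ (1 - α) Q`. -/
theorem le_duetGain_mix [IsFiniteMeasure P] [IsFiniteMeasure Q] (hα0 : 0 ≤ α) (hα1 : α ≤ 1)
    (hle : ENNReal.ofReal α • P ≤ ENNReal.ofReal (1 - α) • Q) (Z W : SimpleFunc Ω ℝ) {a b : ℝ}
    (ha : 0 ≤ a) (hb : 0 ≤ b) :
    a * duetGain P Q α Z + b * duetGain P Q α W ≤ duetGain P Q α (a • Z + b • W) := by
  rw [duetGain_mix]
  have hnn : ∀ ω, 0 ≤ a * max (Z ω) 0 + b * max (W ω) 0 - max (a * Z ω + b * W ω) 0 := fun ω => by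
    rw [sub_nonneg]
    have h1 := mul_le_mul_of_nonneg_left (le_max_left (Z ω) 0) ha
    have h2 := mul_le_mul_of_nonneg_left (le_max_left (W ω) 0) hb
    have h3 := mul_nonneg ha (le_max_right (Z ω) 0)
    have h4 := mul_nonneg hb (le_max_right (W ω) 0)
    exact max_le (by linarith) (by linarith)
  have hint : Integrable (fun ω => a * max (Z ω) 0 + b * max (W ω) 0 - max (a * Z ω + b * W ω) 0)
      (ENNReal.ofReal (1 - α) • Q) :=
    ((((integrable_max Z Q).const_mul a).add ((integrable_max W Q).const_mul b)).sub
      (integrable_max (a • Z + b • W) Q)).smul_measure ENNReal.ofReal_ne_top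
  have := integral_mono_measure hle (Filter.Eventually.of_forall hnn) hint
  rw [integral_smul_measure, integral_smul_measure, ENNReal.toReal_ofReal hα0,
    ENNReal.toReal_ofReal (sub_nonneg.2 hα1)] at this
  simp only [smul_eq_mul] at this
  linarith

/-- Linearity on random variables with the same negative set. -/
theorem duetGain_mix_eq [IsFiniteMeasure P] [IsFiniteMeasure Q] {Z W : SimpleFunc Ω ℝ} {a b : ℝ}
    (ha : 0 ≤ a) (hb : 0 ≤ b) (hZW : ∀ ω, Z ω < 0 ↔ W ω < 0) :
    duetGain P Q α (a • Z + b • W) = a * duetGain P Q α Z + b * duetGain P Q α W := by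
  have hz : ∀ ω, a * max (Z ω) 0 + b * max (W ω) 0 - max (a * Z ω + b * W ω) 0 = 0 := fun ω => by
    by_cases h : Z ω < 0
    · have h' := (hZW ω).1 h
      rw [max_eq_right h.le, max_eq_right h'.le, max_eq_right (by nlinarith)]
      ring
    · have h' := not_lt.1 (mt (hZW ω).2 h)
      have h := not_lt.1 h
      rw [max_eq_left h, max_eq_left h', max_eq_left (by positivity)]
      ring
  rw [duetGain_mix]
  simp only [hz, integral_zero]
  ring

end Gain

/-- The standing assumptions on the parameters of a duet expectile. -/
structure IsDuet {Ω : Type*} [MeasurableSpace Ω] (P Q : Measure Ω) (α : ℝ) : Prop where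
  prob_P : IsProbabilityMeasure P
  prob_Q : IsProbabilityMeasure Q
  ac_PQ : P ≪ Q
  ac_QP : Q ≪ P
  pos : 0 < α
  lt_one : α < 1

namespace IsDuet

variable {Ω : Type*} [MeasurableSpace Ω] {P Q : Measure Ω} {α : ℝ}

theorem gain_lt (d : IsDuet P Q α) (X : SimpleFunc Ω ℝ) {y z : ℝ} (hyz : y < z) :
    duetGain P Q α (X - SimpleFunc.const Ω z) < duetGain P Q α (X - SimpleFunc.const Ω y) := by
  have := d.prob_P
  have := d.prob_Q
  refine duetGain_strict d.pos d.lt_one d.ac_QP (fun ω => ?_) ?_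
  · simp only [SimpleFunc.coe_sub, Pi.sub_apply, SimpleFunc.const_apply]; linarith
  · have : {ω | (X - SimpleFunc.const Ω z) ω < (X - SimpleFunc.const Ω y) ω} = Set.univ := by
      ext ω
      simp [hyz]
    rw [this]
    simp

theorem gain_zero (P Q : Measure Ω) (α : ℝ) : duetGain P Q α 0 = 0 := by
  simp [duetGain]

theorem gain_const (d : IsDuet P Q α) (c : ℝ) :
    duetGain P Q α (SimpleFunc.const Ω c) = α * max c 0 - (1 - α) * max (-c) 0 := by
  have := d.prob_P
  have := d.prob_Q
  simp [duetGain]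

theorem exists_root (d : IsDuet P Q α) (X : SimpleFunc Ω ℝ) :
    ∃ y, duetGain P Q α (X - SimpleFunc.const Ω y) = 0 := by
  have := d.prob_P
  have := d.prob_Q
  obtain ⟨M, hM1, hM⟩ := exists_one_le_bound X
  have hcont : Continuous fun y : ℝ => duetGain P Q α (X - SimpleFunc.const Ω y) := by
    have c1 : Continuous fun y : ℝ => ∫ ω, max ((X - SimpleFunc.const Ω y) ω) 0 ∂P := by
      refine (LipschitzWith.of_dist_le_mul (K := 1) fun y z => ?_).continuous
      rw [Real.dist_eq, ← integral_sub (integrable_max _ P) (integrable_max _ P), NNReal.coe_one,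
        one_mul, ← Real.norm_eq_abs]
      refine (norm_integral_le_of_norm_le_const (C := dist y z)
        (Filter.Eventually.of_forall fun ω => ?_)).trans (by simp)
      refine (abs_max_sub_max_le_abs _ _ _).trans ?_
      simp only [SimpleFunc.coe_sub, Pi.sub_apply, SimpleFunc.const_apply]
      rw [Real.dist_eq, abs_sub_comm y z]
      exact le_of_eq (by congr 1; ring)
    have c2 : Continuous fun y : ℝ => ∫ ω, max (-(X - SimpleFunc.const Ω y) ω) 0 ∂Q := by
      refine (LipschitzWith.of_dist_le_mul (K := 1) fun y z => ?_).continuous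
      rw [Real.dist_eq, ← integral_sub (integrable_max_neg _ Q) (integrable_max_neg _ Q),
        NNReal.coe_one, one_mul, ← Real.norm_eq_abs]
      refine (norm_integral_le_of_norm_le_const (C := dist y z)
        (Filter.Eventually.of_forall fun ω => ?_)).trans (by simp)
      refine (abs_max_sub_max_le_abs _ _ _).trans ?_
      simp only [SimpleFunc.coe_sub, Pi.sub_apply, SimpleFunc.const_apply]
      rw [Real.dist_eq]
      exact le_of_eq (by congr 1; ring)
    exact (continuous_const.mul c1).sub (continuous_const.mul c2)
  have hlo : 0 ≤ duetGain P Q α (X - SimpleFunc.const Ω (-M)) := by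
    rw [← gain_zero P Q α]
    refine duetGain_mono d.pos.le d.lt_one.le fun ω => ?_
    have := (abs_le.1 (hM ω)).1
    simp only [SimpleFunc.coe_zero, Pi.zero_apply, SimpleFunc.coe_sub, Pi.sub_apply,
      SimpleFunc.const_apply]
    linarith
  have hhi : duetGain P Q α (X - SimpleFunc.const Ω M) ≤ 0 := by
    rw [← gain_zero P Q α]
    refine duetGain_mono d.pos.le d.lt_one.le fun ω => ?_
    have := (abs_le.1 (hM ω)).2
    simp only [SimpleFunc.coe_zero, Pi.zero_apply, SimpleFunc.coe_sub, Pi.sub_apply,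
      SimpleFunc.const_apply]
    linarith
  obtain ⟨y, -, hy⟩ := intermediate_value_Icc' (by linarith : -M ≤ M) hcont.continuousOn ⟨hhi, hlo⟩
  exact ⟨y, hy⟩

theorem duetExpectile_eq (d : IsDuet P Q α) {X : SimpleFunc Ω ℝ} {y : ℝ}
    (hy : duetGain P Q α (X - SimpleFunc.const Ω y) = 0) : duetExpectile P Q α X = y := by
  have : {z : ℝ | α * ∫ ω, max (X ω - z) 0 ∂P = (1 - α) * ∫ ω, max (z - X ω) 0 ∂Q} = {y} := by
    ext z
    have e : duetGain P Q α (X - SimpleFunc.const Ω z) =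
        α * ∫ ω, max (X ω - z) 0 ∂P - (1 - α) * ∫ ω, max (z - X ω) 0 ∂Q := by
      simp [duetGain]
    rw [Set.mem_ofPred_eq, Set.mem_singleton_iff, ← sub_eq_zero, ← e]
    constructor
    · intro hz
      rcases lt_trichotomy z y with h | h | h
      · have := d.gain_lt X h
        linarith
      · exact h
      · have := d.gain_lt X h
        linarith
    · rintro rfl
      exact hy
  rw [duetExpectile, this, csInf_singleton]

theorem gain_duetExpectile (d : IsDuet P Q α) (X : SimpleFunc Ω ℝ) :
    duetGain P Q α (X - SimpleFunc.const Ω (duetExpectile P Q α X)) = 0 := by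
  obtain ⟨y, hy⟩ := d.exists_root X
  rwa [d.duetExpectile_eq hy]

theorem le_iff (d : IsDuet P Q α) (X : SimpleFunc Ω ℝ) (y : ℝ) :
    y ≤ duetExpectile P Q α X ↔ 0 ≤ duetGain P Q α (X - SimpleFunc.const Ω y) := by
  have h0 := d.gain_duetExpectile X
  constructor
  · intro hle
    rcases hle.eq_or_lt with h | h
    · rw [h, h0]
    · have := d.gain_lt X h
      linarith
  · intro hle
    by_contra hc
    have := d.gain_lt X (not_le.1 hc)
    linarith

theorem lt_iff (d : IsDuet P Q α) (X : SimpleFunc Ω ℝ) (y : ℝ) :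
    y < duetExpectile P Q α X ↔ 0 < duetGain P Q α (X - SimpleFunc.const Ω y) := by
  have h0 := d.gain_duetExpectile X
  constructor
  · intro h
    have := d.gain_lt X h
    linarith
  · intro h
    by_contra hc
    rcases (not_lt.1 hc).eq_or_lt with h' | h'
    · rw [← h', h0] at h
      exact lt_irrefl _ h
    · have := d.gain_lt X h'
      linarith

theorem expectile_mono (d : IsDuet P Q α) {X Y : SimpleFunc Ω ℝ} (hXY : ∀ ω, X ω ≤ Y ω) :
    duetExpectile P Q α X ≤ duetExpectile P Q α Y := by
  have := d.prob_P
  have := d.prob_Q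
  rw [d.le_iff, ← d.gain_duetExpectile X]
  exact duetGain_mono d.pos.le d.lt_one.le fun ω => sub_le_sub_right (hXY ω) _

theorem expectile_strict (d : IsDuet P Q α) {X Y : SimpleFunc Ω ℝ} (hXY : ∀ ω, X ω ≤ Y ω)
    (hpos : Q {ω | X ω < Y ω} ≠ 0) : duetExpectile P Q α X < duetExpectile P Q α Y := by
  have := d.prob_P
  have := d.prob_Q
  rw [d.lt_iff, ← d.gain_duetExpectile X]
  refine duetGain_strict d.pos d.lt_one d.ac_QP (fun ω => sub_le_sub_right (hXY ω) _) ?_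
  convert hpos using 4
  exact sub_lt_sub_iff_right _

theorem expectile_const (d : IsDuet P Q α) (c : ℝ) :
    duetExpectile P Q α (SimpleFunc.const Ω c) = c := by
  refine d.duetExpectile_eq ?_
  rw [sub_self, gain_zero]

theorem gain_smul (d : IsDuet P Q α) {a : ℝ} (ha : 0 ≤ a) (X : SimpleFunc Ω ℝ) :
    duetGain P Q α (a • X) = a * duetGain P Q α X := by
  have := d.prob_P
  have := d.prob_Q
  have := duetGain_mix_eq (P := P) (Q := Q) (α := α) (Z := X) (W := X) ha le_rfl
    (fun ω => Iff.rfl)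
  simpa using this

theorem expectile_affine (d : IsDuet P Q α) {a : ℝ} (ha : 0 ≤ a) (b : ℝ) (X : SimpleFunc Ω ℝ) :
    duetExpectile P Q α ⇑(a • X + SimpleFunc.const Ω b) = a * duetExpectile P Q α X + b := by
  refine d.duetExpectile_eq ?_
  rw [show a • X + SimpleFunc.const Ω b -
    SimpleFunc.const Ω (a * duetExpectile P Q α X + b) =
      a • (X - SimpleFunc.const Ω (duetExpectile P Q α X)) by
        ext ω; simp; ring, d.gain_smul ha, d.gain_duetExpectile, mul_zero]

end IsDuet

/-! ### From the axioms to the certainty equivalent -/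

section Axioms

variable {Ω E : Type*} [MeasurableSpace Ω] [AddCommGroup E] [Module ℝ E] {C : Set E}

/-- `u` is an affine utility of outcomes for the preference `R`, and `R` is strictly monotone. -/
structure IsMonotoneUtility (hC : Convex ℝ C) (μ : Measure Ω) (R : Act Ω C → Act Ω C → Prop)
    (u : C → ℝ) : Prop where
  affine : IsAffineUtility hC u
  pref : IsPreference μ R
  const_iff : ∀ x y : C, R (constAct Ω x) (constAct Ω y) ↔ u y ≤ u x
  mono : StrictMonotonicity μ R

/-- The Archimedean axiom and independence give an affine utility of outcomes. -/
theorem exists_utility (hC : Convex ℝ C) {μ : Measure Ω} {R : Act Ω C → Act Ω C → Prop}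
    (hR : IsPreference μ R) (hSM : StrictMonotonicity μ R) (hI : Independence hC R)
    (hA : ArchimedeanContinuity hC R) (hN : NonDegeneracy R) :
    ∃ u : C → ℝ, IsMonotoneUtility hC μ R u ∧ ∃ x₀ x₁ : C, u x₀ = -1 ∧ u x₁ = 1 := by
  set r : E → E → Prop := fun x y => ∃ (hx : x ∈ C) (hy : y ∈ C),
    R (constAct Ω ⟨x, hx⟩) (constAct Ω ⟨y, hy⟩) with hr
  have r_iff : ∀ {x y : E} (hx : x ∈ C) (hy : y ∈ C),
      r x y ↔ R (constAct Ω ⟨x, hx⟩) (constAct Ω ⟨y, hy⟩) := fun hx hy =>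
    ⟨fun h => h.2.2, fun h => ⟨hx, hy, h⟩⟩
  have strict : ∀ {f g : Act Ω C}, ¬ R g f → Strict R f g := fun h =>
    ⟨(hR.total _ _).resolve_right h, h⟩
  have hmix : IsMixturePreference C r :=
    { convex := hC
      total := fun x hx y hy => by
        rw [r_iff hx hy, r_iff hy hx]; exact hR.total _ _
      trans := fun x hx y hy z hz h1 h2 => by
        rw [r_iff hx hy] at h1
        rw [r_iff hy hz] at h2
        rw [r_iff hx hz]
        exact hR.trans _ _ _ h1 h2
      ind := fun x hx y hy z hz l hl hl1 h => by
        rw [r_iff hy hx] at h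
        have := hI ⟨x, hx⟩ ⟨y, hy⟩ ⟨z, hz⟩ ⟨l, hl.le, hl1⟩ hl (strict h)
        exact fun hc => this.2 hc.2.2
      arch := fun x hx y hy z hz h1 h2 => by
        rw [r_iff hy hx] at h1
        rw [r_iff hz hy] at h2
        obtain ⟨a, b, ha, hb, ha', hb'⟩ := hA _ _ _ (strict h1) (strict h2)
        exact ⟨a, b, ha, hb, fun hc => ha'.2 hc.2.2, fun hc => hb'.2 hc.2.2⟩ }
  obtain ⟨x₀, x₁, h01⟩ : ∃ x₀ x₁ : C, ¬ r x₀ x₁ := by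
    by_contra hcon
    push Not at hcon
    obtain ⟨f, g, -, hfg⟩ := hN
    exact hfg (hSM g f fun ω => (r_iff (g ω).2 (f ω).2).1 (hcon _ _)).1
  obtain ⟨u, h0, h1, hu, haff⟩ := hmix.exists_affine x₀.2 x₁.2 h01
  exact ⟨fun x => u x, ⟨fun l x y => haff x x.2 y y.2 l l.2.1 l.2.2, hR,
    fun x y => by rw [← hu x x.2 y y.2, r_iff x.2 y.2], hSM⟩, x₀, x₁, h0, h1⟩

namespace IsMonotoneUtility

variable {hC : Convex ℝ C} {μ : Measure Ω} {R : Act Ω C → Act Ω C → Prop} {u : C → ℝ}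

theorem pref_of_le (h : IsMonotoneUtility hC μ R u) {f g : Act Ω C}
    (hfg : ∀ ω, u (g ω) ≤ u (f ω)) : R f g :=
  (h.mono f g fun ω => (h.const_iff _ _).2 (hfg ω)).1

theorem strict_of_not (h : IsMonotoneUtility hC μ R u) {f g : Act Ω C} (hn : ¬ R g f) :
    Strict R f g := ⟨(h.pref.total _ _).resolve_right hn, hn⟩

theorem not_of_lt (h : IsMonotoneUtility hC μ R u) {f g : Act Ω C}
    (hfg : ∀ ω, u (g ω) ≤ u (f ω)) (hpos : 0 < μ {ω | u (g ω) < u (f ω)}) : ¬ R g f := by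
  refine ((h.mono f g fun ω => (h.const_iff _ _).2 (hfg ω)).2 (hpos.trans_le
    (measure_mono fun ω hω => ⟨(h.const_iff _ _).2 (hfg ω), fun hc => ?_⟩))).2
  exact absurd ((h.const_iff _ _).1 hc) (not_le.2 hω)

theorem mixAct_apply (h : IsMonotoneUtility hC μ R u) (l : Set.Icc (0 : ℝ) 1) (f g : Act Ω C)
    (ω : Ω) : u (mixAct hC l f g ω) = (l : ℝ) * u (f ω) + (1 - (l : ℝ)) * u (g ω) :=
  h.affine l (f ω) (g ω)

/-- On the segment between an act and a dominated one there is an act that is indifferent to any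
given act that lies between them in preference. -/
theorem exists_mix_indiff (h : IsMonotoneUtility hC μ R u) (hA : ArchimedeanContinuity hC R)
    {f g k : Act Ω C} (hdom : ∀ ω, u (k ω) ≤ u (f ω)) (hfg : R f g) (hgk : R g k) :
    ∃ l : Set.Icc (0 : ℝ) 1, Indiff R (mixAct hC l f k) g := by
  by_cases hkg : R k g
  · refine ⟨⟨0, le_rfl, zero_le_one⟩, h.pref.trans _ _ _ (h.pref_of_le fun ω => ?_) hkg,
      h.pref.trans _ _ _ hgk (h.pref_of_le fun ω => ?_)⟩ <;>
    · rw [h.mixAct_apply]; simp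
  by_cases hgf : R g f
  · refine ⟨⟨1, zero_le_one, le_rfl⟩, h.pref.trans _ _ _ (h.pref_of_le fun ω => ?_) hfg,
      h.pref.trans _ _ _ hgf (h.pref_of_le fun ω => ?_)⟩ <;>
    · rw [h.mixAct_apply]; simp
  set path : ℝ → Act Ω C := fun t => mixAct hC (Set.projIcc 0 1 zero_le_one t) f k with hpath
  have hval : ∀ t, 0 ≤ t → t ≤ 1 → ∀ ω, u (path t ω) = t * u (f ω) + (1 - t) * u (k ω) := by
    intro t h0 h1 ω
    rw [hpath, h.mixAct_apply, Set.projIcc_of_mem zero_le_one ⟨h0, h1⟩]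
  obtain ⟨t, -, -, hup, hdn⟩ := exists_up_and_dn (up := fun t => R (path t) g)
    (dn := fun t => R g (path t))
    (h.pref.trans _ _ _ hgk (h.pref_of_le fun ω => by
      rw [hval 0 le_rfl zero_le_one]; simp))
    (h.pref.trans _ _ _ (h.pref_of_le fun ω => by
      rw [hval 1 zero_le_one le_rfl]; simp) hfg)
    (fun t _ _ => h.pref.total _ _) (fun s t hs hst ht hr => h.pref.trans _ _ _ hr
      (h.pref_of_le fun ω => by
        rw [hval s hs (hst.trans ht), hval t (hs.trans hst) ht]
        have := mul_nonneg (sub_nonneg.2 hst) (sub_nonneg.2 (hdom ω))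
        linarith))
    (fun t ht ht1 hn => by
      obtain ⟨a, -, ha, -, ha', -⟩ := hA _ _ _ (h.strict_of_not hn) (h.strict_of_not hkg)
      have h0 : 0 ≤ (a : ℝ) * t := mul_nonneg ha.1.le ht.le
      have hlt : (a : ℝ) * t < t := mul_lt_of_lt_one_left ht ha.2
      refine ⟨a * t, h0, hlt, fun hc => ha'.2 (h.pref.trans _ _ _ hc (h.pref_of_le fun ω => ?_))⟩
      rw [h.mixAct_apply, hval t ht.le ht1, hval _ h0 (hlt.le.trans ht1)]
      exact le_of_eq (by ring))
    (fun t ht ht1 hn => by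
      obtain ⟨-, b, -, hb, -, hb'⟩ := hA _ _ _ (h.strict_of_not hgf) (h.strict_of_not hn)
      have hlt : t < b + (1 - b) * t := by nlinarith [mul_pos hb.1 (sub_pos.2 ht1)]
      have h1 : b + (1 - b) * t ≤ 1 := by nlinarith [mul_pos (sub_pos.2 hb.2) (sub_pos.2 ht1)]
      refine ⟨b + (1 - b) * t, hlt, h1, fun hc => hb'.2
        (h.pref.trans _ _ _ (h.pref_of_le fun ω => ?_) hc)⟩
      rw [h.mixAct_apply b f (path t), hval t ht ht1.le, hval _ (ht.trans hlt.le) h1]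
      exact le_of_eq (by ring))
  exact ⟨_, hup, hdn⟩

/-- Every act has a certainty equivalent. -/
theorem exists_certainty_equivalent [Nonempty Ω] (h : IsMonotoneUtility hC μ R u)
    (hA : ArchimedeanContinuity hC R) (f : Act Ω C) : ∃ x : C, Indiff R f (constAct Ω x) := by
  obtain ⟨_, ⟨ω₁, rfl⟩, h₁⟩ := Set.exists_max_image (Set.range f) u f.finite_range
    (Set.range_nonempty _)
  obtain ⟨_, ⟨ω₀, rfl⟩, h₀⟩ := Set.exists_min_image (Set.range f) u f.finite_range
    (Set.range_nonempty _)
  obtain ⟨l, hl⟩ := h.exists_mix_indiff hA (f := constAct Ω (f ω₁)) (g := f)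
    (k := constAct Ω (f ω₀)) (fun ω => h₀ _ ⟨ω₁, rfl⟩) (h.pref_of_le fun ω => h₁ _ ⟨ω, rfl⟩)
    (h.pref_of_le fun ω => h₀ _ ⟨ω, rfl⟩)
  have e : constAct Ω (mixOutcome hC l (f ω₁) (f ω₀)) =
      mixAct hC l (constAct Ω (f ω₁)) (constAct Ω (f ω₀)) := rfl
  exact ⟨mixOutcome hC l (f ω₁) (f ω₀), by rw [e]; exact ⟨hl.2, hl.1⟩⟩

theorem exists_actUtility [Nonempty Ω] (h : IsMonotoneUtility hC μ R u)
    (hA : ArchimedeanContinuity hC R) : ∃ U : Act Ω C → ℝ, (∀ f g, R f g ↔ U g ≤ U f) ∧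
      (∀ x, U (constAct Ω x) = u x) ∧ ∀ f, U f ∈ Set.range u := by
  choose ce hce using h.exists_certainty_equivalent hA
  have key : ∀ f g, R f g ↔ u (ce g) ≤ u (ce f) := fun f g => by
    rw [← h.const_iff]
    exact ⟨fun hr => h.pref.trans _ _ _ (hce f).2 (h.pref.trans _ _ _ hr (hce g).1),
      fun hr => h.pref.trans _ _ _ (hce f).1 (h.pref.trans _ _ _ hr (hce g).2)⟩
  refine ⟨fun f => u (ce f), key, fun x => ?_, fun f => ⟨_, rfl⟩⟩
  exact le_antisymm ((h.const_iff _ _).1 (hce (constAct Ω x)).1)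
    ((h.const_iff _ _).1 (hce (constAct Ω x)).2)

end IsMonotoneUtility

/-- The axioms turn into the properties of a certainty equivalent on acts measured in utils. -/
theorem exists_certaintyEquivalent [Nonempty Ω] (hC : Convex ℝ C) {μ : Measure Ω}
    {R : Act Ω C → Act Ω C → Prop} {u : C → ℝ} (h : IsMonotoneUtility hC μ R u)
    (hA : ArchimedeanContinuity hC R) (hD : DiscoAversion hC R) (hM : MonotoneContinuity R)
    {x₀ x₁ : C} (h₀ : u x₀ = -1) (h₁ : u x₁ = 1) :
    ∃ I : SimpleFunc Ω ℝ → ℝ, IsCertaintyEquivalent μ (Set.range u) I ∧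
      (∀ f g : Act Ω C, R f g ↔ I (g.map u) ≤ I (f.map u)) ∧
      ∀ A : ℕ → Set Ω, (∀ n, MeasurableSet (A n)) → Antitone A → ⋂ n, A n = ∅ →
        ∀ e : ℝ, 0 < e → ∃ n, -e < I (-ind (A n)) := by
  obtain ⟨U, hU, hUc, hUr⟩ := h.exists_actUtility hA
  have : Nonempty C := ⟨x₀⟩
  set σ : ℝ → C := Function.invFun u with hσ
  have uσ : ∀ {t : ℝ}, t ∈ Set.range u → u (σ t) = t := fun ht => Function.invFun_eq ht
  have hUle : ∀ {f g : Act Ω C}, (∀ ω, u (g ω) ≤ u (f ω)) → U g ≤ U f := fun hfg =>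
    (hU _ _).1 (h.pref_of_le hfg)
  have hUeq : ∀ {f g : Act Ω C}, (∀ ω, u (g ω) = u (f ω)) → U g = U f := fun hfg =>
    le_antisymm (hUle fun ω => (hfg ω).le) (hUle fun ω => (hfg ω).ge)
  have hUlt : ∀ {f g : Act Ω C}, ¬ R g f ↔ U g < U f := fun {f g} => by rw [hU, not_le]
  have uX : ∀ {X : SimpleFunc Ω ℝ}, (∀ ω, X ω ∈ Set.range u) → ∀ ω, u (X.map σ ω) = X ω :=
    fun hX ω => uσ (hX ω)
  have hK : Convex ℝ (Set.range u) := by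
    rintro _ ⟨x, rfl⟩ _ ⟨y, rfl⟩ a b ha hb hab
    obtain rfl : b = 1 - a := by linarith
    exact ⟨mixOutcome hC ⟨a, ha, by linarith⟩ x y, h.affine _ x y⟩
  have mixeq : ∀ {X Y : SimpleFunc Ω ℝ}, (∀ ω, X ω ∈ Set.range u) → (∀ ω, Y ω ∈ Set.range u) →
      ∀ l : Set.Icc (0 : ℝ) 1, U ((((l : ℝ) • X + (1 - (l : ℝ)) • Y)).map σ) =
        U (mixAct hC l (X.map σ) (Y.map σ)) := by
    intro X Y hX hY l
    refine hUeq fun ω => ?_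
    rw [h.mixAct_apply, uX hX, uX hY, uX]
    · rfl
    · exact fun ω => hK (hX ω) (hY ω) l.2.1 (sub_nonneg.2 l.2.2) (add_sub_cancel _ _)
  have hdis : ∀ f : Act Ω C, disappointment R f = {ω | u (f ω) < U f} := by
    intro f
    ext ω
    simp only [disappointment, Strict, Set.mem_ofPred_eq, hU, hUc, not_le]
    exact ⟨fun hh => hh.2, fun hh => ⟨hh.le, hh⟩⟩
  refine ⟨fun X => U (X.map σ), ⟨hK, ⟨x₀, h₀⟩, ⟨x₁, h₁⟩, ?_, ?_, ?_, ?_, ?_, ?_⟩, ?_, ?_⟩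
  · intro t ht
    rw [show (SimpleFunc.const Ω t).map σ = constAct Ω (σ t) from rfl, hUc, uσ ht]
  · intro X Y hX hY hXY
    exact hUle fun ω => by rw [uX hX, uX hY]; exact hXY ω
  · intro X Y hX hY hXY hpos
    refine hUlt.1 (h.not_of_lt (fun ω => by rw [uX hX, uX hY]; exact hXY ω) ?_)
    simp only [uX hX, uX hY]
    exact hpos
  · intro X Y hX hY hXY
    have := h.pref.ae_eq (X.map σ) (Y.map σ) (by
      filter_upwards [hXY] with ω hω
      simp [hω])
    exact le_antisymm ((hU _ _).1 this.2) ((hU _ _).1 this.1)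
  · intro X Y hX hY hXY t hXt htY
    obtain ⟨x, rfl⟩ : t ∈ Set.range u :=
      hK.ordConnected.out (hUr (X.map σ)) (hUr (Y.map σ)) ⟨hXt, htY⟩
    obtain ⟨l, hl⟩ := h.exists_mix_indiff hA (f := Y.map σ) (g := constAct Ω x) (k := X.map σ)
      (fun ω => by rw [uX hX, uX hY]; exact hXY ω) (by rw [hU, hUc]; exact htY)
      (by rw [hU, hUc]; exact hXt)
    refine ⟨l, l.2.1, l.2.2, ?_⟩
    rw [mixeq hY hX, ← hUc x]
    exact le_antisymm ((hU _ _).1 hl.2) ((hU _ _).1 hl.1)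
  · intro X Y Z hX hY hZ hXY hYZ a ha0 ha1
    have e1 := mixeq hX hY ⟨a, ha0.le, ha1.le⟩
    have e2 := mixeq hX hZ ⟨a, ha0.le, ha1.le⟩
    simp only at e1 e2
    rw [e1, e2]
    refine (hU _ _).1 (hD _ _ _ ?_ ⟨(hU _ _).2 hYZ.ge, (hU _ _).2 hYZ.le⟩ ⟨a, ha0.le, ha1.le⟩
      ⟨ha0, ha1⟩)
    rw [Disco, hdis, hdis]
    simp only [uX hX, uX hY]
    exact hXY
  · intro f g
    have e : ∀ f : Act Ω C, U ((f.map u).map σ) = U f := fun f =>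
      hUeq fun ω => uσ ⟨f ω, rfl⟩
    simp only [e]
    exact hU f g
  · intro A hAm hAa hAe e he
    set e' := min e 1 with he'
    have he0 : 0 < e' := lt_min he one_pos
    have he1 : e' ≤ 1 := min_le_right _ _
    have m : ∀ {t : ℝ}, -1 ≤ t → t ≤ 0 → t ∈ Set.range u := fun h1 h2 =>
      hK.ordConnected.out ⟨x₀, h₀⟩ ⟨x₁, h₁⟩ ⟨h1, by linarith⟩
    obtain ⟨n, hn⟩ := hM (σ 0) (σ (-e')) (σ (-1)) (h.strict_of_not (by
      rw [h.const_iff, uσ (m (by norm_num) le_rfl), uσ (m (by linarith) (by linarith))]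
      linarith)) A hAm hAa hAe
    have hlt := hUlt.1 hn.2
    rw [hUc, uσ (m (by linarith) (by linarith))] at hlt
    refine ⟨n, lt_of_le_of_lt (neg_le_neg (min_le_left e 1)) (hlt.trans_eq (hUeq fun ω => ?_))⟩
    by_cases hω : ω ∈ A n
    · rw [SimpleFunc.map_apply, SimpleFunc.coe_neg, Pi.neg_apply, ind_of_mem (hAm n) hω]
      simp [betAct, SimpleFunc.piecewise_apply, hω]
    · rw [SimpleFunc.map_apply, SimpleFunc.coe_neg, Pi.neg_apply, ind_of_notMem (hAm n) hω,
        neg_zero]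
      simp [betAct, SimpleFunc.piecewise_apply, hω]

theorem exists_representation (hC : Convex ℝ C) {μ : Measure Ω} [IsProbabilityMeasure μ]
    (hμ : IsStandardSpace μ) {R : Act Ω C → Act Ω C → Prop} (hR : IsPreference μ R)
    (hSM : StrictMonotonicity μ R) (hI : Independence hC R) (hA : ArchimedeanContinuity hC R)
    (hD : DiscoAversion hC R) (hN : NonDegeneracy R) (hM : MonotoneContinuity R) :
    ∃ (u : C → ℝ) (P Q : Measure Ω) (α : ℝ), IsRepresentation hC μ R u P Q α := by
  have : Nonempty Ω := by
    by_contra hne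
    rw [not_nonempty_iff] at hne
    have := measure_univ (μ := μ)
    rw [Set.univ_eq_empty_iff.2 hne, measure_empty] at this
    exact zero_ne_one this
  obtain ⟨u, hu, x₀, x₁, h₀, h₁⟩ := exists_utility hC hR hSM hI hA hN
  obtain ⟨I, hI, hIR, hIc⟩ := exists_certaintyEquivalent hC hu hA hD hM h₀ h₁
  have hJ := hI.isDiscoFunctional
  obtain ⟨P, Q, α, hP, hQ, hPQ, hQμ, hα, hle, hroot⟩ := hJ.exists_duet hμ
    (fun A hAm hAa hAe e he => by
      obtain ⟨n, hn⟩ := hIc A hAm hAa hAe e he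
      refine ⟨n, ?_⟩
      rwa [hI.extension_eq_of_mem fun ω => hI.mem_of_abs_le ?_]
      have n0 := ind_nonneg (hAm n) ω
      have n1 := ind_le_one (hAm n) ω
      rw [SimpleFunc.coe_neg, Pi.neg_apply, abs_neg, abs_of_nonneg n0]
      exact n1)
  have d : IsDuet P Q α := ⟨hP, hQ, hPQ.1, hPQ.2, hα.1, by linarith [hα.2]⟩
  refine ⟨u, P, Q, α, hu.affine, ⟨x₀, x₁, by rw [h₀, h₁]; norm_num⟩, hP, hQ, hPQ, hQμ, hα, hle,
    fun f g => ?_⟩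
  have e : ∀ f : Act Ω C, duetExpectile P Q α (fun ω => u (f ω)) = I (f.map u) := by
    intro f
    rw [← hI.extension_eq_of_mem (X := f.map u) fun ω => ⟨f ω, rfl⟩]
    refine d.duetExpectile_eq (X := f.map u) ?_
    have := hroot (f.map u)
    simp only [duetGain, SimpleFunc.coe_sub, Pi.sub_apply, SimpleFunc.const_apply, neg_sub]
    linarith
  rw [hIR, e, e]

end Axioms

/-! ### Necessity of the axioms -/

section Necessity

variable {Ω E : Type*} [MeasurableSpace Ω] [AddCommGroup E] [Module ℝ E] {C : Set E}
  {hC : Convex ℝ C} {μ : Measure Ω} {R : Act Ω C → Act Ω C → Prop} {u : C → ℝ} {P Q : Measure Ω}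
  {α : ℝ}

theorem duetGain_neg_ind (P Q : Measure Ω) (α : ℝ) {A : Set Ω} (hA : MeasurableSet A) :
    duetGain P Q α (-ind A) = -((1 - α) * Q.real A) := by
  have e1 : ∀ ω, max ((-ind A) ω) 0 = 0 := fun ω => max_eq_right (by
    have := ind_nonneg hA ω
    simpa using this)
  have e2 : ∀ ω, max (-(-ind A) ω) 0 = A.indicator 1 ω := fun ω => by
    have := ind_nonneg hA ω
    rw [SimpleFunc.coe_neg, Pi.neg_apply, neg_neg, max_eq_left this]
    by_cases hω : ω ∈ A
    · simp [ind_of_mem hA hω, hω]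
    · simp [ind_of_notMem hA hω, hω]
  simp only [duetGain, e1, e2, integral_zero, integral_indicator_one hA]
  ring

namespace IsDuet

theorem expectile_le_add (d : IsDuet P Q α) {X Y : SimpleFunc Ω ℝ} {c : ℝ}
    (hXY : ∀ ω, X ω ≤ Y ω + c) : duetExpectile P Q α X ≤ duetExpectile P Q α Y + c := by
  have := d.expectile_affine zero_le_one c Y
  rw [one_smul, one_mul] at this
  rw [← this]
  exact d.expectile_mono hXY

end IsDuet

namespace DuetExpectile.IsRepresentation

theorem isDuet (h : IsRepresentation hC μ R u P Q α) : IsDuet P Q α :=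
  ⟨h.prob_P, h.prob_Q, h.ac_PQ.1, h.ac_PQ.2, h.weight.1, by linarith [h.weight.2]⟩

theorem pref_iff (h : IsRepresentation hC μ R u P Q α) (f g : Act Ω C) :
    R f g ↔ duetExpectile P Q α (g.map u) ≤ duetExpectile P Q α (f.map u) := h.represents f g

theorem strict_iff (h : IsRepresentation hC μ R u P Q α) (f g : Act Ω C) :
    Strict R f g ↔ duetExpectile P Q α (g.map u) < duetExpectile P Q α (f.map u) := by
  rw [Strict, h.pref_iff, h.pref_iff, not_le]
  exact ⟨fun hh => hh.2, fun hh => ⟨hh.le, hh⟩⟩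

theorem expectile_constAct (h : IsRepresentation hC μ R u P Q α) (x : C) :
    duetExpectile P Q α ((constAct Ω x).map u) = u x :=
  h.isDuet.expectile_const (u x)

theorem const_iff (h : IsRepresentation hC μ R u P Q α) (x y : C) :
    R (constAct Ω x) (constAct Ω y) ↔ u y ≤ u x := by
  rw [h.pref_iff, h.expectile_constAct, h.expectile_constAct]

theorem strict_const_iff (h : IsRepresentation hC μ R u P Q α) (x y : C) :
    Strict R (constAct Ω x) (constAct Ω y) ↔ u y < u x := by
  rw [h.strict_iff, h.expectile_constAct, h.expectile_constAct]

theorem map_mixAct (h : IsRepresentation hC μ R u P Q α) (l : Set.Icc (0 : ℝ) 1) (f g : Act Ω C) :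
    (mixAct hC l f g).map u = (l : ℝ) • f.map u + (1 - (l : ℝ)) • g.map u := by
  ext ω
  exact h.affine l (f ω) (g ω)

theorem strictMonotonicity (h : IsRepresentation hC μ R u P Q α) : StrictMonotonicity μ R := by
  intro f g hfg
  have hle : ∀ ω, u (g ω) ≤ u (f ω) := fun ω => (h.const_iff _ _).1 (hfg ω)
  refine ⟨(h.pref_iff _ _).2 (h.isDuet.expectile_mono hle), fun hpos => (h.strict_iff _ _).2
    (h.isDuet.expectile_strict hle fun hz => ?_)⟩
  have := h.ac_Qμ.2 hz
  refine hpos.ne' ?_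
  rwa [show {ω | Strict R (constAct Ω (f ω)) (constAct Ω (g ω))} =
    {ω | (g.map u) ω < (f.map u) ω} from Set.ext fun ω => h.strict_const_iff _ _]

theorem independence (h : IsRepresentation hC μ R u P Q α) : Independence hC R := by
  intro x y z l hl hxy
  rw [h.strict_const_iff] at hxy ⊢
  rw [h.affine, h.affine]
  have := mul_lt_mul_of_pos_left hxy hl
  linarith

theorem archimedeanContinuity (h : IsRepresentation hC μ R u P Q α) :
    ArchimedeanContinuity hC R := by
  intro f g k hfg hgk
  rw [h.strict_iff] at hfg hgk
  set X := f.map u with hX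
  set Y := k.map u with hY
  set M := simpleBound X + simpleBound Y with hM
  have hM0 : 0 < M := by linarith [one_le_simpleBound X, one_le_simpleBound Y]
  have hd : ∀ ω, |X ω - Y ω| ≤ M := fun ω =>
    (abs_sub _ _).trans (add_le_add (abs_le_simpleBound X ω) (abs_le_simpleBound Y ω))
  have pick : ∀ δ : ℝ, 0 < δ → ∃ e : ℝ, 0 < e ∧ e < 1 ∧ e * M < δ := by
    intro δ hδ
    refine ⟨min (1 / 2) (δ / (2 * M)), lt_min (by norm_num) (by positivity),
      (min_le_left _ _).trans_lt (by norm_num), ?_⟩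
    calc min (1 / 2) (δ / (2 * M)) * M ≤ δ / (2 * M) * M :=
          mul_le_mul_of_nonneg_right (min_le_right _ _) hM0.le
      _ = δ / 2 := by field_simp
      _ < δ := by linarith
  obtain ⟨a, ha0, ha1, ha⟩ := pick _ (sub_pos.2 hfg)
  obtain ⟨b, hb0, hb1, hb⟩ := pick _ (sub_pos.2 hgk)
  refine ⟨⟨1 - a, by linarith, by linarith⟩, ⟨b, hb0.le, hb1.le⟩, ⟨by simpa, by simpa⟩, ⟨hb0, hb1⟩,
    ?_, ?_⟩
  · rw [h.strict_iff, h.map_mixAct]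
    have := h.isDuet.expectile_le_add (X := X) (Y := (1 - a) • X + (1 - (1 - a)) • Y) (c := a * M)
      fun ω => by
        have := mul_le_mul_of_nonneg_left (abs_le.1 (hd ω)).2 ha0.le
        simp only [SimpleFunc.coe_add, SimpleFunc.coe_smul, Pi.add_apply, Pi.smul_apply,
          smul_eq_mul]
        linarith
    simp only
    linarith
  · rw [h.strict_iff, h.map_mixAct]
    have := h.isDuet.expectile_le_add (X := b • X + (1 - b) • Y) (Y := Y) (c := b * M)
      fun ω => by
        have := mul_le_mul_of_nonneg_left (abs_le.1 (hd ω)).2 hb0.le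
        simp only [SimpleFunc.coe_add, SimpleFunc.coe_smul, Pi.add_apply, Pi.smul_apply,
          smul_eq_mul]
        linarith
    simp only
    linarith

theorem disappointment_eq (h : IsRepresentation hC μ R u P Q α) (f : Act Ω C) :
    disappointment R f = {ω | u (f ω) < duetExpectile P Q α (f.map u)} := by
  ext ω
  simp only [disappointment, Set.mem_ofPred_eq, h.strict_iff, h.expectile_constAct]

/-- The gains relative to the expectile have the same negative set for disco acts, so the gain is
linear on their mixtures, and superlinear on others. -/
theorem discoAversion (h : IsRepresentation hC μ R u P Q α) : DiscoAversion hC R := by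
  have := h.prob_P
  have := h.prob_Q
  intro f g k hfg hgk a ha
  have d := h.isDuet
  have ha1 : 0 ≤ 1 - (a : ℝ) := sub_nonneg.2 a.2.2
  rw [Disco, h.disappointment_eq, h.disappointment_eq] at hfg
  have hEq : duetExpectile P Q α (g.map u) = duetExpectile P Q α (k.map u) :=
    le_antisymm ((h.pref_iff _ _).1 hgk.2) ((h.pref_iff _ _).1 hgk.1)
  set yf := duetExpectile P Q α (f.map u) with hyf
  set yg := duetExpectile P Q α (g.map u) with hyg
  have e : ∀ k : Act Ω C, (a : ℝ) • f.map u + (1 - (a : ℝ)) • k.map u -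
      SimpleFunc.const Ω ((a : ℝ) * yf + (1 - (a : ℝ)) * yg) =
        (a : ℝ) • (f.map u - SimpleFunc.const Ω yf) +
          (1 - (a : ℝ)) • (k.map u - SimpleFunc.const Ω yg) := fun k => by
    ext ω; simp; ring
  have e1 : duetExpectile P Q α ((mixAct hC a f g).map u) = a * yf + (1 - (a : ℝ)) * yg := by
    refine d.duetExpectile_eq ?_
    rw [h.map_mixAct, e, duetGain_mix_eq ha.1.le ha1, d.gain_duetExpectile, d.gain_duetExpectile,
      mul_zero, mul_zero, add_zero]
    intro ω
    have : ω ∈ {ω | u (f ω) < yf} ↔ ω ∈ {ω | u (g ω) < yg} := by rw [hfg]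
    simpa using this
  rw [h.pref_iff, e1, d.le_iff, h.map_mixAct, e]
  refine le_trans ?_ (le_duetGain_mix d.pos.le d.lt_one.le h.le _ _ ha.1.le ha1)
  rw [d.gain_duetExpectile, hEq, d.gain_duetExpectile, mul_zero, mul_zero, add_zero]

theorem nonDegeneracy (h : IsRepresentation hC μ R u P Q α) : NonDegeneracy R := by
  obtain ⟨x, y, hxy⟩ := h.nonconstant
  rcases hxy.lt_or_gt with hlt | hlt
  · exact ⟨_, _, (h.strict_const_iff y x).2 hlt⟩
  · exact ⟨_, _, (h.strict_const_iff x y).2 hlt⟩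

theorem monotoneContinuity (h : IsRepresentation hC μ R u P Q α) : MonotoneContinuity R := by
  have := h.prob_P
  have := h.prob_Q
  intro x y z hxy A hA hanti hempty
  have d := h.isDuet
  rw [h.strict_const_iff] at hxy
  have hlim : Filter.Tendsto (fun n => Q.real (A n)) Filter.atTop (nhds 0) := by
    have := tendsto_measure_iInter_atTop (μ := Q) (fun n => (hA n).nullMeasurableSet) hanti
      ⟨0, measure_ne_top _ _⟩
    rw [hempty, measure_empty] at this
    exact (ENNReal.tendsto_toReal ENNReal.zero_ne_top).comp this
  have hlim' := hlim.const_mul ((1 - α) * |u x - u z|)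
  rw [mul_zero] at hlim'
  obtain ⟨n, hn⟩ := (hlim'.eventually_lt_const (mul_pos d.pos (sub_pos.2 hxy))).exists
  refine ⟨n, ?_⟩
  rw [h.strict_iff, h.expectile_constAct, d.lt_iff]
  -- the gain is at least that of the riskless gain `u x - u y` plus that of a loss on `A n`
  have low := le_duetGain_mix d.pos.le d.lt_one.le h.le (SimpleFunc.const Ω (u x - u y))
    (-ind (A n)) zero_le_one (abs_nonneg (u x - u z))
  rw [d.gain_const, duetGain_neg_ind P Q α (hA n), max_eq_left (sub_pos.2 hxy).le,
    max_eq_right (by linarith)] at low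
  have up : duetGain P Q α ((1 : ℝ) • SimpleFunc.const Ω (u x - u y) +
      |u x - u z| • -ind (A n)) ≤
      duetGain P Q α ((betAct (A n) (hA n) z x).map u - SimpleFunc.const Ω (u y)) := by
    refine duetGain_mono d.pos.le d.lt_one.le fun ω => ?_
    simp only [SimpleFunc.coe_add, SimpleFunc.coe_smul, Pi.add_apply, Pi.smul_apply,
      smul_eq_mul, SimpleFunc.coe_neg, Pi.neg_apply, SimpleFunc.const_apply, SimpleFunc.coe_sub,
      Pi.sub_apply, SimpleFunc.map_apply, one_mul]
    by_cases hω : ω ∈ A n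
    · have := le_abs_self (u x - u z)
      simp only [ind_of_mem (hA n) hω, betAct, SimpleFunc.piecewise_apply, hω, if_true,
        SimpleFunc.const_apply]
      linarith
    · simp only [ind_of_notMem (hA n) hω, betAct, SimpleFunc.piecewise_apply, hω, if_false,
        SimpleFunc.const_apply]
      linarith
  linarith

end DuetExpectile.IsRepresentation

end Necessity

/-! ### Uniqueness -/

section Uniqueness

variable {Ω E : Type*} [MeasurableSpace Ω] [AddCommGroup E] [Module ℝ E] {C : Set E}

/-- Affine utilities are cardinally unique. -/
theorem exists_affine_eq (hC : Convex ℝ C) {u v : C → ℝ} (hu : IsAffineUtility hC u)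
    (hv : IsAffineUtility hC v) (huv : ∀ x y, u x ≤ u y ↔ v x ≤ v y) {x₀ x₁ : C}
    (h01 : u x₀ < u x₁) : ∃ a b : ℝ, 0 < a ∧ ∀ x, v x = a * u x + b := by
  have v01 : v x₀ < v x₁ := by
    rw [← not_le, ← huv, not_le]
    exact h01
  have du : 0 < u x₁ - u x₀ := sub_pos.2 h01
  refine ⟨(v x₁ - v x₀) / (u x₁ - u x₀), v x₀ - (v x₁ - v x₀) / (u x₁ - u x₀) * u x₀,
    div_pos (sub_pos.2 v01) du, fun z => ?_⟩
  -- contract `z` towards the midpoint, until its utility lies between those of `x₀` and `x₁`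
  set w := (u z - u x₀) / (u x₁ - u x₀) with hw
  have huz : u z = u x₀ + w * (u x₁ - u x₀) := by rw [hw]; field_simp; ring
  have hden : 0 < 2 * |w - 1 / 2| + 1 := by positivity
  set s := 1 / (2 * |w - 1 / 2| + 1) with hs
  have hs0 : 0 < s := by positivity
  have hs1 : s ≤ 1 := by
    rw [hs, div_le_one hden]
    linarith [abs_nonneg (w - 1 / 2)]
  have hsw : s * |w - 1 / 2| ≤ 1 / 2 := by
    rw [hs, one_div_mul_eq_div, div_le_iff₀ hden]
    linarith
  have habs : |s * (w - 1 / 2)| ≤ 1 / 2 := by rwa [abs_mul, abs_of_pos hs0]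
  obtain ⟨l1, l2⟩ := abs_le.1 habs
  set half : Set.Icc (0 : ℝ) 1 := ⟨1 / 2, by norm_num, by norm_num⟩
  set S : Set.Icc (0 : ℝ) 1 := ⟨s, hs0.le, hs1⟩
  set t : Set.Icc (0 : ℝ) 1 := ⟨s * w + (1 - s) / 2, by linarith, by linarith⟩
  have hval : ∀ {f : C → ℝ}, IsAffineUtility hC f →
      f (mixOutcome hC S z (mixOutcome hC half x₁ x₀)) =
        s * f z + (1 - s) * (1 / 2 * f x₁ + (1 - 1 / 2) * f x₀) ∧
      f (mixOutcome hC t x₁ x₀) =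
        (s * w + (1 - s) / 2) * f x₁ + (1 - (s * w + (1 - s) / 2)) * f x₀ := fun hf => by
    rw [hf, hf, hf]
    exact ⟨rfl, rfl⟩
  have e1 : u (mixOutcome hC S z (mixOutcome hC half x₁ x₀)) = u (mixOutcome hC t x₁ x₀) := by
    rw [(hval hu).1, (hval hu).2, huz]
    ring
  have e2 := le_antisymm ((huv _ _).1 e1.le) ((huv _ _).1 e1.ge)
  rw [(hval hv).1, (hval hv).2] at e2
  have e3 : s * (v z - (v x₀ + w * (v x₁ - v x₀))) = 0 := by linear_combination e2
  have e4 := (mul_eq_zero.1 e3).resolve_left hs0.ne'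
  rw [sub_eq_zero.1 e4, hw]
  field_simp
  ring

variable {P Q P' Q' : Measure Ω} {α α' : ℝ}

/-- The expectile of a bet on `A` equates the weighted gain on `A` and the weighted loss off
`A`. -/
theorem IsDuet.expectile_ind (d : IsDuet P Q α) {A : Set Ω} (hA : MeasurableSet A) :
    0 ≤ duetExpectile P Q α (ind A) ∧ duetExpectile P Q α (ind A) ≤ 1 ∧
      α * P.real A * (1 - duetExpectile P Q α (ind A)) =
        (1 - α) * Q.real Aᶜ * duetExpectile P Q α (ind A) := by
  have h0 : 0 ≤ duetExpectile P Q α (ind A) := by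
    rw [← d.expectile_const 0]
    exact d.expectile_mono (ind_nonneg hA)
  have h1 : duetExpectile P Q α (ind A) ≤ 1 := by
    rw [← d.expectile_const 1]
    exact d.expectile_mono (ind_le_one hA)
  refine ⟨h0, h1, ?_⟩
  have hg := d.gain_duetExpectile (ind A)
  set y := duetExpectile P Q α (ind A)
  have e1 : ∀ ω, max ((ind A - SimpleFunc.const Ω y) ω) 0 = A.indicator (fun _ => 1 - y) ω := by
    intro ω
    by_cases hω : ω ∈ A
    · simp [ind_of_mem hA hω, hω, h1]
    · simp [ind_of_notMem hA hω, hω, h0]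
  have e2 : ∀ ω, max (-(ind A - SimpleFunc.const Ω y) ω) 0 = Aᶜ.indicator (fun _ => y) ω := by
    intro ω
    by_cases hω : ω ∈ A
    · simp [ind_of_mem hA hω, hω, h1]
    · simp [ind_of_notMem hA hω, hω, h0]
  simp only [duetGain, e1, e2, integral_indicator_const _ hA, integral_indicator_const _ hA.compl,
    smul_eq_mul] at hg
  linarith

theorem cross_eq (d : IsDuet P Q α) (d' : IsDuet P' Q' α') {A : Set Ω} (hA : MeasurableSet A)
    (hEq : duetExpectile P' Q' α' (ind A) = duetExpectile P Q α (ind A)) :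
    α * P.real A * ((1 - α') * Q'.real Aᶜ) = α' * P'.real A * ((1 - α) * Q.real Aᶜ) := by
  obtain ⟨-, -, h⟩ := d.expectile_ind hA
  obtain ⟨-, -, h'⟩ := d'.expectile_ind hA
  rw [hEq] at h'
  set y := duetExpectile P Q α (ind A)
  rcases eq_or_ne y 0 with hy | hy
  · rw [hy, sub_zero, mul_one, mul_zero] at h h'
    rw [h, h', zero_mul, zero_mul]
  · refine mul_right_cancel₀ hy ?_
    linear_combination α' * P'.real A * h - α * P.real A * h'

/-- Given a partition into three cells, ratios `p i / p' i` and `q i / q' i` such that each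
`p`-ratio is a mean of the other cells' `q`-ratios and vice versa, all ratios are equal to a `p`-ratio
that is maximal. -/
theorem ratio_rigid {p q p' q' : Fin 3 → ℝ} (hp' : ∀ i, 0 < p' i) (hq' : ∀ i, 0 < q' i)
    (hpq : ∀ i j k, i ≠ j → j ≠ k → i ≠ k → p i * (q' j + q' k) = p' i * (q j + q k))
    (hqp : ∀ i j k, i ≠ j → j ≠ k → i ≠ k → q i * (p' j + p' k) = q' i * (p j + p k))
    {M : ℝ} (hpM : ∀ i, p i ≤ M * p' i) (hqM : ∀ i, q i ≤ M * q' i) {i : Fin 3}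
    (hi : p i = M * p' i) : ∀ l, p l = M * p' l ∧ q l = M * q' l := by
  -- a maximal ratio forces the opposite ratios of the two other cells to be maximal
  have stepP : ∀ {i j k}, i ≠ j → j ≠ k → i ≠ k → p i = M * p' i → q j = M * q' j := by
    intro i j k h1 h2 h3 he
    have e := hpq i j k h1 h2 h3
    rw [he] at e
    have e' : p' i * (M * (q' j + q' k) - (q j + q k)) = 0 := by linear_combination e
    have e'' := (mul_eq_zero.1 e').resolve_left (hp' i).ne'
    linarith [hqM j, hqM k]
  have stepQ : ∀ {i j k}, i ≠ j → j ≠ k → i ≠ k → q i = M * q' i → p j = M * p' j := by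
    intro i j k h1 h2 h3 he
    have e := hqp i j k h1 h2 h3
    rw [he] at e
    have e' : q' i * (M * (p' j + p' k) - (p j + p k)) = 0 := by linear_combination e
    have e'' := (mul_eq_zero.1 e').resolve_left (hq' i).ne'
    linarith [hpM j, hpM k]
  obtain ⟨j, k, hij, hjk, hik⟩ : ∃ j k : Fin 3, i ≠ j ∧ j ≠ k ∧ i ≠ k := by
    have : ∀ i : Fin 3, ∃ j k, i ≠ j ∧ j ≠ k ∧ i ≠ k := by decide
    exact this i
  have qj := stepP hij hjk hik hi
  have qk := stepP hik hjk.symm hij hi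
  have pk := stepQ hjk hik.symm hij.symm qj
  have pj := stepQ hjk.symm hij.symm hik.symm qk
  have qi := stepP hij.symm hik hjk pj
  intro l
  have hl : ∀ i j k l : Fin 3, i ≠ j → j ≠ k → i ≠ k → l = i ∨ l = j ∨ l = k := by decide
  rcases hl i j k l hij hjk hik with rfl | rfl | rfl
  exacts [⟨hi, qi⟩, ⟨pj, qj⟩, ⟨pk, qk⟩]

theorem exists_ratio {p q p' q' : Fin 3 → ℝ} (hp' : ∀ i, 0 < p' i) (hq' : ∀ i, 0 < q' i)
    (hpq : ∀ i j k, i ≠ j → j ≠ k → i ≠ k → p i * (q' j + q' k) = p' i * (q j + q k))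
    (hqp : ∀ i j k, i ≠ j → j ≠ k → i ≠ k → q i * (p' j + p' k) = q' i * (p j + p k)) :
    ∃ M : ℝ, ∀ l, p l = M * p' l ∧ q l = M * q' l := by
  obtain ⟨i, hi⟩ := Finite.exists_max fun i => p i / p' i
  obtain ⟨j, hj⟩ := Finite.exists_max fun i => q i / q' i
  have hpi : ∀ l, p l ≤ p i / p' i * p' l := fun l => (div_le_iff₀ (hp' l)).1 (hi l)
  have hqj : ∀ l, q l ≤ q j / q' j * q' l := fun l => (div_le_iff₀ (hq' l)).1 (hj l)
  rcases le_total (q j / q' j) (p i / p' i) with h | h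
  · exact ⟨_, ratio_rigid hp' hq' hpq hqp hpi
      (fun l => (hqj l).trans (mul_le_mul_of_nonneg_right h (hq' l).le))
      (div_mul_cancel₀ _ (hp' i).ne').symm⟩
  · have := ratio_rigid hq' hp' hqp hpq hqj
      (fun l => (hpi l).trans (mul_le_mul_of_nonneg_right h (hp' l).le))
      (div_mul_cancel₀ _ (hq' j).ne').symm
    exact ⟨_, fun l => (this l).symm⟩

/-- Two duet expectiles that agree on bets have the same parameters. -/
theorem duet_unique {μ : Measure Ω} [IsProbabilityMeasure μ] (hμ : IsStandardSpace μ)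
    (d : IsDuet P Q α) (d' : IsDuet P' Q' α') (hQ : Q ≪ μ) (hQ' : Q' ≪ μ)
    (hμQ' : μ ≪ Q') (hEq : ∀ A, MeasurableSet A →
      duetExpectile P' Q' α' (ind A) = duetExpectile P Q α (ind A)) :
    P' = P ∧ Q' = Q ∧ α' = α := by
  have iP := d.prob_P
  have iQ := d.prob_Q
  have iP' := d'.prob_P
  have iQ' := d'.prob_Q
  have hα := sub_pos.2 d.lt_one
  have hα' := sub_pos.2 d'.lt_one
  have rpos : ∀ {M : Measure Ω} [IsProbabilityMeasure M], μ ≪ M → ∀ {A : Set Ω}, 0 < μ A →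
      0 < M.real A := fun {M} _ hM {A} hA =>
    ENNReal.toReal_pos (fun hz => hA.ne' (hM hz)) (measure_ne_top _ _)
  have main : ∀ A, IsProper μ A → α' = α ∧ P'.real A = P.real A ∧ Q'.real A = Q.real A := by
    classical
    intro A hA
    obtain ⟨T, hT, hsplit⟩ := exists_split hμ (ι := Unit) (E := fun _ => Aᶜ)
      (fun _ => hA.meas.compl) (fun _ => hA.compl_pos)
    obtain ⟨hT0, hT1⟩ := hsplit ()
    -- the cells `A`, `Aᶜ ∩ T` and `Aᶜ \ T`
    set label : Ω → Fin 3 := fun ω => if ω ∈ A then 0 else if ω ∈ T then 1 else 2 with hlabel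
    set cell : Fin 3 → Set Ω := fun i => label ⁻¹' {i} with hcell
    have c0 : cell 0 = A := by
      ext ω
      by_cases h1 : ω ∈ A <;> by_cases h2 : ω ∈ T <;> simp [hcell, hlabel, h1, h2]
    have c1 : cell 1 = Aᶜ ∩ T := by
      ext ω
      by_cases h1 : ω ∈ A <;> by_cases h2 : ω ∈ T <;> simp [hcell, hlabel, h1, h2]
    have c2 : cell 2 = Aᶜ \ T := by
      ext ω
      by_cases h1 : ω ∈ A <;> by_cases h2 : ω ∈ T <;> simp [hcell, hlabel, h1, h2]
    have hm : ∀ i, MeasurableSet (cell i) := by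
      intro i
      fin_cases i
      exacts [c0 ▸ hA.meas, c1 ▸ hA.meas.compl.inter hT, c2 ▸ hA.meas.compl.diff hT]
    have hpos : ∀ i, 0 < μ (cell i) := by
      intro i
      fin_cases i
      exacts [c0 ▸ hA.pos, c1 ▸ hT0, c2 ▸ hT1]
    have hcompl : ∀ {M : Measure Ω} [IsProbabilityMeasure M] {i j k : Fin 3}, i ≠ j → j ≠ k →
        i ≠ k → M.real (cell i)ᶜ = M.real (cell j) + M.real (cell k) := by
      intro M _ i j k hij hjk hik
      rw [← measureReal_union _ (hm k)]
      · congr 1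
        ext ω
        have : ∀ i j k l : Fin 3, i ≠ j → j ≠ k → i ≠ k → (¬ l = i ↔ l = j ∨ l = k) := by decide
        exact this i j k (label ω) hij hjk hik
      · rw [Set.disjoint_left]
        intro ω h1 h2
        exact hjk (h1.symm.trans h2)
    have hunion : ∀ {M : Measure Ω} [IsProbabilityMeasure M] {i j k : Fin 3}, i ≠ j → j ≠ k →
        i ≠ k → M.real (cell i) + M.real (cell j) + M.real (cell k) = 1 := by
      intro M _ i j k hij hjk hik
      rw [add_assoc, ← hcompl hij hjk hik, probReal_compl_eq_one_sub (hm i)]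
      ring
    obtain ⟨r, hr⟩ := exists_ratio (p := fun i => α * P.real (cell i))
      (q := fun i => (1 - α) * Q.real (cell i)) (p' := fun i => α' * P'.real (cell i))
      (q' := fun i => (1 - α') * Q'.real (cell i))
      (fun i => mul_pos d'.pos (rpos (hμQ'.trans d'.ac_QP) (hpos i)))
      (fun i => mul_pos hα' (rpos hμQ' (hpos i)))
      (fun i j k hij hjk hik => by
        have := cross_eq d d' (hm i) (hEq _ (hm i))
        rw [hcompl hij hjk hik, hcompl hij hjk hik] at this
        linear_combination this)
      (fun i j k hij hjk hik => by
        have := cross_eq d d' (hm i).compl (hEq _ (hm i).compl)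
        rw [compl_compl, hcompl hij hjk hik, hcompl hij hjk hik] at this
        linear_combination -this)
    have sP := hunion (M := P) (i := 0) (j := 1) (k := 2) (by decide) (by decide) (by decide)
    have sP' := hunion (M := P') (i := 0) (j := 1) (k := 2) (by decide) (by decide) (by decide)
    have sQ := hunion (M := Q) (i := 0) (j := 1) (k := 2) (by decide) (by decide) (by decide)
    have sQ' := hunion (M := Q') (i := 0) (j := 1) (k := 2) (by decide) (by decide) (by decide)
    obtain ⟨p0, q0⟩ := hr 0
    obtain ⟨p1, q1⟩ := hr 1
    obtain ⟨p2, q2⟩ := hr 2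
    have ea : α = r * α' := by linear_combination p0 + p1 + p2 - α * sP + r * α' * sP'
    have eb : 1 - α = r * (1 - α') := by
      linear_combination q0 + q1 + q2 - (1 - α) * sQ + r * (1 - α') * sQ'
    have er : r = 1 := by linarith
    rw [er, one_mul] at ea p0 q0
    rw [c0] at p0 q0
    rw [← ea] at p0 q0
    exact ⟨ea.symm, (mul_left_cancel₀ d.pos.ne' p0).symm, (mul_left_cancel₀ hα.ne' q0).symm⟩
  have ext : ∀ {M N : Measure Ω} [IsProbabilityMeasure M] [IsProbabilityMeasure N], M ≪ μ →
      N ≪ μ → (∀ A, IsProper μ A → M.real A = N.real A) → M = N := by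
    intro M N _ _ hM hN hMN
    refine Measure.ext fun A hA => ?_
    rcases eq_or_ne (μ A) 0 with hz | hz
    · rw [hM hz, hN hz]
    rcases eq_or_ne (μ Aᶜ) 0 with hz' | hz'
    · rw [(prob_compl_eq_zero_iff hA).1 (hM hz'), (prob_compl_eq_zero_iff hA).1 (hN hz')]
    · exact (measureReal_eq_measureReal_iff).1
        (hMN A ⟨hA, pos_iff_ne_zero.2 hz, pos_iff_ne_zero.2 hz'⟩)
  obtain ⟨S, hS, -⟩ := exists_generic hμ (ι := Unit) (D := fun _ => Set.univ)
    (E := fun _ => Set.univ) (fun _ => MeasurableSet.univ) (fun _ => MeasurableSet.univ)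
    (fun _ => by simp)
  exact ⟨ext (d'.ac_PQ.trans hQ') (d.ac_PQ.trans hQ) fun A hA => (main A hA).2.1,
    ext hQ' hQ fun A hA => (main A hA).2.2, (main S hS).1⟩

namespace DuetExpectile.IsRepresentation

variable {hC : Convex ℝ C} {μ : Measure Ω} {R : Act Ω C → Act Ω C → Prop} {u u' : C → ℝ}

theorem of_affine (h : IsRepresentation hC μ R u P Q α) {a b : ℝ} (ha : 0 < a)
    (hu : ∀ x, u' x = a * u x + b) : IsRepresentation hC μ R u' P Q α := by
  refine { h with
    affine := fun l x y => by rw [hu, hu, hu, h.affine]; ring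
    nonconstant := ?_
    represents := fun f g => ?_ }
  · obtain ⟨x, y, hxy⟩ := h.nonconstant
    refine ⟨x, y, fun he => hxy ?_⟩
    rw [hu, hu, add_left_inj] at he
    exact mul_left_cancel₀ ha.ne' he
  · have e : ∀ f : Act Ω C, duetExpectile P Q α (fun ω => u' (f ω)) =
        a * duetExpectile P Q α (f.map u) + b := by
      intro f
      rw [← h.isDuet.expectile_affine ha.le]
      congr 1
      ext ω
      exact hu _
    rw [h.pref_iff, e, e, ge_iff_le, add_le_add_iff_right, mul_le_mul_iff_right₀ ha]

/-- Both representations assign the same expectile to the bet on `A` between two outcomes, because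
both must identify its certainty equivalent. -/
theorem expectile_ind_eq (h : IsRepresentation hC μ R u P Q α)
    (h' : IsRepresentation hC μ R u' P' Q' α') {x₀ x₁ : C} (h01 : u x₀ < u x₁) {A : Set Ω}
    (hA : MeasurableSet A) :
    duetExpectile P' Q' α' (ind A) = duetExpectile P Q α (ind A) := by
  have h01' : u' x₀ < u' x₁ := by rwa [← h'.strict_const_iff, h.strict_const_iff]
  obtain ⟨y0, y1, -⟩ := h.isDuet.expectile_ind hA
  set y := duetExpectile P Q α (ind A)
  have bet : ∀ {v : C → ℝ} {P Q : Measure Ω} {α : ℝ}, IsDuet P Q α → v x₀ < v x₁ →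
      duetExpectile P Q α ((betAct A hA x₁ x₀).map v) =
        (v x₁ - v x₀) * duetExpectile P Q α (ind A) + v x₀ := by
    intro v P Q α d hv
    rw [← d.expectile_affine (sub_pos.2 hv).le]
    congr 1
    ext ω
    by_cases hω : ω ∈ A
    · simp [ind_of_mem hA hω, betAct, hω]
    · simp [ind_of_notMem hA hω, betAct, hω]
  set x := mixOutcome hC ⟨y, y0, y1⟩ x₁ x₀ with hx
  have hux : u x = duetExpectile P Q α ((betAct A hA x₁ x₀).map u) := by
    rw [bet h.isDuet h01, hx, h.affine]
    simp only
    ring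
  have r1 : R (betAct A hA x₁ x₀) (constAct Ω x) := by
    rw [h.pref_iff, h.expectile_constAct, hux]
  have r2 : R (constAct Ω x) (betAct A hA x₁ x₀) := by
    rw [h.pref_iff, h.expectile_constAct, hux]
  rw [h'.pref_iff, h'.expectile_constAct] at r1 r2
  have e := le_antisymm r1 r2
  rw [bet h'.isDuet h01', hx, h'.affine] at e
  simp only at e
  have e' : (u' x₁ - u' x₀) * (duetExpectile P' Q' α' (ind A) - y) = 0 := by linear_combination -e
  exact sub_eq_zero.1 ((mul_eq_zero.1 e').resolve_left (sub_pos.2 h01').ne')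

theorem unique [IsProbabilityMeasure μ] (hμ : IsStandardSpace μ)
    (h : IsRepresentation hC μ R u P Q α) (h' : IsRepresentation hC μ R u' P' Q' α') :
    P' = P ∧ Q' = Q ∧ α' = α ∧ ∃ a b : ℝ, 0 < a ∧ ∀ x : C, u' x = a * u x + b := by
  obtain ⟨x₀, x₁, h01⟩ : ∃ x₀ x₁, u x₀ < u x₁ := by
    obtain ⟨x, y, hxy⟩ := h.nonconstant
    rcases hxy.lt_or_gt with hlt | hlt
    exacts [⟨_, _, hlt⟩, ⟨_, _, hlt⟩]
  obtain ⟨e1, e2, e3⟩ := duet_unique hμ h.isDuet h'.isDuet h.ac_Qμ.1 h'.ac_Qμ.1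
    h'.ac_Qμ.2 fun A hA => h.expectile_ind_eq h' h01 hA
  exact ⟨e1, e2, e3, exists_affine_eq hC h.affine h'.affine
    (fun x y => by rw [← h.const_iff, h'.const_iff]) h01⟩

end DuetExpectile.IsRepresentation

end Uniqueness

theorem theorem5 {Ω E : Type*} [MeasurableSpace Ω] [AddCommGroup E] [Module ℝ E]
    (μ : Measure Ω) [IsProbabilityMeasure μ] (hμ : IsStandardSpace μ)
    (C : Set E) (hC : Convex ℝ C)
    (R : Act Ω C → Act Ω C → Prop) (hR : IsPreference μ R) :
    ((StrictMonotonicity μ R ∧ Independence hC R ∧ ArchimedeanContinuity hC R ∧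
        DiscoAversion hC R ∧ NonDegeneracy R ∧ MonotoneContinuity R) ↔
      ∃ (u : C → ℝ) (P Q : Measure Ω) (α : ℝ), IsRepresentation hC μ R u P Q α) ∧
    (∀ (u : C → ℝ) (P Q : Measure Ω) (α : ℝ), IsRepresentation hC μ R u P Q α →
      ∀ (u' : C → ℝ) (P' Q' : Measure Ω) (α' : ℝ),
        IsRepresentation hC μ R u' P' Q' α' ↔
          (P' = P ∧ Q' = Q ∧ α' = α ∧ ∃ a b : ℝ, 0 < a ∧ ∀ x : C, u' x = a * u x + b)) := by
  refine ⟨⟨?_, ?_⟩, fun u P Q α h u' P' Q' α' => ⟨fun h' => h.unique hμ h', ?_⟩⟩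
  · rintro ⟨hSM, hI, hA, hD, hN, hM⟩
    exact exists_representation hC hμ hR hSM hI hA hD hN hM
  · rintro ⟨u, P, Q, α, h⟩
    exact ⟨h.strictMonotonicity, h.independence, h.archimedeanContinuity, h.discoAversion,
      h.nonDegeneracy, h.monotoneContinuity⟩
  · rintro ⟨rfl, rfl, rfl, a, b, ha, hu⟩
    exact h.of_affine ha hu
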